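/- Throughout, $\{0,1\}^*$ is the set of finite binary strings, $\mathbf C=\{0,1\}^\infty$ is Cantor space, $S[0\dots n]$ is the string of the first $n+1$ bits of $S\in\mathbf C$, and $x\sqsubset y$ means that $x$ is a proper prefix of $y$. Natural-number arguments of machines are written in unary, so the pair $(k,w)\in\mathbb N\times\{0,1\}^*$ is coded as $1^k0w$; space counts all stored symbols, including input and output. **Resource classes.** Let $(g_n)_{n\in\mathbb N}$ be functions $g_n:\mathbb N\to\mathbb N$ such that $g_n=o(g_{n+1})$ for all $n$, some computable $h:\mathbb N\to\mathbb N$ satisfies $g_n=o(h)$ for all $n$, and every polynomial is $O(g_n)$ for some $n$. The class $\Delta=\bigcup_n \mathrm{DTIME}(g_n)$ (respectively $\Delta=\bigcup_n\mathrm{DSPACE}(g_n)$) of functions $\{0,1\}^*\to\{0,1\}^*$ is a time (respectively space) bounded resource class, and $\Gamma_R$ is the collection of all of these. A *bound* of $\Delta$ is a function $t:\mathbb N\to\mathbb N$ with $t=O(g_n)$ for some $n$. Call $\Delta$ *robust* if for every $n$ there is an $m$ such that $k\cdot g_n(j)=O(g_m(k))$ uniformly in $j\le 2k$ (this holds, for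 instance, for polynomial time, polynomial space, $\bigcup_c\mathrm{DTIME}(2^{cn})$ and $\bigcup_c\mathrm{DTIME}(2^{n^c})$). **$\Delta$-strong measure zero.** An odds function $O:\{0,1\}^*\to\mathbb Q\cap[1,2]$ is *acceptable* if $\prod_{w\sqsubset S}O(w)=\infty$ for all $S\in\mathbf C$. An *$O$-supermartingale* is a function $d:\{0,1\}^*\to[0,\infty)$ with $d(w)\ge \frac{d(w0)}{O(w0)}+\frac{d(w1)}{O(w1)}$ for all $w$; it *succeeds* on $X\subseteq\mathbf C$ if $\limsup_{n}d(S[0\dots n])=\infty$ for all $S\in X$. A functional $F$ that maps odds functions to functions $\{0,1\}^*\to[0,\infty)$ is *in $\Delta$* if there are a bound $h$ of $\Delta$ and an oracle machine which, for every odds function $O:\{0,1\}^*\to\mathbb Q\cap[1,2]$ given as oracle and every input $(r,w)\in\mathbb N\times\{0,1\}^*$, outputs a nonnegative rational within $2^{-r}$ of $F(O)(w)$ in time (respectively space) at most $h(|w|+r+\bar O(h(|w|+r)))$, where $\bar O(n)$ is the maximum length of the oracle's answer to a query of length at most $n$. A set $X\subseteq\mathbf C$ has *$\Delta$-strong measure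 zero* if there is a functional $F$ in $\Delta$ such that for every acceptable $O:\{0,1\}^*\to\mathbb Q\cap[1,2]$, $F(O)$ is an $O$-supermartingale that succeeds on $X$. **$\Delta$-countability.** A *constructor* is a function $\delta:\{0,1\}^*\to\{0,1\}^*$ with $x\sqsubset\delta(x)$ for all $x$; its *result* $R(\delta)\in\mathbf C$ is the sequence that has all iterates $\delta^i(\lambda)$, where $\lambda$ is the empty string, as prefixes. A set $X\subseteq\mathbf C$ is *$\Delta$-countable* if there is a function $\delta:\mathbb N\times\{0,1\}^*\to\{0,1\}^*$ in $\Delta$ such that every $\delta_k=\delta(k,\cdot)$ is a constructor and $X\subseteq\{R(\delta_k)\mid k\in\mathbb N\}$. **Theorem** (effective Borel conjecture for time or space bounded resource classes). Let $\Delta\in\Gamma_R$ and $X\subseteq\mathbf C$. If $X$ has $\Delta$-strong measure zero, then $X$ is $\Delta$-countable. If moreover $\Delta$ is robust, then $X$ has $\Delta$-strong measure zero if and only if $X$ is $\Delta$-countable. -/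

import Mathlib

open Filter Asymptotics
open scoped NNReal ENNReal

noncomputable section

namespace StrongMeasureZero

/-! ### Strings, sequences and their encodings -/

/-- Finite binary strings, first bit first. -/
abbrev Str := List Bool

/-- Points of Cantor space. -/
abbrev Cantor := ℕ → Bool

/-- The string consisting of the first `n` bits of `S`. -/
def pre (S : Cantor) (n : ℕ) : Str := (List.range n).map S

/-- The pair of strings `x`, `y` coded as `1^|x| 0 x y`. -/
def pairStr (x y : Str) : Str :=
  List.replicate x.length true ++ false :: (x ++ y)

/-- The pair `(k, w)` of a natural number (in unary) and a string coded as `1^k 0 w`. -/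
def encodeNatStr (k : ℕ) (w : Str) : Str :=
  List.replicate k true ++ false :: w

/-- The number with binary expansion `l`, least significant bit first; inverse to `Nat.bits`
on expansions that have no superfluous zeros. -/
def binVal (l : Str) : ℕ := l.foldr Nat.bit 0

/-- The code of a nonnegative rational: the pair of the binary expansions of the numerator and of
the denominator in lowest terms. -/
def encodeRat (q : ℚ) : Str := pairStr q.num.natAbs.bits q.den.bits

/-- The string `s` represents the nonnegative rational `q` as a quotient of binary numbers
(not necessarily in lowest terms). -/
def CodesRat (s : Str) (q : ℚ) : Prop :=
  ∃ a b : Str, s = pairStr a b ∧ binVal b ≠ 0 ∧ q = (binVal a : ℚ) / (binVal b : ℚ)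

/-! ### Machines with bounded time or space

Machines are Mathlib's multi-stack Turing machines `Turing.FinTM2`; a tape is a pair of stacks. -/

/-- The resource that is measured. -/
inductive Resource
  | time
  | space

/-- Number of symbols stored in a configuration: input, output and work space all count. -/
def cfgSize (tm : Turing.FinTM2) (c : tm.Cfg) : ℕ :=
  letI := tm.kFin
  ∑ k : tm.K, (c.stk k).length

/-- The computation with one-step function `step` leads from `c₀` to `c₁` in at most `b` steps
(time), respectively leads from `c₀` to `c₁` and never stores more than `b` symbols (space). -/
def RunsWithin (ρ : Resource) {C : Type} (step : C → Option C) (size : C → ℕ) (c₀ c₁ : C)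
    (b : ℕ) : Prop :=
  match ρ with
  | Resource.time => Nonempty (StateTransition.EvalsToInTime step c₀ (some c₁) b)
  | Resource.space =>
      Nonempty (StateTransition.EvalsTo step c₀ (some c₁)) ∧
        ∀ c, StateTransition.Reaches step c₀ c → size c ≤ b

/-- A machine over binary strings. -/
abbrev StrTM := Turing.TM2ComputableAux Bool Bool

/-- The initial configuration on input `x`. -/
def StrTM.init (M : StrTM) (x : Str) : M.tm.Cfg :=
  Turing.initList M.tm (x.map M.inputAlphabet.symm)

/-- The halting configuration with output `y`. -/
def StrTM.final (M : StrTM) (y : Str) : M.tm.Cfg :=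
  Turing.haltList M.tm (y.map M.outputAlphabet.symm)

/-- The function `f` is computed by a machine whose use of the resource `ρ` on input `x` is at most
`t |x|`. -/
def ComputableWithin (ρ : Resource) (t : ℕ → ℕ) (f : Str → Str) : Prop :=
  ∃ M : StrTM, ∀ x : Str,
    RunsWithin ρ M.tm.step (cfgSize M.tm) (M.init x) (M.final (f x)) (t x.length)

/-- An oracle machine over binary strings: a machine with a query stack, an answer stack, and two
labels. When the label `ask` is reached, the oracle is consulted, and the computation continues
from the label `resume`. -/
structure OracleTM extends Turing.TM2ComputableAux Bool Bool where
  /-- the query stack -/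
  queryStack : tm.K
  /-- the answer stack -/
  answerStack : tm.K
  queryAlphabet : tm.Γ queryStack ≃ Bool
  answerAlphabet : tm.Γ answerStack ≃ Bool
  /-- the label at which the oracle is consulted -/
  ask : tm.Λ
  /-- the label from which the computation continues after a consultation -/
  resume : tm.Λ

open Classical in
/-- One step of an oracle machine with oracle `A`. A consultation takes one step: the query is
erased, and the content of the answer stack is replaced by the answer of the oracle. -/
def OracleTM.step (M : OracleTM) (A : Str → Str) (c : M.tm.Cfg) : Option M.tm.Cfg :=
  if c.l = some M.ask then
    some
      { l := some M.resume
        var := c.var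
        stk := Function.update (Function.update c.stk M.queryStack []) M.answerStack
          ((A ((c.stk M.queryStack).map M.queryAlphabet)).map M.answerAlphabet.symm) }
  else M.tm.step c

/-- On input `x` and with oracle `A`, the oracle machine `M` outputs `y` and uses at most `b` units
of the resource `ρ`. -/
def OracleTM.OutputsWithin (M : OracleTM) (ρ : Resource) (A : Str → Str) (x y : Str) (b : ℕ) :
    Prop :=
  RunsWithin ρ (M.step A) (cfgSize M.tm) (StrTM.init M.toTM2ComputableAux x)
    (StrTM.final M.toTM2ComputableAux y) b

/-- The maximum length of an answer of the oracle `A` to a query of length at most `n`. -/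
def answerLength (A : Str → Str) (n : ℕ) : ℕ :=
  sSup {m | ∃ q : Str, q.length ≤ n ∧ m = (A q).length}

/-! ### Resource classes -/

/-- A time or space bounded resource class that allows at least polynomial time, respectively
polynomial space, given by a sequence `g 0, g 1, …` of resource bounds. -/
structure ResourceClass where
  /-- whether time or space is bounded -/
  kind : Resource
  /-- the bounds -/
  g : ℕ → ℕ → ℕ
  isLittleO_succ : ∀ n, (fun j => (g n j : ℝ)) =o[atTop] (fun j => (g (n + 1) j : ℝ))
  exists_computable : ∃ h : ℕ → ℕ, Computable h ∧
    ∀ n, (fun j => (g n j : ℝ)) =o[atTop] (fun j => (h j : ℝ))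
  polynomial : ∀ d : ℕ, ∃ n C : ℕ, ∀ j : ℕ, j ^ d ≤ C * g n j + C

namespace ResourceClass

variable (Δ : ResourceClass)

/-- `t` is a resource bound of the class: `t = O(g n)` for some `n`. -/
def IsBound (t : ℕ → ℕ) : Prop := ∃ n C : ℕ, ∀ j : ℕ, t j ≤ C * Δ.g n j + C

/-- The functions that belong to the class: the union over `n` of `DTIME(g n)`, respectively of
`DSPACE(g n)`. -/
def functions : Set (Str → Str) :=
  {f | ∃ t : ℕ → ℕ, Δ.IsBound t ∧ ComputableWithin Δ.kind t f}

/-- The class absorbs linear changes of the input length and linear factors: for every `n` there is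
an `m` with `k * g n j = O(g m k)`, uniformly in `j ≤ 2 * k`. -/
def IsRobust : Prop :=
  ∀ n : ℕ, ∃ m C : ℕ, ∀ j k : ℕ, j ≤ 2 * k → k * Δ.g n j ≤ C * Δ.g m k + C

end ResourceClass

/-! ### Odds functions and supermartingales -/

/-- Odds functions with rational values in `[1, 2]`. -/
abbrev Odds := Str → Set.Icc (1 : ℚ) 2

/-- The product of the odds along every sequence is infinite. -/
def Acceptable (O : Odds) : Prop :=
  ∀ S : Cantor,
    Tendsto (fun n => ∏ i ∈ Finset.range n, (((O (pre S i) : ℚ) : ℝ))) atTop atTop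

/-- `d` is an `O`-supermartingale. -/
def IsSupermartingale (O : Odds) (d : Str → ℝ≥0) : Prop :=
  ∀ w : Str,
    (d (w ++ [false]) : ℝ) / ((O (w ++ [false]) : ℚ) : ℝ) +
      (d (w ++ [true]) : ℝ) / ((O (w ++ [true]) : ℚ) : ℝ) ≤ (d w : ℝ)

/-- `d` succeeds on `X`: its values along each element of `X` have limit superior `∞`. -/
def Succeeds (d : Str → ℝ≥0) (X : Set Cantor) : Prop :=
  ∀ S ∈ X, limsup (fun n => (d (pre S (n + 1)) : ℝ≥0∞)) atTop = ⊤

namespace ResourceClass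

variable (Δ : ResourceClass)

/-- The functional `F` belongs to the class: there are a resource bound `h` of the class and an
oracle machine that, for every odds function `O` as oracle and on every input `(r, w)`, outputs a
rational approximation of `F O w` with error at most `2⁻ʳ` and uses at most
`h(|w| + r + ℓ(h(|w| + r)))` units of the resource, where `ℓ(n)` is the maximum length of an answer
of the oracle to a query of length at most `n`. -/
def HasFunctional (F : Odds → Str → ℝ≥0) : Prop :=
  ∃ h : ℕ → ℕ, Δ.IsBound h ∧ ∃ M : OracleTM, ∀ (O : Odds) (r : ℕ) (w : Str),
    ∃ (y : Str) (q : ℚ), CodesRat y q ∧ |(q : ℝ) - (F O w : ℝ)| ≤ (2 : ℝ)⁻¹ ^ r ∧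
      M.OutputsWithin Δ.kind (fun v => encodeRat (O v)) (encodeNatStr r w) y
        (h (w.length + r + answerLength (fun v => encodeRat (O v)) (h (w.length + r))))

/-- `X` has `Δ`-strong measure zero. -/
def HasStrongMeasureZero (X : Set Cantor) : Prop :=
  ∃ F : Odds → Str → ℝ≥0, Δ.HasFunctional F ∧
    ∀ O : Odds, Acceptable O → IsSupermartingale O (F O) ∧ Succeeds (F O) X

end ResourceClass

/-! ### Countability within a resource class -/

/-- A constructor maps every string to a proper extension of it. -/
def IsConstructor (δ : Str → Str) : Prop := ∀ x : Str, x <+: δ x ∧ x ≠ δ x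

/-- `S` is the result of the constructor `δ`: all iterates of `δ` at the empty string are
prefixes of `S`. -/
def IsResult (δ : Str → Str) (S : Cantor) : Prop :=
  ∀ i : ℕ, δ^[i] [] = pre S (δ^[i] []).length

/-- `X` is `Δ`-countable. -/
def ResourceClass.IsCountable (Δ : ResourceClass) (X : Set Cantor) : Prop :=
  ∃ δ : ℕ → Str → Str,
    (∃ f ∈ Δ.functions, ∀ k w, f (encodeNatStr k w) = δ k w) ∧
    (∀ k, IsConstructor (δ k)) ∧
    ∀ S ∈ X, ∃ k, IsResult (δ k) S

end StrongMeasureZero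

end

/-! Strong measure zero implies countability. Use only odds that are 2 on the strings whose length
lies in a set `a`, and 1 elsewhere; they are acceptable when `a` is infinite. For every S in X some
finite `a` already keeps the values of `F` along S at least 4 from some point on (`exists_levels`).
Otherwise lengths could be added one by one. A computation sees only finitely many oracle values
(`HasFunctional.continuous`), so each new length can be put so late that the value along S has just
been at most 5; it can at most double before the next such point. On the resulting infinite set `F`
would stay below 10 along S and fail. A finite `a` is not acceptable, but the supermartingale
inequality passes to it by continuity (`isSupermartingale_levelOdds`). Beyond the maximum of `a` the
odds are 1, so the values decrease along S, and the siblings of the prefixes of S get values that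
tend to 0 (`exists_offBranch_lt`). From some length on, the value at w0 is thus at least 4 if the
next bit after w is 0, and less than 1/2 if it is 1; an approximation with error 1/4, compared with
1, reveals the bit. So S is the result of a constructor that is described by a finite table, which
lists `a` and the first bits of S. The number r of the table also serves as precision. One value of
a constructor costs one run of the machine for `F` with oracle answers of at most 6 symbols, plus
polynomial overhead, so the constructors stay in every class. Countability implies strong measure
zero for robust classes. Bet on all results simultaneously: `branchCapital` is the product of the
sum of 2^-k over those k for which w lies on the branch of the k-th constructor, and of a capital
that depends on the odds only. The capital is 1 plus a sum of gains, where a gain is 0 or a power of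
1/2 that agrees with O - 1 up to a factor 8. Since the capital is at least 1, adding a gain of at
most O - 1 is no more than multiplying by O (`capital_append_le`); and since the product of the odds
is at most exp of the sum of all O - 1, the capital diverges (`tendsto_capital`). Powers of 1/2
reduce the approximation to shifts and additions (`branchCapital_approx`). Whether w lies on a
branch is decided by at most |w| applications of the constructor, so a polynomial number of calls on
inputs of at most linear length suffices; this is where robustness enters. The rest is programming
with multi-stack machines. Programs are fragments with a Hoare-style relation `Frag.Does` whose
single cost bounds either the time or the additional space, so both resources are treated by the
same proofs. -/

open Filter Asymptotics
open scoped NNReal ENNReal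
set_option linter.unusedSectionVars false
set_option linter.unusedSimpArgs false

noncomputable section

namespace StrongMeasureZero

open Turing Turing.TM2 Turing.TM2.Stmt

/-! ### Paths of a deterministic step function -/

/-- `Path step ok c c' t`: `t` steps lead from `c` to `c'`, and all configurations on the way,
including both ends, satisfy `ok`. -/
inductive Path {C : Type} (step : C → Option C) (ok : C → Prop) : C → C → ℕ → Prop
  | refl {c : C} : ok c → Path step ok c c 0
  | cons {c c₁ c' : C} {t : ℕ} : ok c → step c = some c₁ → Path step ok c₁ c' t →
      Path step ok c c' (t + 1)

namespace Path

variable {C : Type} {step : C → Option C} {ok ok' : C → Prop} {c c' c'' : C} {t t' : ℕ}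

theorem ok_right (h : Path step ok c c' t) : ok c' := by
  induction h <;> assumption

theorem mono (hok : ∀ c, ok c → ok' c) (h : Path step ok c c' t) : Path step ok' c c' t := by
  induction h with
  | refl h => exact .refl (hok _ h)
  | cons h hs _ ih => exact .cons (hok _ h) hs ih

theorem trans (h : Path step ok c c' t) (h' : Path step ok c' c'' t') :
    Path step ok c c'' (t + t') := by
  induction h with
  | refl _ => simpa using h'
  | cons h hs _ ih => rw [Nat.add_right_comm]; exact .cons h hs (ih h')

theorem iterate (h : Path step ok c c' t) : (flip Bind.bind step)^[t] (some c) = some c' := by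
  induction h with
  | refl _ => rfl
  | cons _ hs _ ih => rw [Function.iterate_succ_apply]; simpa [flip, hs] using ih

theorem ok_of_reaches (h : Path step ok c c' t) (hc' : step c' = none) {d : C}
    (hd : StateTransition.Reaches step c d) : ok d := by
  induction h with
  | refl h =>
    rcases Relation.ReflTransGen.cases_head hd with rfl | ⟨e, he, _⟩
    · exact h
    · simp [hc'] at he
  | cons h hs _ ih =>
    rcases Relation.ReflTransGen.cases_head hd with rfl | ⟨e, he, hed⟩
    · exact h
    · rw [hs] at he
      cases he
      exact ih hc' hed

theorem of_iterate (n : ℕ) : ∀ {c : C}, (∀ d, StateTransition.Reaches step c d → ok d) →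
    (flip Bind.bind step)^[n] (some c) = some c' → Path step ok c c' n := by
  induction n with
  | zero =>
    intro c hok h
    cases h
    exact .refl (hok _ .refl)
  | succ n ih =>
    intro c hok h
    rw [Function.iterate_succ_apply] at h
    cases hs : step c with
    | none =>
      have hn : ∀ m, (flip Bind.bind step)^[m] (none : Option C) = none := fun m => by
        induction m with
        | zero => rfl
        | succ m ih => rw [Function.iterate_succ_apply]; exact ih
      rw [show flip Bind.bind step (some c) = none from hs, hn] at h
      cases h
    | some d =>
      refine .cons (hok _ .refl) hs (ih (fun e he => hok e (.head hs he)) ?_)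
      simpa [flip, hs] using h

/-- Determinism. It identifies the halting configurations of two runs when the second oracle agrees
with the first on all queries asked. -/
theorem unique (h : Path step ok c c' t) (hc' : step c' = none) (h' : Path step ok' c c'' t')
    (hc'' : step c'' = none) : c' = c'' ∧ t = t' := by
  induction h generalizing t' with
  | refl _ =>
    cases h' with
    | refl _ => exact ⟨rfl, rfl⟩
    | cons _ hs _ => simp [hc'] at hs
  | cons _ hs _ ih =>
    cases h' with
    | refl _ => simp [hc''] at hs
    | cons _ hs' h' =>
      rw [hs] at hs'
      cases hs'
      obtain ⟨h1, h2⟩ := ih hc' h'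
      exact ⟨h1, by rw [h2]⟩

end Path

/-- One path serves both resources: its length is the time, and the invariant `ok` bounds the space
of everything reachable, because the last configuration halts. -/
theorem Path.runsWithin {ρ : Resource} {C : Type} {step : C → Option C} {size : C → ℕ}
    {c c' : C} {t b : ℕ} {ok : C → Prop} (h : Path step ok c c' t) (hc' : step c' = none)
    (ht : ρ = .time → t ≤ b) (hz : ρ = .space → ∀ d, ok d → size d ≤ b) :
    RunsWithin ρ step size c c' b := by
  cases ρ with
  | time => exact ⟨⟨⟨t, h.iterate⟩, ht rfl⟩⟩
  | space => exact ⟨⟨⟨t, h.iterate⟩⟩, fun d hd => hz rfl d (h.ok_of_reaches hc' hd)⟩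

theorem RunsWithin.exists_path {ρ : Resource} {C : Type} {step : C → Option C} {size : C → ℕ}
    {c c' : C} {b : ℕ} (h : RunsWithin ρ step size c c' b) :
    ∃ t, (ρ = .time → t ≤ b) ∧ Path step (fun d => ρ = .space → size d ≤ b) c c' t := by
  cases ρ with
  | time =>
    obtain ⟨⟨⟨t, h⟩, ht⟩⟩ := h
    exact ⟨t, fun _ => ht, .of_iterate t (by simp) h⟩
  | space =>
    obtain ⟨⟨⟨t, h⟩⟩, hz⟩ := h
    exact ⟨t, by simp, .of_iterate t (fun d hd _ => hz d hd) h⟩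

/-! ### Statements -/

section Stmt

variable {K : Type} {Γ : K → Type} {Λ Λ' σ : Type}

/-- Total number of stored symbols. -/
def stkSize [Fintype K] (S : ∀ k, List (Γ k)) : ℕ := ∑ k, (S k).length

/-- Stated as an equation of sums, so that `omega` can use it without truncated subtraction. -/
theorem stkSize_update [Fintype K] [DecidableEq K] (S : ∀ k, List (Γ k)) (k : K)
    (l : List (Γ k)) :
    stkSize (Function.update S k l) + (S k).length = stkSize S + l.length := by
  unfold stkSize
  rw [← Finset.add_sum_erase _ _ (Finset.mem_univ k),
    ← Finset.add_sum_erase _ (fun k => (S k).length) (Finset.mem_univ k)]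
  rw [Finset.sum_congr rfl (g := fun k => (S k).length)]
  · simp; ring
  · intro j hj
    rw [Function.update_of_ne (Finset.ne_of_mem_erase hj)]

/-- Replace the labels that occur in a statement. -/
def mapLabel (f : Λ → Λ') : Stmt Γ Λ σ → Stmt Γ Λ' σ
  | push k g q => push k g (mapLabel f q)
  | peek k g q => peek k g (mapLabel f q)
  | pop k g q => pop k g (mapLabel f q)
  | load g q => load g (mapLabel f q)
  | branch g q₁ q₂ => branch g (mapLabel f q₁) (mapLabel f q₂)
  | goto g => goto fun v => f (g v)
  | halt => halt

theorem stepAux_mapLabel [DecidableEq K] (f : Λ → Λ') (q : Stmt Γ Λ σ) :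
    ∀ (v : σ) (S : ∀ k, List (Γ k)), stepAux (mapLabel f q) v S =
      ⟨(stepAux q v S).l.map f, (stepAux q v S).var, (stepAux q v S).stk⟩ := by
  induction q with
  | branch g q₁ q₂ ih₁ ih₂ =>
    intro v S
    simp only [mapLabel, stepAux]
    cases g v <;> simp [ih₁, ih₂]
  | _ => intros; simp [mapLabel, *]

/-- An upper bound for the number of symbols that one execution of a statement pushes. -/
def pushes : Stmt Γ Λ σ → ℕ
  | push _ _ q => pushes q + 1
  | peek _ _ q => pushes q
  | pop _ _ q => pushes q
  | load _ q => pushes q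
  | branch _ q₁ q₂ => max (pushes q₁) (pushes q₂)
  | goto _ => 0
  | halt => 0

theorem stkSize_stepAux_le [Fintype K] [DecidableEq K] (q : Stmt Γ Λ σ) :
    ∀ (v : σ) (S : ∀ k, List (Γ k)), stkSize (stepAux q v S).stk ≤ stkSize S + pushes q := by
  induction q with
  | push k g q ih =>
    intro v S
    refine (ih _ _).trans ?_
    have := stkSize_update S k (g v :: S k)
    simp only [List.length_cons, pushes] at this ⊢
    omega
  | pop k g q ih =>
    intro v S
    refine (ih _ _).trans ?_
    have := stkSize_update S k (S k).tail
    simp only [List.length_tail, pushes] at this ⊢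
    omega
  | peek k g q ih => intro v S; exact ih _ _
  | load g q ih => intro v S; exact ih _ _
  | branch g q₁ q₂ ih₁ ih₂ =>
    intro v S
    simp only [stepAux, pushes]
    cases g v
    · exact (ih₂ v S).trans (by omega)
    · exact (ih₁ v S).trans (by omega)
  | goto g => intro v S; simp [pushes]
  | halt => intro v S; simp [pushes]

end Stmt

/-! ### Program fragments -/

/-- A program fragment: finitely many labels, and a statement for each of them, which may jump to
the other labels or leave the fragment (by a jump to `none`). -/
structure Frag {K : Type} (Γ : K → Type) (σ : Type) where
  L : Type
  [fin : Fintype L]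
  entry : L
  code : L → Stmt Γ (Option L) σ

attribute [instance] Frag.fin

section Frag

variable {K : Type} [DecidableEq K] {Γ : K → Type} {σ R : Type}

/-- From label `l`, the fragment `P` exits after `t` steps. -/
inductive Frag.Runs (P : Frag Γ σ) (ok : (∀ k, List (Γ k)) → Prop) :
    P.L → σ → (∀ k, List (Γ k)) → σ → (∀ k, List (Γ k)) → ℕ → Prop
  | exit {l v S v' S'} : ok S → ok S' → stepAux (P.code l) v S = ⟨some none, v', S'⟩ →
      Runs P ok l v S v' S' 1
  | step {l l₁ v S v₁ S₁ v' S' t} : ok S → stepAux (P.code l) v S = ⟨some (some l₁), v₁, S₁⟩ →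
      Runs P ok l₁ v₁ S₁ v' S' t → Runs P ok l v S v' S' (t + 1)

namespace Frag.Runs

variable {P Q : Frag Γ σ} {ok ok' : (∀ k, List (Γ k)) → Prop} {l : P.L} {v v' v'' : σ}
  {S S' S'' : ∀ k, List (Γ k)} {t t' : ℕ}

theorem ok_right (h : P.Runs ok l v S v' S' t) : ok S' := by induction h <;> assumption

theorem mono (hok : ∀ S, ok S → ok' S) (h : P.Runs ok l v S v' S' t) :
    P.Runs ok' l v S v' S' t := by
  induction h with
  | exit h h' hs => exact .exit (hok _ h) (hok _ h') hs
  | step h hs _ ih => exact .step (hok _ h) hs ih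

theorem path {Λ : Type} {step : Cfg Γ Λ σ → Option (Cfg Γ Λ σ)} {e : P.L → Λ} {x : Λ}
    (hstep : ∀ l v S, step ⟨some (e l), v, S⟩ =
      some ⟨(stepAux (P.code l) v S).l.map (fun o => o.elim x e), (stepAux (P.code l) v S).var,
        (stepAux (P.code l) v S).stk⟩)
    (h : P.Runs ok l v S v' S' t) :
    Path step (fun c => ok c.stk) ⟨some (e l), v, S⟩ ⟨some x, v', S'⟩ t := by
  induction h with
  | exit h h' hs => exact .cons h (by rw [hstep, hs]; rfl) (.refl h')
  | step h hs _ ih => exact .cons h (by rw [hstep, hs]; rfl) ih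

theorem lift_exit {e : P.L → Q.L}
    (hcode : ∀ l, Q.code (e l) = mapLabel (fun o => o.elim none fun l => some (e l)) (P.code l))
    (h : P.Runs ok l v S v' S' t) : Q.Runs ok (e l) v S v' S' t := by
  induction h with
  | exit h h' hs => exact .exit h h' (by rw [hcode, stepAux_mapLabel, hs]; rfl)
  | step h hs _ ih => exact .step h (by rw [hcode, stepAux_mapLabel, hs]; rfl) ih

theorem lift_next {e : P.L → Q.L} {x : Q.L}
    (hcode : ∀ l, Q.code (e l) =
      mapLabel (fun o => o.elim (some x) fun l => some (e l)) (P.code l))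
    (h : P.Runs ok l v S v' S' t) (h' : Q.Runs ok x v' S' v'' S'' t') :
    Q.Runs ok (e l) v S v'' S'' (t + t') := by
  induction h with
  | exit h _ hs =>
    rw [Nat.add_comm]
    exact .step h (by rw [hcode, stepAux_mapLabel, hs]; rfl) h'
  | step h hs _ ih =>
    rw [Nat.add_right_comm]
    exact .step h (by rw [hcode, stepAux_mapLabel, hs]; rfl) (ih h')

/-- Time controls space: every step pushes at most `c` symbols. Hence it is enough to count the
steps of a loop. -/
theorem size_le [Fintype K] {c : ℕ} (hc : ∀ l, pushes (P.code l) ≤ c)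
    (h : P.Runs ok l v S v' S' t) :
    P.Runs (fun T => ok T ∧ stkSize T ≤ stkSize S + c * t) l v S v' S' t := by
  induction h with
  | @exit l v S v' S' h h' hs =>
    refine .exit ⟨h, by omega⟩ ⟨h', ?_⟩ hs
    have := stkSize_stepAux_le (P.code l) v S
    rw [hs] at this
    have := hc l
    simp only at *
    omega
  | @step l l₁ v S v₁ S₁ v' S' t h hs _ ih =>
    refine .step ⟨h, by omega⟩ hs (ih.mono fun T hT => ⟨hT.1, hT.2.trans ?_⟩)
    have := stkSize_stepAux_le (P.code l) v S
    rw [hs] at this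
    have := hc l
    simp only at *
    nlinarith

end Frag.Runs

/-- With resource cost at most `b`, the fragment `P` leads from state `v` and stacks `S` to state
`v'` and stacks `S'`: in time at most `b`, respectively storing never more than `b` symbols in
addition to those in `S`. The register, the second component of the state, is scratch. -/
def Frag.Does [Fintype K] (ρ : Resource) (P : Frag Γ (σ × R)) (v : σ) (S : ∀ k, List (Γ k))
    (v' : σ) (S' : ∀ k, List (Γ k)) (b : ℕ) : Prop :=
  ∀ r, ∃ r' t, (ρ = .time → t ≤ b) ∧
    P.Runs (fun T => ρ = .space → stkSize T ≤ stkSize S + b) P.entry (v, r) S (v', r') S' t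

namespace Frag

variable {ρ : Resource} {v v' v'' : σ} {S S' S'' : ∀ k, List (Γ k)} {b b' : ℕ}

theorem Does.mono [Fintype K] {P : Frag Γ (σ × R)} (h : P.Does ρ v S v' S' b) (hb : b ≤ b') :
    P.Does ρ v S v' S' b' := fun r => by
  obtain ⟨r', t, ht, h⟩ := h r
  exact ⟨r', t, fun hρ => (ht hρ).trans hb, h.mono fun T hT hρ => (hT hρ).trans (by omega)⟩

/-- Execute two fragments one after the other. -/
def seq (P Q : Frag Γ σ) : Frag Γ σ where
  L := P.L ⊕ Q.L
  entry := .inl P.entry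
  code
    | .inl l => mapLabel (fun o => o.elim (some (.inr Q.entry)) fun l => some (.inl l)) (P.code l)
    | .inr l => mapLabel (fun o => o.elim none fun l => some (.inr l)) (Q.code l)

/-- Costs add for space as well as for time, since the second fragment is measured against `S'`,
which may exceed `S` by `b` symbols. -/
theorem Does.seq [Fintype K] {P Q : Frag Γ (σ × R)} (h : P.Does ρ v S v' S' b)
    (h' : Q.Does ρ v' S' v'' S'' b') : (P.seq Q).Does ρ v S v'' S'' (b + b') := fun r => by
  obtain ⟨r', t, ht, h⟩ := h r
  obtain ⟨r'', t', ht', h'⟩ := h' r'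
  refine ⟨r'', t + t', fun hρ => add_le_add (ht hρ) (ht' hρ), ?_⟩
  have hm := h.ok_right
  refine Runs.lift_next (Q := P.seq Q) (e := Sum.inl) (x := .inr Q.entry) (fun l => rfl)
    (h.mono fun T hT hρ => (hT hρ).trans (by omega))
    (Runs.lift_exit (Q := P.seq Q) (e := Sum.inr) (fun l => rfl)
      (h'.mono fun T hT hρ => (hT hρ).trans ?_))
  have := hm hρ
  omega

/-- The fragment that does nothing. -/
def skip : Frag Γ σ where
  L := Unit
  entry := ()
  code _ := goto fun _ => none

theorem Does.skip [Fintype K] : (Frag.skip : Frag Γ (σ × R)).Does ρ v S v S 1 := fun r =>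
  ⟨r, 1, fun _ => le_rfl, .exit (by intro; omega) (by intro; omega) rfl⟩

end Frag

end Frag

/-! ### Machines with auxiliary binary stacks -/

/-- The stack alphabets `Γ`, together with binary stacks indexed by `ι`. -/
abbrev SumΓ {K : Type} (Γ : K → Type) (ι : Type) (x : K ⊕ ι) : Type :=
  Sum.rec (motive := fun _ => Type) Γ (fun _ => Bool) x

/-- Scratch registers. -/
abbrev Reg := Option Bool × Option Bool × Bool

/-- The stacks `S` and `A` side by side. -/
def join {K ι : Type} {Γ : K → Type} (S : ∀ k, List (Γ k)) (A : ι → List Bool) :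
    ∀ k, List (SumΓ Γ ι k)
  | .inl k => S k
  | .inr i => A i

section Join

variable {K ι : Type} {Γ : K → Type} (S : ∀ k, List (Γ k)) (A : ι → List Bool)

@[simp] theorem join_inl (k : K) : join S A (.inl k) = S k := rfl

@[simp] theorem join_inr (i : ι) : join S A (.inr i) = A i := rfl

variable [DecidableEq K] [DecidableEq ι]

@[simp] theorem update_join_inl (k : K) (l : List (Γ k)) :
    Function.update (join S A) (.inl k) l = join (Function.update S k l) A := by
  funext j
  rcases j with j | j
  · by_cases h : j = k
    · subst h; simp
    · rw [Function.update_of_ne (by simpa using h)]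
      simp [h]
  · simp

@[simp] theorem update_join_inr (i : ι) (l : List Bool) :
    Function.update (join S A) (.inr i) l = join S (Function.update A i l) := by
  funext j
  rcases j with j | j
  · simp
  · by_cases h : j = i
    · subst h; simp
    · rw [Function.update_of_ne (by simpa using h)]
      simp [h]

theorem stkSize_join [Fintype K] [Fintype ι] :
    stkSize (join S A) = stkSize S + ∑ i, (A i).length := by
  simp [stkSize, Fintype.sum_sum_type, join]

theorem stkSize_nil [Fintype K] : stkSize (fun k => ([] : List (Γ k))) = 0 := by
  simp [stkSize]

end Join

/-! ### Loops, branches and elementary operations on stacks. -/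

namespace Frag

section Combinators

variable {K : Type} [DecidableEq K] [Fintype K] {Γ : K → Type} {σ : Type} {ρ : Resource}
  {v v' v'' : σ} {S S' S'' : ∀ k, List (Γ k)} {b b' : ℕ}

/-- Reset the registers, and then repeat a statement until it jumps to `none`. -/
def loop (q : Stmt Γ (Option Bool) (σ × Reg)) : Frag Γ (σ × Reg) where
  L := Bool
  entry := false
  code
    | false => load (fun v => (v.1, none, none, false)) (goto fun _ => some true)
    | true => q

/-- The repetitions of a statement `q`, until it jumps to `none`. -/
abbrev Loops (q : Stmt Γ (Option Bool) (σ × Reg)) (v : σ) (r : Reg) (S : ∀ k, List (Γ k))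
    (v' : σ) (r' : Reg) (S' : ∀ k, List (Γ k)) (t : ℕ) : Prop :=
  (loop q).Runs (fun _ => True) true (v, r) S (v', r') S' t

theorem Loops.done {q : Stmt Γ (Option Bool) (σ × Reg)} {r r' : Reg}
    (h : stepAux q (v, r) S = ⟨some none, (v', r'), S'⟩) : Loops q v r S v' r' S' 1 :=
  .exit trivial trivial h

theorem Loops.more {q : Stmt Γ (Option Bool) (σ × Reg)} {r r' r'' : Reg} {t : ℕ}
    (h : stepAux q (v, r) S = ⟨some (some true), (v', r'), S'⟩)
    (h' : Loops q v' r' S' v'' r'' S'' t) : Loops q v r S v'' r'' S'' (t + 1) :=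
  .step trivial h h'

/-- The factor `c + 1` pays for one unit of time and `c` pushed symbols per step; the additional
step resets the registers. -/
theorem Loops.does {q : Stmt Γ (Option Bool) (σ × Reg)} {r' : Reg} {t : ℕ} (c : ℕ)
    (hq : pushes q ≤ c) (h : Loops q v (none, none, false) S v' r' S' t) :
    (loop q).Does ρ v S v' S' ((c + 1) * (t + 1)) := fun r => by
  refine ⟨r', t + 1, fun _ => by nlinarith, ?_⟩
  have h' : (loop q).Runs (fun _ => True) false (v, r) S (v', r') S' (t + 1) :=
    .step trivial rfl h
  refine (h'.size_le (c := c) fun l => ?_).mono fun T hT _ => hT.2.trans (by nlinarith)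
  cases l
  · exact Nat.zero_le _
  · exact hq

end Combinators

section Aux

variable {K ι : Type} [DecidableEq K] [Fintype K] [DecidableEq ι] [Fintype ι] {Γ : K → Type}
  {σ : Type} {ρ : Resource} {v v' v'' : σ} {s s' s'' : ∀ k, List (Γ k)}
  {A A' A'' : ι → List Bool} {b b' : ℕ}

/-- Pop the bits of the stack `i` one after the other, and execute `P` or `Q` for each of them. -/
def forEach (i : ι) (P Q : Frag (SumΓ Γ ι) (σ × Reg)) : Frag (SumΓ Γ ι) (σ × Reg) where
  L := Option (P.L ⊕ Q.L)
  entry := none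
  code
    | none => pop (.inr i) (fun v a => (v.1, a, none, false))
        (goto fun v => v.2.1.elim none fun x =>
          some (some (cond x (.inr Q.entry) (.inl P.entry))))
    | some (.inl l) =>
        mapLabel (fun o => o.elim (some none) fun l => some (some (.inl l))) (P.code l)
    | some (.inr l) =>
        mapLabel (fun o => o.elim (some none) fun l => some (some (.inr l))) (Q.code l)

theorem Does.forEach_nil {i : ι} {P Q : Frag (SumΓ Γ ι) (σ × Reg)} (hi : A i = []) :
    (forEach i P Q).Does ρ v (join s A) v (join s A) 1 := fun r =>
  ⟨(none, none, false), 1, fun _ => le_rfl, .exit (by intro; omega) (by intro; omega) (by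
    have : Function.update A i [] = A := by rw [← hi]; exact Function.update_eq_self i A
    simp [forEach, hi, this])⟩

theorem stkSize_pop {i : ι} {x : Bool} {l : List Bool} (hi : A i = x :: l) :
    stkSize (join s (Function.update A i l)) + 1 = stkSize (join s A) := by
  have := stkSize_update (join s A) (.inr i) l
  rw [update_join_inr, join_inr, hi, List.length_cons] at this
  omega

theorem Does.forEach_cons {i : ι} {P Q : Frag (SumΓ Γ ι) (σ × Reg)} {x : Bool} {l : List Bool}
    (hi : A i = x :: l)
    (h : (cond x Q P).Does ρ v (join s (Function.update A i l)) v' (join s' A') b)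
    (h' : (forEach i P Q).Does ρ v' (join s' A') v'' (join s'' A'') b') :
    (forEach i P Q).Does ρ v (join s A) v'' (join s'' A'') (1 + b + b') := fun r => by
  have hsize := stkSize_pop (s := s) hi
  obtain ⟨r', t, ht, h⟩ := h (some x, none, false)
  obtain ⟨r'', t', ht', h'⟩ := h' r'
  refine ⟨r'', t + t' + 1, fun hρ => ?_, ?_⟩
  · have := ht hρ; have := ht' hρ; omega
  have hm := h.ok_right
  have h2 := h'.mono (ok' := fun T => ρ = .space → stkSize T ≤ stkSize (join s A) + (1 + b + b'))
    fun T hT hρ => (hT hρ).trans (by have := hm hρ; omega)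
  have h1 := h.mono (ok' := fun T => ρ = .space → stkSize T ≤ stkSize (join s A) + (1 + b + b'))
    fun T hT hρ => (hT hρ).trans (by omega)
  refine .step (by intro; omega) (l₁ := some (cond x (.inr Q.entry) (.inl P.entry)))
    (v₁ := (v, some x, none, false)) (S₁ := join s (Function.update A i l)) ?_ ?_
  · simp [forEach, hi]
  · cases x
    · exact Runs.lift_next (Q := forEach i P Q) (e := fun l => some (.inl l)) (x := none)
        (fun l => rfl) h1 h2
    · exact Runs.lift_next (Q := forEach i P Q) (e := fun l => some (.inr l)) (x := none)
        (fun l => rfl) h1 h2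

/-- Execute `P` if the stack `i` is empty, and `Q` otherwise. -/
def ifEmpty (i : ι) (P Q : Frag (SumΓ Γ ι) (σ × Reg)) : Frag (SumΓ Γ ι) (σ × Reg) where
  L := Option (P.L ⊕ Q.L)
  entry := none
  code
    | none => peek (.inr i) (fun v a => (v.1, a, none, false))
        (goto fun v => some (some (cond v.2.1.isSome (.inr Q.entry) (.inl P.entry))))
    | some (.inl l) =>
        mapLabel (fun o => o.elim none fun l => some (some (.inl l))) (P.code l)
    | some (.inr l) =>
        mapLabel (fun o => o.elim none fun l => some (some (.inr l))) (Q.code l)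

theorem Does.ifEmpty_nil {i : ι} {P Q : Frag (SumΓ Γ ι) (σ × Reg)} (hi : A i = [])
    (h : P.Does ρ v (join s A) v' (join s' A') b) :
    (ifEmpty i P Q).Does ρ v (join s A) v' (join s' A') (b + 1) := fun r => by
  obtain ⟨r', t, ht, h⟩ := h (none, none, false)
  refine ⟨r', t + 1, fun hρ => by have := ht hρ; omega, ?_⟩
  refine .step (by intro; omega) (l₁ := some (.inl P.entry))
    (v₁ := (v, none, none, false)) (S₁ := join s A) ?_ ?_
  · simp [ifEmpty, hi]
  · exact Runs.lift_exit (Q := ifEmpty i P Q) (e := fun l => some (.inl l))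
      (fun l => rfl) (h.mono fun T hT hρ => (hT hρ).trans (by omega))

theorem Does.ifEmpty_cons {i : ι} {P Q : Frag (SumΓ Γ ι) (σ × Reg)} (hi : A i ≠ [])
    (h : Q.Does ρ v (join s A) v' (join s' A') b) :
    (ifEmpty i P Q).Does ρ v (join s A) v' (join s' A') (b + 1) := fun r => by
  obtain ⟨x, l, hi⟩ := List.exists_cons_of_ne_nil hi
  obtain ⟨r', t, ht, h⟩ := h (some x, none, false)
  refine ⟨r', t + 1, fun hρ => by have := ht hρ; omega, ?_⟩
  refine .step (by intro; omega) (l₁ := some (.inr Q.entry))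
    (v₁ := (v, some x, none, false)) (S₁ := join s A) ?_ ?_
  · simp [ifEmpty, hi]
  · exact Runs.lift_exit (Q := ifEmpty i P Q) (e := fun l => some (.inr l))
      (fun l => rfl) (h.mono fun T hT hρ => (hT hρ).trans (by omega))

/-- Empty the stack `k`. -/
def clearStk {K : Type} {Γ : K → Type} (k : K) : Frag Γ (σ × Reg) :=
  loop (pop k (fun v a => (v.1, none, none, a.isSome))
    (goto fun v => cond v.2.2.2 (some true) none))

theorem Does.clearStk {S : ∀ k, List (Γ k)} {k : K} :
    (Frag.clearStk k).Does ρ v S v (Function.update S k []) ((S k).length + 2) := by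
  -- For the induction the content of the stack and the register are arbitrary; the actual content
  -- comes back through `Function.update_eq_self`. The loops below are all treated in this way.
  suffices ∀ l r, Loops (pop k (fun v a => (v.1, none, none, a.isSome))
      (goto fun v => cond v.2.2.2 (some true) none)) v r (Function.update S k l) v
      (none, none, false) (Function.update S k []) (l.length + 1) by
    have h := (this (S k) (none, none, false)).does (ρ := ρ) 0 le_rfl
    rw [Function.update_eq_self] at h
    exact h.mono (by omega)
  intro l
  induction l with
  | nil => intro r; exact .done (by simp)
  | cons x l ih => intro r; exact .more (r' := (none, none, true)) (by simp) (ih _)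

/-- Empty the auxiliary stack `i`. -/
abbrev clear (i : ι) : Frag (SumΓ Γ ι) (σ × Reg) := clearStk (Sum.inr i : K ⊕ ι)

theorem Does.clear {i : ι} : (Frag.clear i : Frag (SumΓ Γ ι) (σ × Reg)).Does ρ v (join s A) v
    (join s (Function.update A i [])) ((A i).length + 2) := by
  have := Does.clearStk (ρ := ρ) (v := v) (S := join s A) (k := .inr i)
  rwa [update_join_inr] at this

/-- Push fixed bits. -/
def pushBits (i : ι) (l : List Bool) : Frag (SumΓ Γ ι) (σ × Reg) :=
  loop (l.foldl (fun q x => push (.inr i) (fun _ => x) q) (goto fun _ => none))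

theorem Does.pushBits {i : ι} (l : List Bool) :
    (Frag.pushBits i l).Does ρ v (join s A) v (join s (Function.update A i (l ++ A i)))
      (2 * (l.length + 1)) := by
  have hp : ∀ (l : List Bool) (q : Stmt (SumΓ Γ ι) (Option Bool) (σ × Reg)),
      pushes (l.foldl (fun q x => push (.inr i) (fun _ => x) q) q) = l.length + pushes q := by
    intro l
    induction l with
    | nil => simp
    | cons x l ih => intro q; simp [ih, pushes]; omega
  have hs : ∀ (l : List Bool) (q : Stmt (SumΓ Γ ι) (Option Bool) (σ × Reg)) v (A : ι → List Bool),
      stepAux (l.foldl (fun q x => push (.inr i) (fun _ => x) q) q) v (join s A) =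
        stepAux q v (join s (Function.update A i (l ++ A i))) := by
    intro l
    induction l with
    | nil => simp
    | cons x l ih => intro q v A; simp [ih]
  refine ((Loops.done ?_).does (r' := (none, none, false)) l.length ?_).mono (by omega)
  · rw [hs]; simp
  · rw [hp]; simp [pushes]

/-- Move the symbols of the stack `i` to the stack `j`. -/
def move (i j : ι) : Frag (SumΓ Γ ι) (σ × Reg) :=
  loop (pop (.inr i) (fun v a => (v.1, a, none, false))
    (branch (fun v => v.2.1.isSome)
      (push (.inr j) (fun v => v.2.1.getD false) (goto fun _ => some true))
      (goto fun _ => none)))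

theorem Does.move {i j : ι} (hij : i ≠ j) :
    (Frag.move i j).Does ρ v (join s A) v
      (join s (Function.update (Function.update A i []) j ((A i).reverse ++ A j)))
      (2 * ((A i).length + 2)) := by
  suffices ∀ l m r, Loops (pop (.inr i) (fun v a => (v.1, a, none, false))
      (branch (fun v => v.2.1.isSome)
        (push (.inr j) (fun v => v.2.1.getD false) (goto fun _ => some true))
        (goto fun _ => none))) v r
      (join s (Function.update (Function.update A i l) j m)) v (none, none, false)
      (join s (Function.update (Function.update A i []) j (l.reverse ++ m))) (l.length + 1) by
    have h := (this (A i) (A j) (none, none, false)).does (ρ := ρ) 1 le_rfl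
    rw [Function.update_eq_self, Function.update_eq_self] at h
    exact h.mono (by omega)
  intro l
  induction l with
  | nil =>
    intro m r
    refine .done ?_
    simp [hij, hij.symm, Function.update_comm hij]
  | cons x l ih =>
    intro m r
    refine .more ?_ (by simpa using ih (x :: m) (some x, none, false))
    simp [hij, hij.symm, Function.update_comm hij]

/-- Move the symbols of the stack `i` to both stacks `j` and `k`. -/
def move₂ (i j k : ι) : Frag (SumΓ Γ ι) (σ × Reg) :=
  loop (pop (.inr i) (fun v a => (v.1, a, none, false))
    (branch (fun v => v.2.1.isSome)
      (push (.inr j) (fun v => v.2.1.getD false)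
        (push (.inr k) (fun v => v.2.1.getD false) (goto fun _ => some true)))
      (goto fun _ => none)))

theorem Does.move₂ {i j k : ι} (hij : i ≠ j) (hik : i ≠ k) (hjk : j ≠ k) :
    (Frag.move₂ i j k).Does ρ v (join s A) v
      (join s (Function.update (Function.update (Function.update A i []) j
        ((A i).reverse ++ A j)) k ((A i).reverse ++ A k)))
      (3 * ((A i).length + 2)) := by
  suffices ∀ l m n r, Loops (pop (.inr i) (fun v a => (v.1, a, none, false))
      (branch (fun v => v.2.1.isSome)
        (push (.inr j) (fun v => v.2.1.getD false)
          (push (.inr k) (fun v => v.2.1.getD false) (goto fun _ => some true)))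
        (goto fun _ => none))) v r
      (join s (Function.update (Function.update (Function.update A i l) j m) k n)) v
      (none, none, false)
      (join s (Function.update (Function.update (Function.update A i []) j
        (l.reverse ++ m)) k (l.reverse ++ n))) (l.length + 1) by
    have h := (this (A i) (A j) (A k) (none, none, false)).does (ρ := ρ) 2 le_rfl
    rw [Function.update_eq_self, Function.update_eq_self, Function.update_eq_self] at h
    exact h.mono (by omega)
  intro l
  induction l with
  | nil =>
    intro m n r
    refine .done ?_
    simp [hij, hij.symm, hik, hik.symm, Function.update_comm hij, Function.update_comm hik]
  | cons x l ih =>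
    intro m n r
    refine .more ?_ (by simpa using ih (x :: m) (x :: n) (some x, none, false))
    simp [hij, hij.symm, hik, hik.symm, hjk, hjk.symm, Function.update_comm hij,
      Function.update_comm hik, Function.update_comm hjk]

end Aux

end Frag

/-! ### Binary increments -/

/-- The successor of a binary number, least significant bit first. -/
def inc : List Bool → List Bool
  | [] => [true]
  | false :: l => true :: l
  | true :: l => false :: inc l

theorem length_inc_le (l : List Bool) : (inc l).length ≤ l.length + 1 := by
  induction l with
  | nil => simp [inc]
  | cons x l ih => cases x <;> simp [inc]; omega

theorem binVal_cons (x : Bool) (l : List Bool) : binVal (x :: l) = 2 * binVal l + x.toNat := by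
  cases x <;> simp [binVal, Nat.bit]

theorem binVal_inc (l : List Bool) : binVal (inc l) = binVal l + 1 := by
  induction l with
  | nil => rfl
  | cons x l ih =>
    cases x
    · simp [inc, binVal_cons]
    · simp [inc, binVal_cons, ih]; ring

namespace Frag

section Aux

variable {K ι : Type} [DecidableEq K] [Fintype K] [DecidableEq ι] [Fintype ι] {Γ : K → Type}
  {σ : Type} {ρ : Resource} {v v' v'' : σ} {s s' s'' : ∀ k, List (Γ k)}
  {A A' A'' : ι → List Bool} {b b' : ℕ}

/-- Replace the binary number on stack `i` by its successor, and then move the contents of the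
stack `j` to stack `i`. -/
def incr (i j : ι) : Frag (SumΓ Γ ι) (σ × Reg) :=
  (loop (pop (.inr i) (fun v a => (v.1, a, none, false))
    (branch (fun v => v.2.1 == some true)
      (push (.inr j) (fun _ => false) (goto fun _ => some true))
      (push (.inr i) (fun _ => true) (goto fun _ => none))))).seq (move j i)

theorem Does.incr {i j : ι} (hij : i ≠ j) :
    (Frag.incr i j).Does ρ v (join s A) v
      (join s (Function.update (Function.update A i ((A j).reverse ++ inc (A i))) j []))
      (4 * ((A i).length + (A j).length + 3)) := by
  -- The carry moves ones, changed to zeros, from `i` to `j` until the first zero. Where it stops is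
  -- left open; only the recombination of both stacks matters, and the number of steps is one more
  -- than the number of moved symbols.
  suffices ∀ l m r, ∃ r' l' m', Loops (pop (.inr i) (fun v a => (v.1, a, none, false))
      (branch (fun v => v.2.1 == some true)
        (push (.inr j) (fun _ => false) (goto fun _ => some true))
        (push (.inr i) (fun _ => true) (goto fun _ => none)))) v r
      (join s (Function.update (Function.update A i l) j m)) v r'
      (join s (Function.update (Function.update A i l') j m')) (m'.length + 1 - m.length) ∧
      m'.length ≤ m.length + l.length ∧ m.length ≤ m'.length ∧
      m'.reverse ++ l' = m.reverse ++ inc l by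
    obtain ⟨r', l', m', h, h1, h0, h2⟩ := this (A i) (A j) (none, none, false)
    have h := h.does (ρ := ρ) 1 le_rfl
    rw [Function.update_eq_self, Function.update_eq_self] at h
    have h3 := h.seq (Does.move (ρ := ρ) (v := v) (s := s)
      (A := Function.update (Function.update A i l') j m') hij.symm)
    simp only [Function.update_self, Function.update_of_ne hij, h2] at h3
    rw [Function.update_idem, Function.update_comm hij, Function.update_idem,
      Function.update_comm hij.symm] at h3
    exact h3.mono (by omega)
  intro l
  induction l with
  | nil =>
    intro m r
    refine ⟨(none, none, false), [true], m, ?_, by simp, le_rfl, by simp [inc]⟩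
    rw [Nat.add_sub_cancel_left]
    refine .done ?_
    simp [hij, hij.symm, Function.update_comm hij]
  | cons x l ih =>
    intro m r
    cases x
    · refine ⟨(some false, none, false), true :: l, m, ?_, by simp, le_rfl, by simp [inc]⟩
      rw [Nat.add_sub_cancel_left]
      refine .done ?_
      simp [hij, hij.symm, Function.update_comm hij]
    · obtain ⟨r', l', m', h, h1, h0, h2⟩ := ih (false :: m) (some true, none, false)
      simp only [List.length_cons] at h h1 h0
      refine ⟨r', l', m', ?_, by simp; omega, by omega, by simpa [inc] using h2⟩
      rw [show m'.length + 1 - m.length = m'.length + 1 - (m.length + 1) + 1 by omega]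
      refine .more ?_ h
      simp [hij, hij.symm, Function.update_comm hij]

end Aux

end Frag

/-! ### Machines as fragments -/

section Embed

variable {K ι : Type} {Γ : K → Type} {Λ σ : Type}

/-- The statement `q` acting on the first summand of the stacks; to halt is to leave. -/
def embed (ι : Type) : Stmt Γ Λ σ → Stmt (SumΓ Γ ι) (Option Λ) (σ × Reg)
  | push k f q => push (.inl k) (fun v => f v.1) (embed ι q)
  | peek k f q => peek (.inl k) (fun v a => (f v.1 a, v.2)) (embed ι q)
  | pop k f q => pop (.inl k) (fun v a => (f v.1 a, v.2)) (embed ι q)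
  | load f q => load (fun v => (f v.1, v.2)) (embed ι q)
  | branch f q₁ q₂ => branch (fun v => f v.1) (embed ι q₁) (embed ι q₂)
  | goto f => goto fun v => some (f v.1)
  | halt => goto fun _ => none

variable [DecidableEq K] [DecidableEq ι]

theorem stepAux_embed (q : Stmt Γ Λ σ) (r : Reg) (A : ι → List Bool) :
    ∀ (v : σ) (S : ∀ k, List (Γ k)), stepAux (embed ι q) (v, r) (join S A) =
      ⟨some (stepAux q v S).l, ((stepAux q v S).var, r), join (stepAux q v S).stk A⟩ := by
  induction q with
  | branch f q₁ q₂ ih₁ ih₂ =>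
    intro v S
    simp only [embed, stepAux]
    cases f v <;> simp [ih₁, ih₂]
  | _ => intros; simp [embed, *]

/-- A machine as a fragment. -/
def Frag.ofTM (ι : Type) (M : FinTM2) : Frag (SumΓ M.Γ ι) (M.σ × Reg) where
  L := M.Λ
  fin := M.ΛFin
  entry := M.main
  code l := embed ι (M.m l)

end Embed

theorem initList_stk (M : FinTM2) (l : List (M.Γ M.k₀)) :
    (initList M l).stk = Function.update (fun _ => []) M.k₀ l := by
  funext k
  by_cases h : k = M.k₀
  · subst h; simp [initList]
  · simp [initList, h]

theorem haltList_stk (M : FinTM2) (l : List (M.Γ M.k₁)) :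
    (haltList M l).stk = Function.update (fun _ => []) M.k₁ l := by
  funext k
  by_cases h : k = M.k₁
  · subst h; simp [haltList]
  · simp [haltList, h]

theorem stkSize_update_nil {K : Type} [Fintype K] [DecidableEq K] {Γ : K → Type} (k : K)
    (l : List (Γ k)) : stkSize (Function.update (fun k => ([] : List (Γ k))) k l) = l.length := by
  have := stkSize_update (fun k => ([] : List (Γ k))) k l
  simpa [stkSize_nil] using this

/-- Bound for the number of symbols pushed in one step. -/
def maxPushes (M : FinTM2) : ℕ :=
  letI := M.ΛFin
  Finset.univ.sup fun l => pushes (M.m l)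

theorem pushes_le_maxPushes (M : FinTM2) (l : M.Λ) : pushes (M.m l) ≤ maxPushes M :=
  letI := M.ΛFin
  Finset.le_sup (f := fun l => pushes (M.m l)) (Finset.mem_univ l)

instance (M : FinTM2) : Fintype M.K := M.kFin
instance (M : FinTM2) : Fintype M.σ := M.σFin

/-- Contents of the stacks of a machine that halts with output `y`. -/
def StrTM.outStk (M : StrTM) (y : Str) : ∀ k, List (M.tm.Γ k) :=
  Function.update (fun _ => []) M.tm.k₁ (y.map M.outputAlphabet.symm)

/-- Contents of the stacks of a machine that starts with input `x`. -/
def StrTM.inStk (M : StrTM) (x : Str) : ∀ k, List (M.tm.Γ k) :=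
  Function.update (fun _ => []) M.tm.k₀ (x.map M.inputAlphabet.symm)

/-- The machine never touches the auxiliary stacks, and halting becomes leaving the fragment. The
bound `b` covers all of the machine's own symbols, while the auxiliary ones are part of the initial
size. -/
theorem Frag.Does.ofTM {ι : Type} [Fintype ι] [DecidableEq ι] {ρ : Resource} {M : StrTM}
    {x y : Str} {b : ℕ} {A : ι → List Bool}
    (h : RunsWithin ρ M.tm.step (cfgSize M.tm) (M.init x) (M.final y) b) :
    (Frag.ofTM ι M.tm).Does ρ M.tm.initialState (join (M.inStk x) A) M.tm.initialState
      (join (M.outStk y) A) b := fun r => by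
  obtain ⟨t, ht, h⟩ := h.exists_path
  refine ⟨r, t, ht, ?_⟩
  have key : ∀ {c c' : M.tm.Cfg} {t : ℕ},
      Path M.tm.step (fun d => ρ = .space → cfgSize M.tm d ≤ b) c c' t →
      c'.l = none → ∀ l, c.l = some l →
      (Frag.ofTM ι M.tm).Runs (fun T => ρ = .space → stkSize T ≤ stkSize (join (M.inStk x) A) + b)
        l (c.var, r) (join c.stk A) (c'.var, r) (join c'.stk A) t := by
    intro c c' t h hc'
    induction h with
    | refl _ => intro l hl; rw [hc'] at hl; cases hl
    | @cons c c₁ c' t hok hs h ih =>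
      intro l hl
      obtain ⟨lc, v, S⟩ := c
      simp only at hl
      subst hl
      have hs' : stepAux (M.tm.m l) v S = c₁ := Option.some.inj hs
      have hsize : ∀ d : M.tm.Cfg, (ρ = .space → cfgSize M.tm d ≤ b) → ρ = .space →
          stkSize (join d.stk A) ≤ stkSize (join (M.inStk x) A) + b := by
        intro d hd hρ
        rw [stkSize_join, stkSize_join]
        have : cfgSize M.tm d = stkSize d.stk := rfl
        have := hd hρ
        omega
      cases h₁ : c₁.l with
      | none =>
        cases h with
        | refl hok' =>
          refine .exit (hsize _ hok) (hsize _ hok') ?_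
          change stepAux (embed ι (M.tm.m l)) _ _ = _
          rw [stepAux_embed, hs', h₁]; rfl
        | cons _ hs₁ _ =>
          obtain ⟨lc, v, S⟩ := c₁
          simp only at h₁
          subst h₁
          simp at hs₁
      | some l₁ =>
        refine .step (hsize _ hok) (l₁ := l₁) ?_ (ih hc' l₁ h₁)
        change stepAux (embed ι (M.tm.m l)) _ _ = _
        rw [stepAux_embed, hs', h₁]; rfl
  have := key h rfl M.tm.main rfl
  rw [StrTM.init, StrTM.final, initList_stk, haltList_stk] at this
  exact this

/-- For space the output is part of the last configuration; for time every step pushes at most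
`maxPushes` symbols. This controls the lengths of the strings to which a constructor is applied
repeatedly. -/
theorem RunsWithin.length_le {ρ : Resource} {M : StrTM} {x y : Str} {b : ℕ}
    (h : RunsWithin ρ M.tm.step (cfgSize M.tm) (M.init x) (M.final y) b) :
    y.length ≤ x.length + (maxPushes M.tm + 1) * b := by
  obtain ⟨t, ht, h⟩ := h.exists_path
  have hy : cfgSize M.tm (M.final y) = y.length := by
    change stkSize (M.final y).stk = _
    rw [StrTM.final, haltList_stk, stkSize_update_nil, List.length_map]
  have hx : cfgSize M.tm (M.init x) = x.length := by
    change stkSize (M.init x).stk = _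
    rw [StrTM.init, initList_stk, stkSize_update_nil, List.length_map]
  cases ρ with
  | space =>
    have := h.ok_right rfl
    nlinarith
  | time =>
    have key : ∀ {c c' : M.tm.Cfg} {t : ℕ} {ok}, Path M.tm.step ok c c' t →
        cfgSize M.tm c' ≤ cfgSize M.tm c + maxPushes M.tm * t := by
      intro c c' t ok h
      induction h with
      | refl _ => simp
      | @cons c c₁ c' t hok hs h ih =>
        obtain ⟨lc, v, S⟩ := c
        cases lc with
        | none => simp at hs
        | some l =>
          have hs' : stepAux (M.tm.m l) v S = c₁ := Option.some.inj hs
          have h1 := stkSize_stepAux_le (M.tm.m l) v S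
          rw [hs'] at h1
          have h2 := pushes_le_maxPushes M.tm l
          change stkSize c'.stk ≤ stkSize S + _
          change stkSize c'.stk ≤ stkSize c₁.stk + _ at ih
          nlinarith
    have h1 := key h
    have h2 := ht rfl
    rw [hx, hy] at h1
    nlinarith

/-! ### Fragments as machines -/

theorem initList_eq (M : FinTM2) (l : List (M.Γ M.k₀)) : initList M l =
    ⟨some M.main, M.initialState, Function.update (fun _ => []) M.k₀ l⟩ := by
  rw [← initList_stk]; rfl

theorem haltList_eq (M : FinTM2) (l : List (M.Γ M.k₁)) : haltList M l =
    ⟨none, M.initialState, Function.update (fun _ => []) M.k₁ l⟩ := by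
  rw [← haltList_stk]; rfl

theorem cfg_eq_elim {K : Type} {Γ : K → Type} {L σ : Type} (c : Cfg Γ (Option L) σ) :
    c = ⟨c.l.map fun o => o.elim none some, c.var, c.stk⟩ := by
  rcases c with ⟨_ | _ | _, _, _⟩ <;> rfl

section ToTM

variable {K : Type} [DecidableEq K] [Fintype K] {Γ : K → Type} {σ : Type} [Fintype σ]

/-- The machine that executes a fragment, resets the state and halts. -/
def Frag.toTM (P : Frag Γ (σ × Reg)) (v₀ : σ) (k₀ k₁ : K) (e₀ : Γ k₀ ≃ Bool)
    (e₁ : Γ k₁ ≃ Bool) : StrTM where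
  tm :=
    { K := K
      k₀ := k₀
      k₁ := k₁
      Γ := Γ
      Λ := Option P.L
      main := some P.entry
      σ := σ × Reg
      initialState := (v₀, none, none, false)
      Γk₀Fin := Fintype.ofEquiv Bool e₀.symm
      m := fun
        | none => load (fun _ => (v₀, none, none, false)) halt
        | some l => P.code l }
  inputAlphabet := e₀
  outputAlphabet := e₁

/-- A final configuration has the initial state and no symbols outside the output stack. So the
fragment has to clean up its stacks, and one more step resets state and registers. The summand
`x.length` is the space of the input. -/
theorem Frag.Does.toTM {ρ : Resource} {P : Frag Γ (σ × Reg)} {v₀ v₁ : σ} {k₀ k₁ : K}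
    {e₀ : Γ k₀ ≃ Bool} {e₁ : Γ k₁ ≃ Bool} {x y : Str} {b : ℕ}
    (h : P.Does ρ v₀ (Function.update (fun _ => []) k₀ (x.map e₀.symm)) v₁
      (Function.update (fun _ => []) k₁ (y.map e₁.symm)) b) :
    RunsWithin ρ (P.toTM v₀ k₀ k₁ e₀ e₁).tm.step (cfgSize (P.toTM v₀ k₀ k₁ e₀ e₁).tm)
      ((P.toTM v₀ k₀ k₁ e₀ e₁).init x) ((P.toTM v₀ k₀ k₁ e₀ e₁).final y)
      (x.length + b + 1) := by
  obtain ⟨r', t, ht, h⟩ := h (none, none, false)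
  have hp := h.path (Λ := Option P.L) (step := TM2.step (P.toTM v₀ k₀ k₁ e₀ e₁).tm.m) (e := some)
    (x := none) (fun l v S => congrArg some (cfg_eq_elim _))
  have hp := hp.trans (.cons (c' := ⟨none, (v₀, none, none, false),
    Function.update (fun _ => []) k₁ (y.map e₁.symm)⟩) hp.ok_right rfl (.refl hp.ok_right))
  refine Path.runsWithin (t := t + 1) (ok := fun c => ρ = .space → stkSize c.stk ≤ x.length + b) ?_
    rfl (fun hρ => by have := ht hρ; omega) (fun hρ d hd => (hd hρ).trans (by omega))
  rw [StrTM.init, StrTM.final]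
  have e1 : initList (P.toTM v₀ k₀ k₁ e₀ e₁).tm
      (x.map (P.toTM v₀ k₀ k₁ e₀ e₁).inputAlphabet.symm) =
      ⟨some (some P.entry), (v₀, none, none, false),
        Function.update (fun _ => []) k₀ (x.map e₀.symm)⟩ := by
    exact initList_eq (P.toTM v₀ k₀ k₁ e₀ e₁).tm _
  have e2 : haltList (P.toTM v₀ k₀ k₁ e₀ e₁).tm
      (y.map (P.toTM v₀ k₀ k₁ e₀ e₁).outputAlphabet.symm) =
      ⟨none, (v₀, none, none, false),
        Function.update (fun _ => []) k₁ (y.map e₁.symm)⟩ := by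
    exact haltList_eq (P.toTM v₀ k₀ k₁ e₀ e₁).tm _
  rw [e1, e2]
  refine Path.mono (fun c hc hρ => (hc hρ).trans ?_) hp
  rw [stkSize_update_nil, List.length_map]

end ToTM

/-! ### Binary subtraction -/

/-- Difference bit and borrow bit of `x - y - c`. -/
def subBit (x y c : Bool) : Bool × Bool := (xor (xor x y) c, (!x && (y || c)) || (y && c))

/-- Binary subtraction, least significant bit first, with borrow `c`: the difference bits and the
final borrow. -/
def subBits : Bool → List Bool → List Bool → List Bool × Bool
  | c, [], [] => ([], c)
  | c, x :: l, [] =>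
    let p := subBits (subBit x false c).2 l []
    ((subBit x false c).1 :: p.1, p.2)
  | c, [], y :: m =>
    let p := subBits (subBit false y c).2 [] m
    ((subBit false y c).1 :: p.1, p.2)
  | c, x :: l, y :: m =>
    let p := subBits (subBit x y c).2 l m
    ((subBit x y c).1 :: p.1, p.2)

@[simp] theorem binVal_nil : binVal [] = 0 := rfl

theorem subBit_spec (x y c : Bool) :
    x.toNat + 2 * (subBit x y c).2.toNat = y.toNat + c.toNat + (subBit x y c).1.toNat := by
  cases x <;> cases y <;> cases c <;> rfl

theorem subBits_spec (c : Bool) (l m : List Bool) :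
    binVal l + 2 ^ (subBits c l m).1.length * (subBits c l m).2.toNat =
      binVal m + c.toNat + binVal (subBits c l m).1 := by
  induction c, l, m using subBits.induct with
  | case1 c => simp [subBits]
  | case2 c x l ih =>
    have := subBit_spec x false c
    simp only [subBits, binVal_cons, List.length_cons, pow_succ, binVal_nil, Bool.toNat_false] at *
    linarith
  | case3 c y m ih =>
    have := subBit_spec false y c
    simp only [subBits, binVal_cons, List.length_cons, pow_succ, binVal_nil, Bool.toNat_false] at *
    linarith
  | case4 c x l y m ih =>
    have := subBit_spec x y c
    simp only [subBits, binVal_cons, List.length_cons, pow_succ] at *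
    linarith

theorem length_subBits (c : Bool) (l m : List Bool) :
    (subBits c l m).1.length = max l.length m.length := by
  induction c, l, m using subBits.induct <;> simp_all [subBits]

theorem binVal_lt (l : List Bool) : binVal l < 2 ^ l.length := by
  induction l with
  | nil => simp
  | cons x l ih =>
    rw [binVal_cons, List.length_cons, pow_succ]
    have := Bool.toNat_lt x
    omega

/-- The difference has fewer than `2 ^ length` values, which forces the borrow in `subBits_spec`. So
one pass over the digits compares two numbers. -/
theorem subBits_borrow_iff (l m : List Bool) :
    (subBits false l m).2 = true ↔ binVal l < binVal m := by
  have h := subBits_spec false l m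
  have h1 := binVal_lt (subBits false l m).1
  cases h2 : (subBits false l m).2 <;> simp [h2] at h ⊢ <;> omega

/-! ### Fragments that use a fixed set of auxiliary stacks -/

/-- Names of auxiliary stacks. -/
inductive Tape
  | inp | uno | tab | tmp | str | cpy | cod | cnt | rev | num | flg | acc | idx | bts | qry | prc
  deriving DecidableEq

instance : Fintype Tape where
  elems := {.inp, .uno, .tab, .tmp, .str, .cpy, .cod, .cnt, .rev, .num, .flg, .acc, .idx, .bts,
    .qry, .prc}
  complete k := by cases k <;> decide

namespace Frag

section Pour

variable {ι : Type} [DecidableEq ι] [Fintype ι] {ρ : Resource} {M : TM2ComputableAux Bool Bool}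
  {v : M.tm.σ} {A : ι → List Bool}

/-- Move the symbols of the stack `i` to the input stack of `M`. -/
def pour (M : TM2ComputableAux Bool Bool) (i : ι) : Frag (SumΓ M.tm.Γ ι) (M.tm.σ × Reg) :=
  loop (pop (.inr i) (fun v a => (v.1, a, none, false))
    (branch (fun v => v.2.1.isSome)
      (push (.inl M.tm.k₀) (fun v => M.inputAlphabet.symm (v.2.1.getD false))
        (goto fun _ => some true))
      (goto fun _ => none)))

theorem Does.pour {i : ι} :
    (Frag.pour M i).Does ρ v (join (fun _ => []) A) v
      (join (StrTM.inStk M (A i).reverse) (Function.update A i [])) (2 * ((A i).length + 2)) := by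
  suffices ∀ l m r, Loops (pop (.inr i) (fun v a => (v.1, a, none, false))
      (branch (fun v => v.2.1.isSome)
        (push (.inl M.tm.k₀) (fun v => M.inputAlphabet.symm (v.2.1.getD false))
          (goto fun _ => some true))
        (goto fun _ => none))) v r (join (StrTM.inStk M m) (Function.update A i l)) v
      (none, none, false) (join (StrTM.inStk M (l.reverse ++ m)) (Function.update A i []))
      (l.length + 1) by
    have h := (this (A i) [] (none, none, false)).does (ρ := ρ) 1 le_rfl
    rw [Function.update_eq_self, List.append_nil] at h
    have h0 : StrTM.inStk M [] = fun _ => [] := by simp [StrTM.inStk]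
    rw [h0] at h
    exact h.mono (by omega)
  intro l
  induction l with
  | nil => intro m r; exact .done (by simp)
  | cons x l ih =>
    intro m r
    refine .more (r' := (some x, none, false)) ?_ (by simpa using ih (x :: m) _)
    simp [StrTM.inStk]

/-- Move the symbols of the output stack of `M` to the stack `i`. -/
def drain (M : TM2ComputableAux Bool Bool) (i : ι) : Frag (SumΓ M.tm.Γ ι) (M.tm.σ × Reg) :=
  loop (pop (.inl M.tm.k₁) (fun v a => (v.1, a.map M.outputAlphabet, none, false))
    (branch (fun v => v.2.1.isSome)
      (push (.inr i) (fun v => v.2.1.getD false) (goto fun _ => some true))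
      (goto fun _ => none)))

theorem Does.drain {i : ι} {y : Str} :
    (Frag.drain M i).Does ρ v (join (StrTM.outStk M y) A) v
      (join (fun _ => []) (Function.update A i (y.reverse ++ A i))) (2 * (y.length + 2)) := by
  suffices ∀ l m r, Loops (pop (.inl M.tm.k₁)
      (fun v a => (v.1, a.map M.outputAlphabet, none, false))
      (branch (fun v => v.2.1.isSome)
        (push (.inr i) (fun v => v.2.1.getD false) (goto fun _ => some true))
        (goto fun _ => none))) v r (join (StrTM.outStk M l) (Function.update A i m)) v
      (none, none, false) (join (fun _ => []) (Function.update A i (l.reverse ++ m)))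
      (l.length + 1) by
    have h := (this y (A i) (none, none, false)).does (ρ := ρ) 1 le_rfl
    rw [Function.update_eq_self] at h
    exact h.mono (by omega)
  intro l
  induction l with
  | nil => intro m r; exact .done (by simp [StrTM.outStk])
  | cons x l ih =>
    intro m r
    refine .more (r' := (some x, none, false)) ?_ (by simpa using ih (x :: m) _)
    simp [StrTM.outStk]

end Pour

section Aux

variable {K : Type} [DecidableEq K] [Fintype K] {Γ : K → Type}
  {σ : Type} {ρ : Resource} {v v' v'' : σ} {s s' s'' : ∀ k, List (Γ k)}
  {A A' A'' : Tape → List Bool} {b b' : ℕ}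

theorem Does.congr {P : Frag (SumΓ Γ Tape) (σ × Reg)} (h : P.Does ρ v (join s A) v' (join s' A') b)
    (hA : A' = A'') (hb : b ≤ b') : P.Does ρ v (join s A) v' (join s' A'') b' :=
  hA ▸ h.mono hb

theorem Loops.congr_stacks {q : Stmt (SumΓ Γ Tape) (Option Bool) (σ × Reg)} {r r' : Reg} {t t' : ℕ}
    (h : Loops q v r (join s A) v' r' (join s' A') t) (hA : A' = A'') (ht : t = t') :
    Loops q v r (join s A) v' r' (join s' A'') t' := by
  subst hA ht
  exact h

/-- Move the leading ones from stack `i` to stack `j`. -/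
def splitOnes (i j : Tape) : Frag (SumΓ Γ Tape) (σ × Reg) :=
  loop (peek (.inr i) (fun v a => (v.1, a, none, false))
    (branch (fun v => v.2.1 == some true)
      (pop (.inr i) (fun v _ => v) (push (.inr j) (fun _ => true) (goto fun _ => some true)))
      (goto fun _ => none)))

theorem Does.splitOnes {i j : Tape} {n : ℕ} {l : List Bool} (hij : i ≠ j)
    (hi : A i = List.replicate n true ++ l) (hl : l.head? ≠ some true) :
    (Frag.splitOnes i j).Does ρ v (join s A) v
      (join s (Function.update (Function.update A i l) j (List.replicate n true ++ A j)))
      (2 * (n + 2)) := by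
  suffices ∀ n m r, ∃ r', Loops (peek (.inr i) (fun v a => (v.1, a, none, false))
      (branch (fun v => v.2.1 == some true)
        (pop (.inr i) (fun v _ => v) (push (.inr j) (fun _ => true) (goto fun _ => some true)))
        (goto fun _ => none))) v r
      (join s (Function.update (Function.update A i (List.replicate n true ++ l)) j m)) v r'
      (join s (Function.update (Function.update A i l) j (List.replicate n true ++ m)))
      (n + 1) by
    obtain ⟨r', h⟩ := this n (A j) (none, none, false)
    have h := h.does (ρ := ρ) 1 le_rfl
    rw [← hi, Function.update_eq_self, Function.update_eq_self] at h
    exact h.mono (by omega)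
  intro n
  induction n with
  | zero =>
    intro m r
    refine ⟨(l.head?, none, false), .done ?_⟩
    rcases l with _ | ⟨_ | _, l⟩ <;>
      simp [hij, hij.symm, Function.update_comm hij] at hl ⊢
  | succ n ih =>
    intro m r
    obtain ⟨r', h⟩ := ih (true :: m) (some true, none, false)
    refine ⟨r', .more (v' := v) (r' := (some true, none, false)) (S' := join s (Function.update
      (Function.update A i (List.replicate n true ++ l)) j (true :: m))) ?_ ?_⟩
    · simp [hij, hij.symm, Function.update_comm hij, List.replicate_succ]
    · rw [List.append_cons, ← List.replicate_succ'] at h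
      exact h

/-- Remove the first `n` symbols of stack `i`. -/
def dropTop (i : Tape) (n : ℕ) : Frag (SumΓ Γ Tape) (σ × Reg) :=
  loop ((fun q => pop (.inr i) (fun v _ => v) q)^[n] (goto fun _ => none))

theorem Does.dropTop {i : Tape} {n : ℕ} :
    (Frag.dropTop i n).Does ρ v (join s A) v (join s (Function.update A i ((A i).drop n))) 2 := by
  have h : ∀ n (A : Tape → List Bool), stepAux ((fun q => pop (.inr i) (fun v _ => v) q)^[n]
      (goto fun _ => none) : Stmt (SumΓ Γ Tape) (Option Bool) (σ × Reg))
      (v, none, none, false) (join s A) =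
      ⟨some none, (v, none, none, false), join s (Function.update A i ((A i).drop n))⟩ := by
    intro n
    induction n with
    | zero => simp
    | succ n ih =>
      intro A
      rw [Function.iterate_succ_apply', stepAux, join_inr, update_join_inr, ih]
      simp [Nat.add_comm n 1]
  have hp : pushes ((fun q => pop (.inr i) (fun v _ => v) q)^[n]
      (goto fun _ => none) : Stmt (SumΓ Γ Tape) (Option Bool) (σ × Reg)) = 0 := by
    induction n with
    | zero => rfl
    | succ n ih => rw [Function.iterate_succ_apply', pushes, ih]
  exact ((Loops.done (h n A)).does 0 hp.le).mono le_rfl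

/-- Move as many symbols from stack `i` to stack `j` as there are symbols on stack `k`, which is
emptied. -/
def moveCount (k i j : Tape) : Frag (SumΓ Γ Tape) (σ × Reg) :=
  loop (pop (.inr k) (fun v a => (v.1, a, none, false))
    (branch (fun v => v.2.1.isSome)
      (pop (.inr i) (fun v a => (v.1, a, none, false))
        (branch (fun v => v.2.1.isSome)
          (push (.inr j) (fun v => v.2.1.getD false) (goto fun _ => some true))
          (goto fun _ => some true)))
      (goto fun _ => none)))

theorem Does.moveCount {k i j : Tape} (hki : k ≠ i) (hkj : k ≠ j) (hij : i ≠ j) :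
    (Frag.moveCount k i j).Does ρ v (join s A) v
      (join s (Function.update (Function.update (Function.update A k []) i
        ((A i).drop (A k).length)) j (((A i).take (A k).length).reverse ++ A j)))
      (2 * ((A k).length + 2)) := by
  suffices ∀ c l m r, Loops (pop (.inr k) (fun v a => (v.1, a, none, false))
      (branch (fun v => v.2.1.isSome)
        (pop (.inr i) (fun v a => (v.1, a, none, false))
          (branch (fun v => v.2.1.isSome)
            (push (.inr j) (fun v => v.2.1.getD false) (goto fun _ => some true))
            (goto fun _ => some true)))
        (goto fun _ => none))) v r
      (join s (Function.update (Function.update (Function.update A k c) i l) j m)) v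
      (none, none, false)
      (join s (Function.update (Function.update (Function.update A k []) i
        (l.drop c.length)) j ((l.take c.length).reverse ++ m))) (c.length + 1) by
    have h := (this (A k) (A i) (A j) (none, none, false)).does (ρ := ρ) 1 le_rfl
    rw [Function.update_eq_self, Function.update_eq_self, Function.update_eq_self] at h
    exact h.mono (by omega)
  intro c
  induction c with
  | nil =>
    intro l m r
    refine .done ?_
    simp [hki, hki.symm, hkj, hkj.symm, Function.update_comm hki, Function.update_comm hkj]
  | cons x c ih =>
    intro l m r
    rcases l with _ | ⟨y, l⟩
    · refine .more ?_ (by simpa using ih [] m (none, none, false))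
      simp [hki, hki.symm, hkj, hkj.symm, hij, hij.symm, Function.update_comm hki,
        Function.update_comm hkj, Function.update_comm hij]
    · refine .more ?_ (by simpa using ih l (y :: m) (some y, none, false))
      simp [hki, hki.symm, hkj, hkj.symm, hij, hij.symm, Function.update_comm hki,
        Function.update_comm hkj, Function.update_comm hij]

/-- Decompose the pair on `cod` into the first component, on `num`, and the second component, on
`cod`. -/
def unpair : Frag (SumΓ Γ Tape) (σ × Reg) :=
  (splitOnes .cod .cnt).seq ((dropTop .cod 1).seq ((moveCount .cnt .cod .rev).seq (move .rev .num)))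

theorem Does.unpair {x y : Str} (hcod : A .cod = pairStr x y) (hcnt : A .cnt = [])
    (hrev : A .rev = []) :
    Frag.unpair.Does ρ v (join s A) v
      (join s (Function.update (Function.update A .cod y) .num (x ++ A .num)))
      (6 * (x.length + 3)) := by
  have h1 := Does.splitOnes (ρ := ρ) (v := v) (s := s) (A := A) (i := .cod) (j := .cnt)
    (n := x.length) (l := false :: (x ++ y)) (by decide) hcod (by simp)
  refine ((h1.seq (Does.dropTop.seq ((Does.moveCount (by decide) (by decide) (by decide)).seq
    (Does.move (by decide))))).congr ?_ ?_)
  · funext k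
    cases k <;> simp [hcnt, hrev]
  · simp [hcnt, hrev]
    omega

/-- Subtract the binary number on `cod` from the one on `num`. The difference bits are pushed to
`rev`, and the final borrow to `flg` if it is one. -/
def subtract : Frag (SumΓ Γ Tape) (σ × Reg) :=
  loop (pop (.inr .num) (fun v a => (v.1, a, v.2.2))
    (pop (.inr .cod) (fun v a => (v.1, v.2.1, a, v.2.2.2))
      (branch (fun v => v.2.1.isNone && v.2.2.1.isNone)
        (branch (fun v => v.2.2.2) (push (.inr .flg) (fun _ => true) (goto fun _ => none))
          (goto fun _ => none))
        (push (.inr .rev) (fun v =>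
            (subBit (v.2.1.getD false) (v.2.2.1.getD false) v.2.2.2).1)
          (load (fun v => (v.1, v.2.1, v.2.2.1,
              (subBit (v.2.1.getD false) (v.2.2.1.getD false) v.2.2.2).2))
            (goto fun _ => some true))))))

theorem Does.subtract (hrev : A .rev = []) (hflg : A .flg = []) :
    Frag.subtract.Does ρ v (join s A) v
      (join s (Function.update (Function.update (Function.update (Function.update A .num [])
        .cod []) .rev (subBits false (A .num) (A .cod)).1.reverse)
        .flg (if binVal (A .num) < binVal (A .cod) then [true] else [])))
      (3 * (max (A .num).length (A .cod).length + 2)) := by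
  suffices ∀ c l m, ∀ (A : Tape → List Bool) r₁ r₂, A .num = l → A .cod = m → ∃ r',
      Loops (pop (.inr .num) (fun v a => (v.1, a, v.2.2))
        (pop (.inr .cod) (fun v a => (v.1, v.2.1, a, v.2.2.2))
          (branch (fun v => v.2.1.isNone && v.2.2.1.isNone)
            (branch (fun v => v.2.2.2) (push (.inr .flg) (fun _ => true) (goto fun _ => none))
              (goto fun _ => none))
            (push (.inr .rev) (fun v =>
                (subBit (v.2.1.getD false) (v.2.2.1.getD false) v.2.2.2).1)
              (load (fun v => (v.1, v.2.1, v.2.2.1,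
                  (subBit (v.2.1.getD false) (v.2.2.1.getD false) v.2.2.2).2))
                (goto fun _ => some true)))))) v (r₁, r₂, c) (join s A) v r'
      (join s (Function.update (Function.update (Function.update (Function.update A .num [])
        .cod []) .rev ((subBits c l m).1.reverse ++ A .rev))
        .flg (if (subBits c l m).2 then true :: A .flg else A .flg)))
      ((subBits c l m).1.length + 1) by
    obtain ⟨r', h⟩ := this false (A .num) (A .cod) A none none rfl rfl
    have h := h.does (ρ := ρ) 2 (by simp [pushes])
    simp only [hrev, hflg, List.append_nil, subBits_borrow_iff, length_subBits] at h
    exact h.mono (by omega)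
  intro c l m
  induction c, l, m using subBits.induct with
  | case1 c =>
    intro A r₁ r₂ hl hm
    refine ⟨(none, none, c), ?_⟩
    rw [show (subBits c [] []).1.length + 1 = 1 by simp [subBits]]
    refine .done ?_
    cases c
    · simp only [stepAux, join_inr, hl, hm, update_join_inr, List.head?_nil, List.tail_nil]
      simp [subBits, hl, hm]
      funext k
      rcases k with _ | k
      · rfl
      · cases k <;> simp [hl, hm]
    · simp [subBits, hl, hm]
      funext k
      rcases k with _ | k
      · rfl
      · cases k <;> simp [hl, hm]
  | case2 c x l ih =>
    intro A r₁ r₂ hl hm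
    obtain ⟨r', h⟩ := ih (Function.update (Function.update (Function.update A .num l) .cod [])
      .rev ((subBit x false c).1 :: A .rev)) (some x) none (by simp) (by simp)
    refine ⟨r', .more (v' := v) (r' := (some x, none, (subBit x false c).2))
      (S' := join s (Function.update (Function.update (Function.update A .num l) .cod [])
      .rev ((subBit x false c).1 :: A .rev)))
      (by simp [hl, hm]) (h.congr_stacks ?_ ?_)⟩
    · funext k
      cases k <;> simp [subBits]
    · simp [subBits]
  | case3 c y m ih =>
    intro A r₁ r₂ hl hm
    obtain ⟨r', h⟩ := ih (Function.update (Function.update (Function.update A .num []) .cod m)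
      .rev ((subBit false y c).1 :: A .rev)) none (some y) (by simp) (by simp)
    refine ⟨r', .more (v' := v) (r' := (none, some y, (subBit false y c).2))
      (S' := join s (Function.update (Function.update (Function.update A .num []) .cod m)
      .rev ((subBit false y c).1 :: A .rev)))
      (by simp [hl, hm]) (h.congr_stacks ?_ ?_)⟩
    · funext k
      cases k <;> simp [subBits]
    · simp [subBits]
  | case4 c x l y m ih =>
    intro A r₁ r₂ hl hm
    obtain ⟨r', h⟩ := ih (Function.update (Function.update (Function.update A .num l) .cod m)
      .rev ((subBit x y c).1 :: A .rev)) (some x) (some y) (by simp) (by simp)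
    refine ⟨r', .more (v' := v) (r' := (some x, some y, (subBit x y c).2))
      (S' := join s (Function.update (Function.update (Function.update A .num l) .cod m)
      .rev ((subBit x y c).1 :: A .rev)))
      (by simp [hl, hm]) (h.congr_stacks ?_ ?_)⟩
    · funext k
      cases k <;> simp [subBits]
    · simp [subBits]

end Aux

end Frag

/-! ### Oracle machines as fragments -/

open Classical in
/-- An oracle machine as a fragment, where consultations of the oracle are replaced by executions
of the fragment `P`. -/
def Frag.ofOracleTM {ι : Type} (M : OracleTM) (P : Frag (SumΓ M.tm.Γ ι) (M.tm.σ × Reg)) :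
    Frag (SumΓ M.tm.Γ ι) (M.tm.σ × Reg) where
  L := M.tm.Λ ⊕ P.L
  fin := letI := M.tm.ΛFin; inferInstance
  entry := .inl M.tm.main
  code
    | .inl l => if l = M.ask then goto fun _ => some (.inr P.entry)
        else mapLabel (Option.map .inl) (embed ι (M.tm.m l))
    | .inr l => mapLabel (fun o => o.elim (some (.inl M.resume)) fun l => some (.inr l)) (P.code l)

section OracleSim

variable {ι : Type} [Fintype ι] [DecidableEq ι] {ρ : Resource} {M : OracleTM}
  {P : Frag (SumΓ M.tm.Γ ι) (M.tm.σ × Reg)} {O : Str → Str} {A : ι → List Bool} {C K : ℕ}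

/-- The stacks of an oracle machine after a consultation of the oracle. -/
def OracleTM.consult (M : OracleTM) (O : Str → Str) (S : ∀ k, List (M.tm.Γ k)) :
    ∀ k, List (M.tm.Γ k) :=
  Function.update (Function.update S M.queryStack []) M.answerStack
    ((O ((S M.queryStack).map M.queryAlphabet)).map M.answerAlphabet.symm)

/-- The number of symbols that are erased in a consultation of the oracle. -/
def OracleTM.erased (M : OracleTM) (S : ∀ k, List (M.tm.Γ k)) : ℕ :=
  (S M.queryStack).length + (Function.update S M.queryStack [] M.answerStack).length

theorem OracleTM.stkSize_consult (S : ∀ k, List (M.tm.Γ k)) :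
    stkSize (M.consult O S) + M.erased S =
      stkSize S + (O ((S M.queryStack).map M.queryAlphabet)).length := by
  have h1 := stkSize_update S M.queryStack []
  have h2 := stkSize_update (Function.update S M.queryStack []) M.answerStack
    ((O ((S M.queryStack).map M.queryAlphabet)).map M.answerAlphabet.symm)
  simp only [List.length_nil, List.length_map] at h1 h2
  unfold OracleTM.consult OracleTM.erased
  omega

/-- Amortised analysis. A consultation is one step of `M`, but to simulate it takes time
proportional to the number of erased symbols. Each of these was input or was pushed before, so with
the potential `C * stkSize` every step costs at most `C * (maxPushes + K + 1) + 1`. For space no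
amortisation is needed: at most `b` symbols are present, so one consultation adds at most `C * (b +
1)`. -/
theorem Frag.Does.ofOracleTM {x y : Str} {b : ℕ}
    (hP : ∀ v S, P.Does ρ v (join S A) v (join (M.consult O S) A) (C * (M.erased S + 1)))
    (hO : ∀ q, (O q).length ≤ K) (h : M.OutputsWithin ρ O x y b) :
    (Frag.ofOracleTM M P).Does ρ M.tm.initialState (join (StrTM.inStk M.toTM2ComputableAux x) A)
      M.tm.initialState (join (StrTM.outStk M.toTM2ComputableAux y) A)
      ((C + 1) * (maxPushes M.tm + K + 2) * (x.length + b + 1)) := fun r => by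
  obtain ⟨t, ht, h⟩ := RunsWithin.exists_path h
  have key : ∀ {c c' : M.tm.Cfg} {t : ℕ},
      Path (M.step O) (fun d => ρ = .space → cfgSize M.tm d ≤ b) c c' t →
      c'.l = none → ∀ l, c.l = some l → ∀ r, ∃ t' r',
      (ρ = .time → t' + C * stkSize c'.stk ≤
        C * stkSize c.stk + (C * (maxPushes M.tm + K + 1) + 1) * t) ∧
      (Frag.ofOracleTM M P).Runs (fun T => ρ = .space →
        stkSize T ≤ ∑ i, (A i).length + b + C * (b + 1))
        (.inl l) (c.var, r) (join c.stk A) (c'.var, r') (join c'.stk A) t' := by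
    intro c c' t h hc'
    induction h with
    | refl _ => intro l hl; rw [hc'] at hl; cases hl
    | @cons c c₁ c' t hok hs h ih =>
      intro l hl r
      obtain ⟨lc, v, S⟩ := c
      simp only at hl
      subst hl
      have hsize : ∀ d : M.tm.Cfg, (ρ = .space → cfgSize M.tm d ≤ b) → ρ = .space →
          stkSize (join d.stk A) ≤ ∑ i, (A i).length + b + C * (b + 1) := by
        intro d hd hρ
        rw [stkSize_join]
        have : cfgSize M.tm d = stkSize d.stk := rfl
        have := hd hρ
        omega
      have hlen := M.stkSize_consult (O := O) S
      have hle := hO ((S M.queryStack).map M.queryAlphabet)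
      by_cases hl : l = M.ask
      · have hc₁ : c₁ = ⟨some M.resume, v, M.consult O S⟩ := by
          unfold OracleTM.step at hs
          rw [if_pos (by rw [hl])] at hs
          exact (Option.some.inj hs).symm
        subst hc₁
        obtain ⟨r₁, t₁, ht₁, h₁⟩ := hP v S r
        obtain ⟨t₂, r₂, ht₂, h₂⟩ := ih hc' M.resume rfl r₁
        refine ⟨t₁ + t₂ + 1, r₂, fun hρ => ?_, .step (hsize _ hok)
          (l₁ := (Sum.inr P.entry : M.tm.Λ ⊕ P.L))
          (v₁ := (v, r)) (S₁ := join S A) ?_ ?_⟩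
        · have h3 := ht₁ hρ
          have h4 := ht₂ hρ
          simp only at h4 ⊢
          have h5 : C * stkSize (M.consult O S) + C * M.erased S ≤ C * stkSize S + C * K := by
            rw [← mul_add, hlen, ← mul_add]
            gcongr
          have h6 : C * (maxPushes M.tm + K + 1) = C * maxPushes M.tm + C * K + C := by ring
          have h7 : C * (M.erased S + 1) = C * M.erased S + C := by ring
          rw [mul_add_one]
          omega
        · simp [Frag.ofOracleTM, hl]
        · refine Frag.Runs.lift_next (Q := Frag.ofOracleTM M P) (e := Sum.inr)
            (x := .inl M.resume) (fun l => rfl) (h₁.mono fun T hT hρ => (hT hρ).trans ?_) h₂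
          rw [stkSize_join]
          have h3 := hok hρ
          change stkSize S ≤ b at h3
          have h4 : M.erased S ≤ stkSize S := by
            have h1 := stkSize_update S M.queryStack []
            have h2 := stkSize_update (Function.update S M.queryStack []) M.answerStack []
            simp only [List.length_nil] at h1 h2
            unfold OracleTM.erased
            omega
          have h5 : C * (M.erased S + 1) ≤ C * (b + 1) := by gcongr; omega
          omega
      · have hs' : stepAux (M.tm.m l) v S = c₁ := by
          unfold OracleTM.step at hs
          rw [if_neg (by simpa using hl)] at hs
          exact Option.some.inj hs
        have hcode : (Frag.ofOracleTM M P).code (.inl l) =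
            mapLabel (Option.map .inl) (embed ι (M.tm.m l)) := by
          simp [Frag.ofOracleTM, hl]
        have hpush := stkSize_stepAux_le (M.tm.m l) v S
        have hmax := pushes_le_maxPushes M.tm l
        rw [hs'] at hpush
        have hpot : C * stkSize c₁.stk ≤ C * stkSize S + C * maxPushes M.tm := by
          rw [← mul_add]; gcongr; omega
        have h6 : C * (maxPushes M.tm + K + 1) = C * maxPushes M.tm + C * K + C := by ring
        cases h₁ : c₁.l with
        | none =>
          cases h with
          | refl hok' =>
            refine ⟨1, r, fun _ => ?_, .exit (hsize _ hok) (hsize _ hok') ?_⟩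
            · simp only
              omega
            · rw [hcode, stepAux_mapLabel, stepAux_embed, hs', h₁]; rfl
          | cons _ hs₁ _ =>
            obtain ⟨lc, v, S⟩ := c₁
            simp only at h₁
            subst h₁
            simp [OracleTM.step] at hs₁
        | some l₁ =>
          obtain ⟨t₂, r₂, ht₂, h₂⟩ := ih hc' l₁ h₁ r
          refine ⟨t₂ + 1, r₂, fun hρ => ?_, .step (hsize _ hok)
            (l₁ := (Sum.inl l₁ : M.tm.Λ ⊕ P.L)) ?_ h₂⟩
          · have h4 := ht₂ hρ
            simp only at h4 ⊢
            rw [mul_add_one]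
            omega
          · rw [hcode, stepAux_mapLabel, stepAux_embed, hs', h₁]; rfl
  obtain ⟨t', r', ht', h'⟩ := key h rfl M.tm.main rfl r
  have hx : stkSize (StrTM.init M.toTM2ComputableAux x).stk = x.length := by
    rw [StrTM.init, initList_stk, stkSize_update_nil, List.length_map]
  refine ⟨r', t', fun hρ => ?_, ?_⟩
  · have h1 := ht' hρ
    have h2 := ht hρ
    rw [hx] at h1
    calc t' ≤ C * x.length + (C * (maxPushes M.tm + K + 1) + 1) * t := by omega
      _ ≤ C * x.length + (C * (maxPushes M.tm + K + 1) + 1) * b := by gcongr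
      _ ≤ (C + 1) * (maxPushes M.tm + K + 2) * x.length +
          (C + 1) * (maxPushes M.tm + K + 2) * b := by
        gcongr
        · nlinarith
        · nlinarith
      _ ≤ _ := by rw [← mul_add]; exact Nat.mul_le_mul_left _ (by omega)
  · rw [StrTM.init, StrTM.final, initList_stk, haltList_stk] at h'
    refine h'.mono fun T hT hρ => (hT hρ).trans ?_
    rw [stkSize_join]
    have : b + C * (b + 1) ≤ (C + 1) * (maxPushes M.tm + K + 2) * (x.length + b + 1) :=
      calc b + C * (b + 1) ≤ (C + 1) * 1 * (b + 1) := by nlinarith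
        _ ≤ _ := Nat.mul_le_mul (Nat.mul_le_mul_left _ (by omega)) (by omega)
    omega

end OracleSim

/-! ### Oracles given by a finite table -/

/-- The odds `2` on the strings of length `n` where bit `2 * n` of `T` is set, and `1` elsewhere. -/
def tableOdds (T : List Bool) : Odds := fun q =>
  if T[2 * q.length]? = some true then ⟨2, by norm_num⟩ else ⟨1, by norm_num⟩

theorem encodeRat_one : encodeRat 1 = [true, false, true, true] := by
  simp [encodeRat, pairStr]

theorem encodeRat_two : encodeRat 2 = [true, true, false, false, true, true] := by
  have h : Nat.bits 2 = [false, true] := by decide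
  simp [encodeRat, pairStr, h]

theorem encodeRat_tableOdds (T : List Bool) (q : Str) : encodeRat (tableOdds T q) =
    if T[2 * q.length]? = some true then [true, true, false, false, true, true]
    else [true, false, true, true] := by
  unfold tableOdds
  split_ifs
  · exact encodeRat_two
  · exact encodeRat_one

namespace Frag

variable {ρ : Resource} {M : OracleTM} {v : M.tm.σ} {A : Tape → List Bool}

/-- Answer a query to the oracle given by the table on `tab`. -/
def lookup (M : OracleTM) : Frag (SumΓ M.tm.Γ Tape) (M.tm.σ × Reg) :=
  (loop (pop (.inl M.queryStack) (fun v a => (v.1, none, none, a.isSome))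
    (branch (fun v => v.2.2.2)
      (pop (.inr .tab) (fun v a => (v.1, a, none, false))
        (branch (fun v => v.2.1.isSome)
          (push (.inr .tmp) (fun v => v.2.1.getD false)
            (pop (.inr .tab) (fun v a => (v.1, a, none, false))
              (branch (fun v => v.2.1.isSome)
                (push (.inr .tmp) (fun v => v.2.1.getD false) (goto fun _ => some true))
                (goto fun _ => some true))))
          (goto fun _ => some true)))
      (goto fun _ => none)))).seq
  ((clearStk (.inl M.answerStack)).seq
  ((loop (peek (.inr .tab) (fun v a => (v.1, a, none, false))
    (branch (fun v => v.2.1 == some true)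
      ([true, true, false, false, true, true].foldr
        (fun x q => push (.inl M.answerStack) (fun _ => M.answerAlphabet.symm x) q)
        (goto fun _ => none))
      ([true, true, false, true].foldr
        (fun x q => push (.inl M.answerStack) (fun _ => M.answerAlphabet.symm x) q)
        (goto fun _ => none))))).seq
  (move .tmp .tab)))

/-- Every symbol of the query removes two entries of the table, which leaves entry `2 * |q|` on top;
`tmp` keeps the removed entries so that the table can be restored. The cost depends on the erased
symbols only, as the amortisation in `Does.ofOracleTM` demands. -/
theorem Does.lookup (htmp : A .tmp = []) (S : ∀ k, List (M.tm.Γ k)) :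
    (Frag.lookup M).Does ρ v (join S A) v
      (join (M.consult (fun q => encodeRat (tableOdds (A .tab) q)) S) A)
      (30 * (M.erased S + 1)) := by
  have h1 : (loop (pop (.inl M.queryStack) (fun v a => (v.1, none, none, a.isSome))
      (branch (fun v => v.2.2.2)
        (pop (.inr .tab) (fun v a => (v.1, a, none, false))
          (branch (fun v => v.2.1.isSome)
            (push (.inr .tmp) (fun v => v.2.1.getD false)
              (pop (.inr .tab) (fun v a => (v.1, a, none, false))
                (branch (fun v => v.2.1.isSome)
                  (push (.inr .tmp) (fun v => v.2.1.getD false) (goto fun _ => some true))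
                  (goto fun _ => some true))))
            (goto fun _ => some true)))
        (goto fun _ => none))) : Frag (SumΓ M.tm.Γ Tape) (M.tm.σ × Reg)).Does ρ v (join S A) v
      (join (Function.update S M.queryStack []) (Function.update (Function.update A .tab
        ((A .tab).drop (2 * (S M.queryStack).length))) .tmp
          (((A .tab).take (2 * (S M.queryStack).length)).reverse)))
      (3 * ((S M.queryStack).length + 2)) := by
    suffices ∀ q l m r, Loops (pop (.inl M.queryStack) (fun v a => (v.1, none, none, a.isSome))
        (branch (fun v => v.2.2.2)
          (pop (.inr .tab) (fun v a => (v.1, a, none, false))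
            (branch (fun v => v.2.1.isSome)
              (push (.inr .tmp) (fun v => v.2.1.getD false)
                (pop (.inr .tab) (fun v a => (v.1, a, none, false))
                  (branch (fun v => v.2.1.isSome)
                    (push (.inr .tmp) (fun v => v.2.1.getD false) (goto fun _ => some true))
                    (goto fun _ => some true))))
              (goto fun _ => some true)))
          (goto fun _ => none))) v r (join (Function.update S M.queryStack q)
            (Function.update (Function.update A .tab l) .tmp m)) v (none, none, false)
          (join (Function.update S M.queryStack []) (Function.update (Function.update A .tab
            (l.drop (2 * q.length))) .tmp ((l.take (2 * q.length)).reverse ++ m)))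
          (q.length + 1) by
      have h := (this (S M.queryStack) (A .tab) (A .tmp) (none, none, false)).does (ρ := ρ) 2
        (by simp [pushes])
      rw [Function.update_eq_self, Function.update_eq_self, Function.update_eq_self, htmp,
        List.append_nil] at h
      exact h.mono (by omega)
    intro q
    induction q with
    | nil => intro l m r; exact .done (by simp)
    | cons x q ih =>
      intro l m r
      have e : 2 * (x :: q).length = 2 * q.length + 1 + 1 := by simp; ring
      rw [e]
      rcases l with _ | ⟨a, _ | ⟨b, l⟩⟩
      · refine .more ?_ (by simpa using ih [] m (none, none, false))
        simp
        congr 1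
        funext k
        cases k <;> simp
      · refine .more ?_ (by simpa using ih [] (a :: m) (none, none, false))
        simp [Function.update_comm]
      · refine .more ?_ (by simpa using ih l (b :: a :: m) (some b, none, false))
        simp [Function.update_comm]
  -- The fold pushes the first bit first, so the bits arrive on the stack in reverse order. The code
  -- of 2 is a palindrome; the code of 1 is not.
  have h2 : ∀ (S : ∀ k, List (M.tm.Γ k)) (A : Tape → List Bool), S M.answerStack = [] →
      (loop (peek (.inr .tab) (fun v a => (v.1, a, none, false))
        (branch (fun v => v.2.1 == some true)
          ([true, true, false, false, true, true].foldr
            (fun x q => push (.inl M.answerStack) (fun _ => M.answerAlphabet.symm x) q)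
            (goto fun _ => none))
          ([true, true, false, true].foldr
            (fun x q => push (.inl M.answerStack) (fun _ => M.answerAlphabet.symm x) q)
            (goto fun _ => none)))) : Frag (SumΓ M.tm.Γ Tape) (M.tm.σ × Reg)).Does ρ v
        (join S A) v (join (Function.update S M.answerStack
          ((if (A .tab).head? = some true then [true, true, false, false, true, true]
            else [true, false, true, true]).map M.answerAlphabet.symm)) A) 14 := by
    intro S A hS
    refine (Loops.does (r' := ((A .tab).head?, none, false)) (t := 1) 6 (by simp [pushes])
      (.done ?_)).mono le_rfl
    by_cases h : (A .tab).head? = some true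
    · simp [h, hS]
    · simp [h, hS, beq_eq_false_iff_ne.2 h]
  have h3 : ∀ (S : ∀ k, List (M.tm.Γ k)) (A : Tape → List Bool),
      (Frag.clearStk (.inl M.answerStack) : Frag (SumΓ M.tm.Γ Tape) (M.tm.σ × Reg)).Does ρ v
        (join S A) v (join (Function.update S M.answerStack []) A)
        ((S M.answerStack).length + 2) := by
    intro S A
    rw [← update_join_inl]
    exact Does.clearStk
  have h4 := h1.seq ((h3 _ _).seq ((h2 _ _ (by simp)).seq
    (Does.move (i := .tmp) (j := .tab) (by decide))))
  have hS : M.consult (fun q => encodeRat (tableOdds (A .tab) q)) S =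
      Function.update (Function.update (Function.update S M.queryStack []) M.answerStack [])
        M.answerStack ((if ((A .tab).drop (2 * (S M.queryStack).length)).head? = some true then
          [true, true, false, false, true, true]
            else [true, false, true, true]).map M.answerAlphabet.symm) := by
    rw [OracleTM.consult, Function.update_idem, List.head?_drop]
    simp only [encodeRat_tableOdds, List.length_map]
  rw [hS]
  refine Does.congr (h4.mono (le_refl _)) ?_ ?_
  · funext k
    cases k <;> simp [htmp]
  · simp only [OracleTM.erased]
    simp
    omega

end Frag

/-! ### Enumeration of tables -/

/-- The binary expansion of `r`, most significant bit first. -/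
def table (r : ℕ) : List Bool := (inc^[r] []).reverse

theorem length_iterate_inc_le (r : ℕ) (l : List Bool) : (inc^[r] l).length ≤ l.length + r := by
  induction r with
  | zero => simp
  | succ r ih =>
    rw [Function.iterate_succ_apply']
    exact (length_inc_le _).trans (by omega)

theorem length_table_le (r : ℕ) : (table r).length ≤ r := by
  simpa [table] using length_iterate_inc_le r []

theorem getLast?_inc {l : List Bool} (hl : l.getLast? ≠ some false) :
    (inc l).getLast? = some true := by
  induction l with
  | nil => rfl
  | cons x l ih =>
    rcases l with _ | ⟨y, l⟩
    · cases x <;> simp [inc] at hl ⊢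
    · have hl' : (y :: l).getLast? ≠ some false := by simpa [List.getLast?_cons_cons] using hl
      cases x
      · have : (y :: l).getLast? = some true := by
          rcases h : (y :: l).getLast? with _ | _ | _
          · simp at h
          · exact absurd h hl'
          · rfl
        simp only [inc, List.getLast?_cons_cons, this]
      · have := ih hl'
        rcases h : inc (y :: l) with _ | ⟨z, m⟩
        · simp [h] at this
        · rw [inc, h, List.getLast?_cons_cons, ← h, this]

theorem getLast?_iterate_inc (r : ℕ) : (inc^[r] []).getLast? ≠ some false := by
  induction r with
  | zero => simp
  | succ r ih =>
    rw [Function.iterate_succ_apply', getLast?_inc ih]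
    simp

theorem head?_table {r : ℕ} (hr : 0 < r) : (table r).head? = some true := by
  obtain ⟨r, rfl⟩ := Nat.exists_eq_succ_of_ne_zero hr.ne'
  rw [table, List.head?_reverse, Function.iterate_succ_apply']
  exact getLast?_inc (getLast?_iterate_inc r)

theorem binVal_pos {l : List Bool} (h : l.getLast? = some true) : 0 < binVal l := by
  induction l with
  | nil => simp at h
  | cons x l ih =>
    rw [binVal_cons]
    rcases l with _ | ⟨y, l⟩
    · simp at h; subst h; simp
    · have := ih (by simpa [List.getLast?_cons_cons] using h)
      omega

theorem binVal_injective {l m : List Bool} (hl : l.getLast? ≠ some false)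
    (hm : m.getLast? ≠ some false) (h : binVal l = binVal m) : l = m := by
  have hpos : ∀ {l : List Bool}, l.getLast? ≠ some false → l ≠ [] → 0 < binVal l := by
    intro l hl hne
    refine binVal_pos ?_
    rcases h : l.getLast? with _ | _ | _
    · simp at h; exact absurd h hne
    · exact absurd h hl
    · rfl
  induction l generalizing m with
  | nil =>
    by_contra hne
    have := hpos hm (Ne.symm hne)
    simp at h
    omega
  | cons x l ih =>
    rcases m with _ | ⟨y, m⟩
    · have := hpos hl (by simp)
      simp at h
      omega
    · have hx := Bool.toNat_lt x
      have hy := Bool.toNat_lt y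
      rw [binVal_cons, binVal_cons] at h
      have hxy : x = y := by
        have : x.toNat = y.toNat := by omega
        revert this
        cases x <;> cases y <;> simp
      have tl : ∀ {x : Bool} {l : List Bool}, (x :: l).getLast? ≠ some false →
          l.getLast? ≠ some false := by
        intro x l h
        rcases l with _ | ⟨z, l⟩
        · simp
        · simpa [List.getLast?_cons_cons] using h
      rw [hxy, ih (tl hl) (tl hm) (by subst hxy; omega)]

/-- A string with leading 1 is the expansion of its own value, so it occurs as a table. The bound on
the length makes the precision `2⁻ʳ` small enough later on. -/
theorem exists_table (l : List Bool) : ∃ r, l.length < r ∧ table r = true :: l := by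
  have h : inc^[binVal (l.reverse ++ [true])] [] = l.reverse ++ [true] := by
    refine binVal_injective (getLast?_iterate_inc _) (by simp) ?_
    have : ∀ n, binVal (inc^[n] []) = n := by
      intro n
      induction n with
      | zero => rfl
      | succ n ih => rw [Function.iterate_succ_apply', binVal_inc, ih]
    exact this _
  refine ⟨binVal (l.reverse ++ [true]), ?_, by simp [table, h]⟩
  have := length_iterate_inc_le (binVal (l.reverse ++ [true])) []
  rw [h] at this
  simpa using this

/-! ### The next bit of a constructor -/

/-- The next bit after `w`: the entry `2 * |w| + 1` of the table `T`, or the default `c` if the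
table is too short. -/
def nextBit (T : List Bool) (w : Str) (c : Bool) : Bool := T[2 * w.length + 1]?.getD c

namespace Frag

section Aux

variable {K : Type} [DecidableEq K] [Fintype K] {Γ : K → Type}
  {σ : Type} {ρ : Resource} {v v' v'' : σ} {s s' s'' : ∀ k, List (Γ k)}
  {A A' A'' : Tape → List Bool} {b b' : ℕ}

/-- Append the bit `0` to the string on `inp`, with the result on `acc`. -/
def appendZero : Frag (SumΓ Γ Tape) (σ × Reg) :=
  (move .inp .str).seq ((pushBits .acc [false]).seq (move .str .acc))

theorem Does.appendZero {w : Str} :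
    Frag.appendZero.Does ρ v (join s (Function.update (fun _ => []) .inp w)) v
      (join s (Function.update (fun _ => []) .acc (w ++ [false]))) (12 * (w.length + 1)) := by
  refine ((Does.move (by decide)).seq ((Does.pushBits [false]).seq
    (Does.move (by decide)))).congr ?_ ?_
  · funext k
    cases k <;> simp
  · simp
    omega

/-- Move the unary number on `uno` to `prc`, and count it in binary on `num`. -/
def buildTable : Frag (SumΓ Γ Tape) (σ × Reg) :=
  forEach .uno ((pushBits .prc [true]).seq (incr .num .tmp))
    ((pushBits .prc [true]).seq (incr .num .tmp))

theorem Does.buildTable : ∀ (r : ℕ) (A : Tape → List Bool), A .uno = List.replicate r true →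
    A .tmp = [] → Frag.buildTable.Does ρ v (join s A) v
      (join s (Function.update (Function.update (Function.update A .uno [])
        .prc (List.replicate r true ++ A .prc)) .num (inc^[r] (A .num))))
      ((4 * ((A .num).length + r) + 17) * r + 1) := by
  intro r
  induction r with
  | zero =>
    intro A hu ht
    refine (Does.forEach_nil hu).congr ?_ (by simp)
    funext k
    cases k <;> simp [hu]
  | succ r ih =>
    intro A hu ht
    refine (Does.forEach_cons (x := true) (l := List.replicate r true) (by rw [hu]; rfl)
      ((Does.pushBits [true]).seq (Does.incr (by decide))) (ih _ ?_ ?_)).congr ?_ ?_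
    · simp
    · simp
    · funext k
      cases k <;> simp [ht]
      rw [List.append_cons, ← List.replicate_succ']
    · have := length_inc_le (A .num)
      simp [ht]
      have h2 : (4 * ((inc (A .num)).length + r) + 17) * r ≤
        (4 * ((A .num).length + (r + 1)) + 17) * r := by gcongr ?_ * r; omega
      rw [mul_add_one (4 * ((A .num).length + (r + 1)) + 17)]
      omega

/-- Push the top of `tab` to `acc` if `tab` is not empty, and the flag on `flg` otherwise. -/
def chooseBit : Frag (SumΓ Γ Tape) (σ × Reg) :=
  ifEmpty .tab (ifEmpty .flg (pushBits .acc [false]) (pushBits .acc [true]))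
    ((pushBits .uno [true]).seq (moveCount .uno .tab .acc))

theorem Does.chooseBit {c : Bool} (hflg : A .flg = if c then [true] else [])
    (huno : A .uno = []) (hacc : A .acc = []) :
    Frag.chooseBit.Does ρ v (join s A) v
      (join s (Function.update (Function.update A .tab (A .tab).tail)
        .acc [(A .tab).head?.getD c])) 20 := by
  rcases hT : A .tab with _ | ⟨x, l⟩
  · cases c
    · refine (Does.ifEmpty_nil hT (Does.ifEmpty_nil (by simpa using hflg)
        (Does.pushBits [false]))).congr ?_ (by simp)
      funext k
      cases k <;> simp [hacc, hT]
    · refine (Does.ifEmpty_nil hT (Does.ifEmpty_cons (by simp [hflg])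
        (Does.pushBits [true]))).congr ?_ (by simp)
      funext k
      cases k <;> simp [hacc, hT]
  · refine (Does.ifEmpty_cons (by simp [hT]) ((Does.pushBits [true]).seq
      (Does.moveCount (by decide) (by decide) (by decide)))).congr ?_ (by simp [huno])
    funext k
    cases k <;> simp [hacc, huno, hT]

/-- Choose the next bit: from the table on `tab` if it is long enough, and from the flag on `flg`
otherwise, append it to the string that is reversed on `str`, with the result on `acc`. -/
def appendBit : Frag (SumΓ Γ Tape) (σ × Reg) :=
  (move₂ .str .cpy .uno).seq ((moveCount .uno .tab .tmp).seq
  ((move₂ .cpy .str .uno).seq ((moveCount .uno .tab .tmp).seq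
  ((clear .tmp).seq ((dropTop .tab 1).seq (chooseBit.seq
  ((clear .tab).seq ((clear .flg).seq (move .str .acc)))))))))

/-- The string is moved from `str` to `cpy` and back, and each pass leaves a counter of length |w|
on `uno`. Thus 2|w| entries of the table are removed, one more is dropped, and the wanted entry is
on top. Two passes also restore the order on `str`. -/
theorem Does.appendBit {w : Str} {c : Bool} {T : List Bool} (hstr : A .str = w.reverse)
    (htab : A .tab = T) (hflg : A .flg = if c then [true] else []) (hcpy : A .cpy = [])
    (huno : A .uno = []) (htmp : A .tmp = []) (hacc : A .acc = []) :
    Frag.appendBit.Does ρ v (join s A) v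
      (join s (Function.update (Function.update (Function.update (Function.update A .str [])
        .tab []) .flg []) .acc (w ++ [nextBit T w c]))) (20 * (w.length + T.length + 4)) := by
  refine ((Does.move₂ (by decide) (by decide) (by decide)).seq
    ((Does.moveCount (by decide) (by decide) (by decide)).seq
    ((Does.move₂ (by decide) (by decide) (by decide)).seq
    ((Does.moveCount (by decide) (by decide) (by decide)).seq
    (Does.clear.seq (Does.dropTop.seq ((Does.chooseBit (c := c) ?_ ?_ ?_).seq
    (Does.clear.seq (Does.clear.seq (Does.move (by decide))))))))))).congr ?_ ?_
  · simp [hflg]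
  · simp
  · simp [hacc]
  · have h2 : w.length + w.length + 1 = 2 * w.length + 1 := by omega
    funext k
    cases k <;> simp [hstr, htab, hcpy, huno, htmp, nextBit, h2]
  · cases c <;> simp [hstr, htab, hcpy, huno, htmp, hflg] <;> omega

end Aux

end Frag

theorem OracleTM.OutputsWithin.length_le {ρ : Resource} {M : OracleTM} {O : Str → Str} {K : ℕ}
    {x y : Str} {b : ℕ} (hO : ∀ q, (O q).length ≤ K) (h : M.OutputsWithin ρ O x y b) :
    y.length ≤ x.length + (maxPushes M.tm + K + 1) * b := by
  obtain ⟨t, ht, h⟩ := RunsWithin.exists_path h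
  have hy : stkSize (StrTM.final M.toTM2ComputableAux y).stk = y.length := by
    rw [StrTM.final, haltList_stk, stkSize_update_nil, List.length_map]
  have hx : stkSize (StrTM.init M.toTM2ComputableAux x).stk = x.length := by
    rw [StrTM.init, initList_stk, stkSize_update_nil, List.length_map]
  cases ρ with
  | space =>
    have := h.ok_right rfl
    change stkSize (StrTM.final M.toTM2ComputableAux y).stk ≤ b at this
    nlinarith
  | time =>
    have key : ∀ {c c' : M.tm.Cfg} {t : ℕ} {ok}, Path (M.step O) ok c c' t →
        stkSize c'.stk ≤ stkSize c.stk + (maxPushes M.tm + K) * t := by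
      intro c c' t ok h
      induction h with
      | refl _ => simp
      | @cons c c₁ c' t hok hs h ih =>
        have h1 : stkSize c₁.stk ≤ stkSize c.stk + (maxPushes M.tm + K) := by
          unfold OracleTM.step at hs
          split_ifs at hs with hl
          · have hlen := M.stkSize_consult (O := O) c.stk
            have hle := hO ((c.stk M.queryStack).map M.queryAlphabet)
            rw [← Option.some.inj hs]
            change stkSize (M.consult O c.stk) ≤ _
            omega
          · obtain ⟨lc, v, S⟩ := c
            cases lc with
            | none => simp at hs
            | some l =>
              have hs' : stepAux (M.tm.m l) v S = c₁ := Option.some.inj hs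
              have h1 := stkSize_stepAux_le (M.tm.m l) v S
              rw [hs'] at h1
              have h2 := pushes_le_maxPushes M.tm l
              simp only
              omega
        rw [mul_add_one]
        omega
    have h1 := key h
    have h2 := ht rfl
    rw [hx, hy] at h1
    nlinarith

/-! ### The machine that computes all the constructors. -/

namespace Frag

variable {ρ : Resource} {M : OracleTM}

/-- Append to the string on `inp` the bit that `M` and the table with the number on `uno`
determine. -/
def appendNext (M : OracleTM) : Frag (SumΓ M.tm.Γ Tape) (M.tm.σ × Reg) :=
  (buildTable.seq ((move .num .tab).seq ((pushBits .prc [false]).seq ((move₂ .inp .prc .str).seq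
    (pushBits .prc [false]))))).seq ((pour M.toTM2ComputableAux .prc).seq
  ((ofOracleTM M (lookup M)).seq (((drain M.toTM2ComputableAux .cpy).seq (move .cpy .cod)).seq
  (unpair.seq (subtract.seq ((clear .rev).seq appendBit))))))

/-- The machine `M` is asked for the value at w0. The final borrow of numerator minus denominator
tells whether the approximation is less than 1, and this is the default for the next bit: a small
value at w0 means that the sequence continues with 1. -/
theorem Does.appendNext {r b : ℕ} {w p q : Str}
    (h : M.OutputsWithin ρ (fun v => encodeRat (tableOdds (table r) v))
      (encodeNatStr r (w ++ [false])) (pairStr p q) b) :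
    (Frag.appendNext M).Does ρ M.tm.initialState
      (join (fun _ => []) (Function.update (Function.update (fun _ => []) .uno
        (List.replicate r true)) .inp w)) M.tm.initialState
      (join (fun _ => []) (Function.update (fun _ => []) .acc
        (w ++ [nextBit (table r) w (decide (binVal p < binVal q))])))
      ((31 * (maxPushes M.tm + 8) + 200) * ((r + w.length + 2) ^ 2 + b + (pairStr p q).length)) := by
  have hO : ∀ q, (encodeRat (tableOdds (table r) q)).length ≤ 6 := by
    intro q
    rw [encodeRat_tableOdds]
    split_ifs <;> simp
  have hnum : inc^[r] [] = (table r).reverse := by simp [table]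
  set A : Tape → List Bool := Function.update (Function.update (fun _ => []) .uno
    (List.replicate r true)) .inp w with hA
  have h1 := (Does.buildTable (ρ := ρ) (Γ := M.tm.Γ) (v := M.tm.initialState) (s := fun _ => [])
    r A (by simp [hA]) (by simp [hA])).seq
    ((Does.move (i := .num) (j := .tab) (by decide)).seq ((Does.pushBits (i := .prc) [false]).seq
    ((Does.move₂ (i := .inp) (j := .prc) (k := .str) (by decide) (by decide) (by decide)).seq
    (Does.pushBits (i := .prc) [false]))))
  set A₁ : Tape → List Bool := Function.update (Function.update (fun _ => []) .tab (table r))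
    .str w.reverse with hA₁
  have h1 := h1.congr (A'' := Function.update A₁ .prc
    (encodeNatStr r (w ++ [false])).reverse) (b' := 60 * (r + w.length + 2) ^ 2) (by
      funext k
      cases k <;> simp [hA, hA₁, hnum, encodeNatStr]) (by
      have := length_table_le r
      simp [hA, hnum]
      nlinarith)
  have h2 := Does.pour (ρ := ρ) (M := M.toTM2ComputableAux) (v := M.tm.initialState)
    (A := Function.update A₁ .prc (encodeNatStr r (w ++ [false])).reverse) (i := .prc)
  have h2 := h2.congr (A'' := A₁) (b' := 2 * (r + w.length + 5)) (by
      funext k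
      cases k <;> simp [hA₁]) (by simp [encodeNatStr]; omega)
  rw [Function.update_self, List.reverse_reverse] at h2
  have h3 := Does.ofOracleTM (C := 30) (A := A₁) (K := 6) (fun v S => by
    have := Does.lookup (ρ := ρ) (v := v) (A := A₁) (by simp [hA₁]) S
    rwa [show A₁ .tab = table r by simp [hA₁]] at this) hO h
  have h4 := (Does.drain (ρ := ρ) (M := M.toTM2ComputableAux) (v := M.tm.initialState) (A := A₁)
    (i := .cpy) (y := pairStr p q)).seq (Does.move (i := .cpy) (j := .cod) (by decide))
  have h4 := h4.congr (A'' := Function.update A₁ .cod (pairStr p q))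
    (b' := 4 * ((pairStr p q).length + 2)) (by
      funext k
      cases k <;> simp [hA₁]) (by simp [hA₁]; omega)
  have h5 := (Does.unpair (ρ := ρ) (v := M.tm.initialState) (Γ := M.tm.Γ) (s := fun _ => [])
    (A := Function.update A₁ .cod (pairStr p q)) (x := p) (y := q) (by simp) (by simp [hA₁])
    (by simp [hA₁])).seq
    ((Does.subtract (by simp [hA₁]) (by simp [hA₁])).seq
    ((Does.clear (i := .rev)).seq (Does.appendBit (w := w) (T := table r)
      (c := decide (binVal p < binVal q)) (by simp [hA₁]) (by simp [hA₁]) (by simp [hA₁])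
      (by simp [hA₁]) (by simp [hA₁]) (by simp [hA₁]) (by simp [hA₁]))))
  refine (h1.seq (h2.seq (h3.seq (h4.seq h5)))).congr ?_ ?_
  · funext k
    cases k <;> simp [hA₁]
  · have hT := length_table_le r
    have hx : (encodeNatStr r (w ++ [false])).length = r + w.length + 2 := by
      simp [encodeNatStr]; omega
    have hy : (pairStr p q).length = 2 * p.length + q.length + 1 := by
      simp [pairStr]; omega
    rw [hx, hy]
    simp [length_subBits, hA₁]
    generalize hN : r + w.length + 2 = N
    have hN2 : N + 1 ≤ N ^ 2 := by nlinarith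
    have hD : 31 * (maxPushes M.tm + 6 + 2) * (N + b + 1) ≤
        31 * (maxPushes M.tm + 8) * (N ^ 2 + b + (2 * p.length + q.length + 1)) :=
      Nat.mul_le_mul le_rfl (by omega)
    rw [add_mul]
    omega

/-- The machine that computes the constructors that are given by `M` and the tables. -/
def nextFrag (M : OracleTM) : Frag (SumΓ M.tm.Γ Tape) (M.tm.σ × Reg) :=
  (splitOnes .inp .uno).seq (ifEmpty .inp (clear .uno) ((dropTop .inp 1).seq ((dropTop .uno 6).seq
    (ifEmpty .uno appendZero (appendNext M)))))

/-- The function that is computed by `nextFrag`. Here `c r w` is the default for the bit after `w`,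
with precision `r`. -/
def nextFun (c : ℕ → Str → Bool) (x : Str) : Str :=
  match x.dropWhile id with
  | [] => []
  | _ :: w =>
    if (x.takeWhile id).length ≤ 6 then w ++ [false]
    else w ++ [nextBit (table ((x.takeWhile id).length - 6)) w ((c ((x.takeWhile id).length - 6)) w)]

theorem nextFun_encodeNatStr (c : ℕ → Str → Bool) (k : ℕ) (w : Str) :
    nextFun c (encodeNatStr k w) = if k ≤ 6 then w ++ [false]
      else w ++ [nextBit (table (k - 6)) w (c (k - 6) w)] := by
  simp [nextFun, encodeNatStr]

/-- The machine also has to halt on strings that code no pair. They consist of ones only, and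
`nextFun` is empty there. -/
theorem exists_encodeNatStr_or (x : Str) :
    (∃ k, x = List.replicate k true) ∨ ∃ k w, x = encodeNatStr k w := by
  induction x with
  | nil => exact .inl ⟨0, rfl⟩
  | cons b x ih =>
    cases b
    · exact .inr ⟨0, x, rfl⟩
    · rcases ih with ⟨k, rfl⟩ | ⟨k, w, rfl⟩
      · exact .inl ⟨k + 1, rfl⟩
      · exact .inr ⟨k + 1, w, rfl⟩

theorem Does.nextFrag {c : ℕ → Str → Bool} {x : Str} {b l : ℕ}
    (h : ∀ r w, 0 < r → x = encodeNatStr (r + 6) w → ∃ p q,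
      M.OutputsWithin ρ (fun v => encodeRat (tableOdds (table r) v))
        (encodeNatStr r (w ++ [false])) (pairStr p q) b ∧
      c r w = decide (binVal p < binVal q) ∧ (pairStr p q).length ≤ l) :
    (Frag.nextFrag M).Does ρ M.tm.initialState
      (join (fun _ => []) (Function.update (fun _ => []) .inp x)) M.tm.initialState
      (join (fun _ => []) (Function.update (fun _ => []) .acc (nextFun c x)))
      ((31 * (maxPushes M.tm + 8) + 300) * ((x.length + 1) ^ 2 + b + l)) := by
  have hcost : 300 * (x.length + 1) ≤
      (31 * (maxPushes M.tm + 8) + 300) * ((x.length + 1) ^ 2 + b + l) :=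
    Nat.mul_le_mul (by omega) (by nlinarith)
  rcases exists_encodeNatStr_or x with ⟨k, rfl⟩ | ⟨k, w, rfl⟩
  · refine ((Does.splitOnes (n := k) (l := []) (by decide) (by simp) (by simp)).seq
      (Does.ifEmpty_nil (by simp) Does.clear)).congr ?_ ?_
    · funext j
      cases j <;> simp [nextFun]
    · simp at hcost ⊢
      omega
  · have hx : (encodeNatStr k w).length = k + w.length + 1 := by simp [encodeNatStr]; omega
    have hsplit := Does.splitOnes (ρ := ρ) (Γ := M.tm.Γ) (v := M.tm.initialState)
      (s := fun _ => []) (A := Function.update (fun _ => []) .inp (encodeNatStr k w))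
      (i := .inp) (j := .uno) (n := k) (l := false :: w) (by decide)
      (by simp [encodeNatStr]) (by simp)
    have hdrop := (Does.dropTop (ρ := ρ) (Γ := M.tm.Γ) (v := M.tm.initialState)
      (s := fun _ => []) (A := Function.update (Function.update (fun _ => []) .inp (false :: w))
        .uno (List.replicate k true)) (i := .inp) (n := 1)).congr
        (A'' := Function.update (Function.update (fun _ => []) .uno (List.replicate k true)) .inp w)
        (b' := 2) (by funext j; cases j <;> simp) le_rfl
    have hdrop₂ := (Does.dropTop (ρ := ρ) (Γ := M.tm.Γ) (v := M.tm.initialState)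
      (s := fun _ => []) (A := Function.update (Function.update (fun _ => []) .uno
        (List.replicate k true)) .inp w) (i := .uno) (n := 6)).congr
        (A'' := Function.update (Function.update (fun _ => []) .uno
          (List.replicate (k - 6) true)) .inp w)
        (b' := 2) (by funext j; cases j <;> simp) le_rfl
    have hsplit := hsplit.congr (A'' := Function.update (Function.update (fun _ => []) .inp
      (false :: w)) .uno (List.replicate k true)) (by funext j; cases j <;> simp) le_rfl
    rw [nextFun_encodeNatStr]
    split_ifs with hk
    · have hA : Function.update (Function.update (fun _ => []) .uno
          (List.replicate (k - 6) true)) .inp w =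
          (Function.update (fun _ => []) .inp w : Tape → List Bool) := by
        funext j
        cases j <;> simp; omega
      rw [hA] at hdrop₂
      refine (hsplit.seq (Does.ifEmpty_cons (by simp) (hdrop.seq (hdrop₂.seq
        (Does.ifEmpty_nil (by simp) Does.appendZero))))).congr rfl ?_
      rw [hx] at hcost ⊢
      omega
    · obtain ⟨p, q, ho, hc, hl⟩ := h (k - 6) w (by omega) (by rw [Nat.sub_add_cancel (by omega)])
      rw [hc]
      refine (hsplit.seq (Does.ifEmpty_cons (by simp) (hdrop.seq (hdrop₂.seq
        (Does.ifEmpty_cons (by simp; omega) (Does.appendNext ho)))))).congr rfl ?_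
      rw [hx]
      have h1 : (31 * (maxPushes M.tm + 8) + 200) *
          ((k - 6 + w.length + 2) ^ 2 + b + (pairStr p q).length) ≤
          (31 * (maxPushes M.tm + 8) + 200) * ((k + w.length + 1 + 1) ^ 2 + b + l) := by
        exact Nat.mul_le_mul le_rfl (add_le_add (add_le_add (Nat.pow_le_pow_left (by omega) 2)
          le_rfl) hl)
      have h2 : 100 * (k + w.length + 1 + 1) ≤ 100 * ((k + w.length + 1 + 1) ^ 2 + b + l) := by
        exact Nat.mul_le_mul le_rfl (by nlinarith)
      have h3 : (31 * (maxPushes M.tm + 8) + 300) * ((k + w.length + 1 + 1) ^ 2 + b + l) =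
          (31 * (maxPushes M.tm + 8) + 200) * ((k + w.length + 1 + 1) ^ 2 + b + l) +
          100 * ((k + w.length + 1 + 1) ^ 2 + b + l) := by ring
      omega

end Frag

/-! ### Resource bounds -/

namespace ResourceClass

variable {Δ : ResourceClass} {t t' : ℕ → ℕ}

/-- The little-o relation with constant 1 gives the inequality for large `j`; the finitely many
other values are absorbed by `C`. So any two bounds of the class have a common upper bound of the
form required by `IsBound`. -/
theorem exists_g_le_succ (Δ : ResourceClass) (n : ℕ) : ∃ C, ∀ j, Δ.g n j ≤ Δ.g (n + 1) j + C := by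
  have h := (Δ.isLittleO_succ n).bound (c := 1) one_pos
  obtain ⟨J, hJ⟩ := eventually_atTop.1 h
  refine ⟨∑ i ∈ Finset.range J, Δ.g n i, fun j => ?_⟩
  by_cases hj : J ≤ j
  · have := hJ j hj
    simp at this
    omega
  · have := Finset.single_le_sum (f := fun i => Δ.g n i) (fun i _ => Nat.zero_le _)
      (Finset.mem_range.2 (not_le.1 hj))
    change Δ.g n j ≤ _ at this
    omega

theorem exists_g_le (Δ : ResourceClass) {n m : ℕ} (h : n ≤ m) :
    ∃ C, ∀ j, Δ.g n j ≤ Δ.g m j + C := by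
  induction m, h using Nat.le_induction with
  | base => exact ⟨0, fun j => le_rfl⟩
  | succ m _ ih =>
    obtain ⟨C, hC⟩ := ih
    obtain ⟨C', hC'⟩ := Δ.exists_g_le_succ m
    exact ⟨C' + C, fun j => by have := hC j; have := hC' j; omega⟩

theorem IsBound.mono (h : Δ.IsBound t) (hle : ∀ j, t' j ≤ t j) : Δ.IsBound t' := by
  obtain ⟨n, C, h⟩ := h
  exact ⟨n, C, fun j => (hle j).trans (h j)⟩

theorem IsBound.add (h : Δ.IsBound t) (h' : Δ.IsBound t') : Δ.IsBound fun j => t j + t' j := by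
  obtain ⟨n, C, h⟩ := h
  obtain ⟨n', C', h'⟩ := h'
  obtain ⟨D, hD⟩ := Δ.exists_g_le (le_max_left n n')
  obtain ⟨D', hD'⟩ := Δ.exists_g_le (le_max_right n n')
  refine ⟨max n n', C * (D + 1) + C' * (D' + 1), fun j => ?_⟩
  have h1 := (h j).trans (Nat.add_le_add_right (Nat.mul_le_mul_left C (hD j)) C)
  have h2 := (h' j).trans (Nat.add_le_add_right (Nat.mul_le_mul_left C' (hD' j)) C')
  calc t j + t' j ≤ _ := add_le_add h1 h2
    _ ≤ _ := by ring_nf; nlinarith [Nat.zero_le (C * D * Δ.g (max n n') j),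
      Nat.zero_le (C' * D' * Δ.g (max n n') j)]

theorem IsBound.const_mul (h : Δ.IsBound t) (c : ℕ) : Δ.IsBound fun j => c * t j := by
  obtain ⟨n, C, h⟩ := h
  refine ⟨n, c * C, fun j => ?_⟩
  calc c * t j ≤ c * (C * Δ.g n j + C) := Nat.mul_le_mul_left c (h j)
    _ = _ := by ring

theorem isBound_pow (Δ : ResourceClass) (d : ℕ) : Δ.IsBound fun j => j ^ d := by
  obtain ⟨n, C, h⟩ := Δ.polynomial d
  exact ⟨n, C, h⟩

theorem isBound_const (Δ : ResourceClass) (c : ℕ) : Δ.IsBound fun _ => c := by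
  simpa using (Δ.isBound_pow 0).const_mul c

theorem isBound_id (Δ : ResourceClass) : Δ.IsBound fun j => j := by
  simpa using Δ.isBound_pow 1

end ResourceClass

/-! ### Encodings -/

theorem length_encodeNatStr (k : ℕ) (w : Str) : (encodeNatStr k w).length = k + w.length + 1 := by
  simp [encodeNatStr]
  omega

theorem pairStr_injective {x y x' y' : Str} (h : pairStr x y = pairStr x' y') :
    x = x' ∧ y = y' := by
  have hrep : ∀ (m n : ℕ) (l l' : List Bool), List.replicate m true ++ false :: l =
      List.replicate n true ++ false :: l' → m = n ∧ l = l' := by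
    intro m
    induction m with
    | zero =>
      intro n l l' h
      cases n with
      | zero => simpa using h
      | succ n => simp [List.replicate_succ] at h
    | succ m ih =>
      intro n l l' h
      cases n with
      | zero => simp [List.replicate_succ] at h
      | succ n =>
        rw [List.replicate_succ, List.replicate_succ, List.cons_append, List.cons_append] at h
        obtain ⟨h1, h2⟩ := ih n l l' (List.cons.inj h).2
        exact ⟨by rw [h1], h2⟩
  obtain ⟨h1, h2⟩ := hrep _ _ _ _ h
  exact List.append_inj h2 h1

theorem CodesRat.unique {s : Str} {q q' : ℚ} (h : CodesRat s q) (h' : CodesRat s q') : q = q' := by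
  obtain ⟨a, b, rfl, _, rfl⟩ := h
  obtain ⟨a', b', h', _, rfl⟩ := h'
  obtain ⟨rfl, rfl⟩ := pairStr_injective h'
  rfl

@[simp] theorem length_pre (S : Cantor) (n : ℕ) : (pre S n).length = n := by simp [pre]

theorem pre_succ (S : Cantor) (n : ℕ) : pre S (n + 1) = pre S n ++ [S n] := by
  simp [pre, List.range_succ]

/-! ### Continuity of functionals -/

/-- A run is finite, so `L` can be taken as the maximal length of the query stack during the run. -/
theorem OracleTM.exists_path_congr {M : OracleTM} {A : Str → Str} {ok : M.tm.Cfg → Prop}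
    {c c' : M.tm.Cfg} {t : ℕ} (h : Path (M.step A) ok c c' t) :
    ∃ L, ∀ A' : Str → Str, (∀ v, v.length ≤ L → A' v = A v) → Path (M.step A') ok c c' t := by
  induction h with
  | refl h => exact ⟨0, fun _ _ => .refl h⟩
  | @cons c c₁ c' t hok hs h ih =>
    obtain ⟨L, ih⟩ := ih
    refine ⟨max L (c.stk M.queryStack).length, fun A' hA' =>
      .cons hok ?_ (ih A' fun v hv => hA' v (hv.trans (le_max_left _ _)))⟩
    rw [← hs]
    unfold OracleTM.step
    rw [hA' _ (by simp)]

/-- If the oracles agree on all queries of a run, the output is the same, and it is within `2⁻ʳ` of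
both values. This holds for all odds, acceptable or not, since the machine is correct for every
oracle. -/
theorem ResourceClass.HasFunctional.continuous {Δ : ResourceClass} {F : Odds → Str → ℝ≥0}
    (hF : Δ.HasFunctional F) (O : Odds) (r : ℕ) (w : Str) :
    ∃ L, ∀ O' : Odds, (∀ v, v.length ≤ L → O' v = O v) →
      |(F O' w : ℝ) - (F O w : ℝ)| ≤ 2 * (2 : ℝ)⁻¹ ^ r := by
  obtain ⟨h, _, M, hM⟩ := hF
  obtain ⟨y, q, hy, hq, hout⟩ := hM O r w
  obtain ⟨t, _, hp⟩ := RunsWithin.exists_path hout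
  obtain ⟨L, hL⟩ := OracleTM.exists_path_congr hp
  refine ⟨L, fun O' hO' => ?_⟩
  obtain ⟨y', q', hy', hq', hout'⟩ := hM O' r w
  obtain ⟨t', _, hp'⟩ := RunsWithin.exists_path hout'
  have hp := hL (fun v => encodeRat (O' v)) fun v hv => by rw [hO' v hv]
  have hfin := (hp.unique (by simp [OracleTM.step, StrTM.final, haltList]; rfl) hp'
    (by simp [OracleTM.step, StrTM.final, haltList]; rfl)).1
  have hyy : y = y' := by
    have h1 := congrArg Cfg.stk hfin
    rw [StrTM.final, StrTM.final, haltList_stk, haltList_stk] at h1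
    have h2 := congrFun h1 M.tm.k₁
    simp only [Function.update_self] at h2
    exact List.map_injective_iff.2 (Equiv.injective _) h2
  subst hyy
  have := hy.unique hy'
  subst this
  rw [abs_le] at *
  constructor <;> linarith [hq.1, hq.2, hq'.1, hq'.2]

/-! ### Odds that depend on the length only -/

open Classical in
/-- The odds `2` on the strings whose lengths belong to `a`, and `1` elsewhere. -/
def levelOdds (a : Set ℕ) : Odds := fun q =>
  if q.length ∈ a then ⟨2, by norm_num⟩ else ⟨1, by norm_num⟩

theorem levelOdds_of_mem {a : Set ℕ} {q : Str} (h : q.length ∈ a) :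
    ((levelOdds a q : ℚ) : ℝ) = 2 := by simp [levelOdds, h]

theorem levelOdds_of_notMem {a : Set ℕ} {q : Str} (h : q.length ∉ a) :
    ((levelOdds a q : ℚ) : ℝ) = 1 := by simp [levelOdds, h]

theorem one_le_odds (O : Odds) (q : Str) : (1 : ℝ) ≤ ((O q : ℚ) : ℝ) := by
  exact_mod_cast (O q).2.1

theorem odds_le_two (O : Odds) (q : Str) : ((O q : ℚ) : ℝ) ≤ 2 := by
  exact_mod_cast (O q).2.2

theorem acceptable_levelOdds {a : Set ℕ} (ha : a.Infinite) : Acceptable (levelOdds a) := by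
  intro S
  have hmono : Monotone fun n => ∏ i ∈ Finset.range n, ((levelOdds a (pre S i) : ℚ) : ℝ) := by
    refine monotone_nat_of_le_succ fun n => ?_
    rw [Finset.prod_range_succ]
    exact le_mul_of_one_le_right
      (Finset.prod_nonneg fun i _ => zero_le_one.trans (one_le_odds _ _)) (one_le_odds _ _)
  have hpow : ∀ k : ℕ, ∃ n, (2 : ℝ) ^ k ≤
      ∏ i ∈ Finset.range n, ((levelOdds a (pre S i) : ℚ) : ℝ) := by
    intro k
    induction k with
    | zero => exact ⟨0, by simp⟩
    | succ k ih =>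
      obtain ⟨n, hn⟩ := ih
      obtain ⟨m, hma, hm⟩ := ha.exists_gt n
      refine ⟨m + 1, ?_⟩
      rw [Finset.prod_range_succ, pow_succ, levelOdds_of_mem (by simpa using hma)]
      exact mul_le_mul_of_nonneg_right (hn.trans (hmono hm.le)) zero_le_two
  refine tendsto_atTop_atTop_of_monotone hmono fun b => ?_
  obtain ⟨k, hk⟩ := pow_unbounded_of_one_lt b one_lt_two
  obtain ⟨n, hn⟩ := hpow k
  exact ⟨n, hk.le.trans hn⟩

theorem IsSupermartingale.le_mul {O : Odds} {d : Str → ℝ≥0} (h : IsSupermartingale O d) (w : Str)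
    (b : Bool) : (d (w ++ [b]) : ℝ) ≤ ((O (w ++ [b]) : ℚ) : ℝ) * d w := by
  have h1 := h w
  have hpos : ∀ b, (0 : ℝ) < ((O (w ++ [b]) : ℚ) : ℝ) := fun b =>
    zero_lt_one.trans_le (one_le_odds _ _)
  have h2 : ∀ b, (0 : ℝ) ≤ (d (w ++ [b]) : ℝ) / ((O (w ++ [b]) : ℚ) : ℝ) := fun b =>
    div_nonneg (d _).2 (hpos b).le
  have h3 := h2 false
  have h4 := h2 true
  rw [mul_comm, ← div_le_iff₀ (hpos b)]
  cases b <;> linarith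

namespace ResourceClass

variable {Δ : ResourceClass} {F : Odds → Str → ℝ≥0}

/-- If the inequality failed for `a`, it would fail by a positive amount, and by continuity also for
odds that agree with those of `a` up to some length but are acceptable. This is needed for finite
`a`. -/
theorem HasFunctional.isSupermartingale_levelOdds (hF : Δ.HasFunctional F)
    (h : ∀ O, Acceptable O → IsSupermartingale O (F O)) (a : Set ℕ) :
    IsSupermartingale (levelOdds a) (F (levelOdds a)) := by
  intro w
  refine le_of_forall_pos_le_add fun ε hε => ?_
  -- Three values of `F` are replaced, each with an error of at most `2 * 2⁻ʳ`; dividing by odds of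
  -- at least 1 does not increase the error.
  obtain ⟨r, hr⟩ := exists_pow_lt_of_lt_one (show 0 < ε / 6 by positivity)
    (show (2 : ℝ)⁻¹ < 1 by norm_num)
  obtain ⟨L₁, h₁⟩ := hF.continuous (levelOdds a) r (w ++ [false])
  obtain ⟨L₂, h₂⟩ := hF.continuous (levelOdds a) r (w ++ [true])
  obtain ⟨L₃, h₃⟩ := hF.continuous (levelOdds a) r w
  set L := max (max L₁ L₂) (max L₃ (w.length + 1)) with hL
  -- Adding all large lengths makes the odds acceptable without changing them up to length `L`.
  set a' : Set ℕ := a ∪ {n | L < n} with ha'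
  have hagree : ∀ v : Str, v.length ≤ L → levelOdds a' v = levelOdds a v := by
    intro v hv
    have hiff : v.length ∈ a' ↔ v.length ∈ a := by simp [ha', not_lt.2 hv]
    unfold levelOdds
    by_cases hm : v.length ∈ a
    · rw [if_pos (hiff.2 hm), if_pos hm]
    · rw [if_neg (mt hiff.1 hm), if_neg hm]
  have hinf : a'.Infinite := by
    refine Set.Infinite.mono Set.subset_union_right ?_
    exact Set.infinite_of_not_bddAbove fun ⟨b, hb⟩ => by
      have := hb (show L < max L b + 1 by omega)
      omega
  have hs := h _ (acceptable_levelOdds hinf) w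
  have h₁ := h₁ (levelOdds a') fun v hv => hagree v (by omega)
  have h₂ := h₂ (levelOdds a') fun v hv => hagree v (by omega)
  have h₃ := h₃ (levelOdds a') fun v hv => hagree v (by omega)
  rw [hagree _ (by simp; omega), hagree _ (by simp; omega)] at hs
  have hdiv : ∀ (b : Bool) (x y : ℝ), |x - y| ≤ 2 * (2 : ℝ)⁻¹ ^ r →
      y / ((levelOdds a (w ++ [b]) : ℚ) : ℝ) ≤
        x / ((levelOdds a (w ++ [b]) : ℚ) : ℝ) + 2 * (2 : ℝ)⁻¹ ^ r := by
    intro b x y hxy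
    have h1 := one_le_odds (levelOdds a) (w ++ [b])
    rw [div_add' _ _ _ (by positivity)]
    gcongr
    have h2 := (abs_le.1 hxy).1
    have h3 : (0 : ℝ) ≤ 2 * (2 : ℝ)⁻¹ ^ r := by positivity
    nlinarith
  have h4 := hdiv false _ _ h₁
  have h5 := hdiv true _ _ h₂
  have h6 := (abs_le.1 h₃).2
  linarith

/-- If no finite set of levels works, a sparse infinite set is built on which `F` remains bounded
along S, although the odds are acceptable. The requirement `0 ∈ a` becomes the leading 1 of a table.
-/
theorem HasFunctional.exists_levels (hF : Δ.HasFunctional F) {X : Set Cantor}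
    (h : ∀ O, Acceptable O → IsSupermartingale O (F O) ∧ Succeeds (F O) X) {S : Cantor}
    (hS : S ∈ X) : ∃ a : Finset ℕ, 0 ∈ a ∧ ∃ m₀, ∀ m, m₀ ≤ m →
      4 ≤ (F (levelOdds a) (pre S m) : ℝ) := by
  by_contra hcon
  push Not at hcon
  -- By assumption the value is below 4 at some `m > n`. Continuity with precision 1 costs an error
  -- of at most 1, so 5 is a bound for all sets that agree with `a` up to `L`.
  have step : ∀ (a : Finset ℕ) (n : ℕ), 0 ∈ a → ∃ m L, n < m ∧ m ≤ L ∧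
      ∀ a' : Set ℕ, (∀ i ≤ L, i ∈ a' ↔ i ∈ a) → (F (levelOdds a') (pre S m) : ℝ) ≤ 5 := by
    intro a n ha
    obtain ⟨m, hm, hlt⟩ := hcon a ha (n + 1)
    obtain ⟨L, hL⟩ := hF.continuous (levelOdds a) 1 (pre S m)
    refine ⟨m, max m L, by omega, by omega, fun a' ha' => ?_⟩
    have := (abs_le.1 (hL (levelOdds a') fun v hv => by
      simp [levelOdds, ha' v.length (by omega)])).2
    norm_num at this
    linarith
  choose m L hm hmL hle using step
  -- A state consists of the levels so far and the last of them. The next level is `L + 1`, just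
  -- beyond what the previous bound depends on.
  let st : ℕ → {p : Finset ℕ × ℕ // 0 ∈ p.1} := fun i => Nat.rec ⟨({0}, 0), by simp⟩
    (fun _ p => ⟨(insert (L p.1.1 p.1.2 p.2 + 1) p.1.1, L p.1.1 p.1.2 p.2 + 1), by
      simp [p.2]⟩) i
  set N : ℕ → ℕ := fun i => (st i).1.2 with hN
  set m' : ℕ → ℕ := fun i => m (st i).1.1 (st i).1.2 (st i).2 with hm'
  set L' : ℕ → ℕ := fun i => L (st i).1.1 (st i).1.2 (st i).2 with hL'
  have hNs : ∀ i, N (i + 1) = L' i + 1 := fun i => rfl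
  have hNm : ∀ i, N i < m' i := fun i => hm _ _ _
  have hmL' : ∀ i, m' i ≤ L' i := fun i => hmL _ _ _
  have hNmono : StrictMono N := strictMono_nat_of_lt_succ fun i => by
    have := hNm i; have := hmL' i; rw [hNs]; omega
  have hst : ∀ i j, j ∈ (st i).1.1 ↔ ∃ k ≤ i, N k = j := by
    intro i
    induction i with
    | zero =>
      intro j
      have h0 : (st 0).1.1 = {0} := rfl
      have h1 : N 0 = 0 := rfl
      rw [h0]
      constructor
      · intro h; exact ⟨0, le_rfl, by simp at h; omega⟩
      · rintro ⟨k, hk, rfl⟩; rw [Nat.le_zero.1 hk, h1]; simp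
    | succ i ih =>
      intro j
      have h0 : (st (i + 1)).1.1 = insert (N (i + 1)) (st i).1.1 := rfl
      rw [h0, Finset.mem_insert, ih]
      constructor
      · rintro (rfl | ⟨k, hk, rfl⟩)
        · exact ⟨i + 1, le_rfl, rfl⟩
        · exact ⟨k, by omega, rfl⟩
      · rintro ⟨k, hk, rfl⟩
        rcases Nat.lt_or_ge i k with h | h
        · left; rw [show k = i + 1 by omega]
        · exact .inr ⟨k, h, rfl⟩
  set O := levelOdds (Set.range N) with hO
  have hacc : Acceptable O := acceptable_levelOdds (Set.infinite_range_of_injective hNmono.injective)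
  obtain ⟨hsup, hsucc⟩ := h O hacc
  have h5 : ∀ i, (F O (pre S (m' i)) : ℝ) ≤ 5 := by
    intro i
    refine hle (st i).1.1 (st i).1.2 (st i).2 (Set.range N) fun j hj => ?_
    rw [hst]
    constructor
    · rintro ⟨k, rfl⟩
      refine ⟨k, ?_, rfl⟩
      by_contra hk
      have h1 := hNmono.monotone (show i + 1 ≤ k by omega)
      rw [hNs] at h1
      have : N k ≤ L' i := hj
      omega
    · rintro ⟨k, _, rfl⟩
      exact ⟨k, rfl⟩
  -- Between two consecutive points with value at most 5 there is exactly one level, `N (i + 1)`.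
  -- Elsewhere the odds are 1 and the value cannot increase; at this level it at most doubles.
  have hgrow : ∀ i n, m' i + n ≤ m' (i + 1) → (F O (pre S (m' i + n)) : ℝ) ≤
      if N (i + 1) ≤ m' i + n then 10 else 5 := by
    intro i n
    induction n with
    | zero =>
      intro _
      have := h5 i
      rw [add_zero]
      split_ifs <;> linarith
    | succ n ih =>
      intro hn
      have ih := ih (by omega)
      have hstep := hsup.le_mul (pre S (m' i + n)) (S (m' i + n))
      rw [← pre_succ, add_assoc] at hstep
      have hnn : (0 : ℝ) ≤ F O (pre S (m' i + n)) := (F O _).2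
      by_cases hmem : m' i + (n + 1) = N (i + 1)
      · rw [if_pos (by omega)]
        rw [if_neg (by omega)] at ih
        have := odds_le_two O (pre S (m' i + (n + 1)))
        nlinarith
      · have hnot : (pre S (m' i + (n + 1))).length ∉ Set.range N := by
          rw [length_pre]
          rintro ⟨k, hk⟩
          have h1 := hNm i
          have h2 := hNm (i + 1)
          have hik : i < k := hNmono.lt_iff_lt.1 (by omega)
          have hki : k < i + 2 := hNmono.lt_iff_lt.1 (by
            have := hmL' (i + 1); have := hNs (i + 1)
            change N k < N (i + 1 + 1)
            omega)
          exact hmem (by rw [← hk, show k = i + 1 by omega])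
        rw [hO, levelOdds_of_notMem hnot, one_mul, ← hO] at hstep
        refine hstep.trans (ih.trans ?_)
        by_cases h1 : N (i + 1) ≤ m' i + n
        · rw [if_pos h1, if_pos (by omega)]
        · rw [if_neg h1, if_neg (by omega)]
  have hmmono : StrictMono m' := strictMono_nat_of_lt_succ fun i => by
    have h1 := hNm (i + 1); have h2 := hmL' i; rw [hNs] at h1; omega
  have h10 : ∀ n, m' 0 ≤ n → (F O (pre S n) : ℝ) ≤ 10 := by
    intro n hn
    have hex : ∃ i, n < m' (i + 1) := ⟨n, Nat.lt_of_succ_le (hmmono.le_apply (x := n + 1))⟩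
    classical
    have h1 := Nat.find_spec hex
    have h2 : m' (Nat.find hex) ≤ n := by
      rcases hi : Nat.find hex with _ | i
      · exact hn
      · exact not_lt.1 (Nat.find_min hex (by omega))
    have h3 := hgrow (Nat.find hex) (n - m' (Nat.find hex)) (by omega)
    rw [Nat.add_sub_cancel' h2] at h3
    refine h3.trans ?_
    split_ifs <;> norm_num
  have hlim := hsucc S hS
  have hle10 : limsup (fun n => (F O (pre S (n + 1)) : ℝ≥0∞)) atTop ≤ 10 := by
    refine limsup_le_of_le (by isBoundedDefault) ?_
    filter_upwards [eventually_ge_atTop (m' 0)] with n hn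
    have := h10 (n + 1) (by omega)
    have h2 : F O (pre S (n + 1)) ≤ 10 := by exact_mod_cast this
    exact_mod_cast h2
  rw [hlim] at hle10
  exact absurd hle10 (by simp)

end ResourceClass

/-! ### Strong measure zero implies countability -/

theorem length_encodeRat_tableOdds_le (T : List Bool) (q : Str) :
    (encodeRat (tableOdds T q)).length ≤ 6 := by
  rw [encodeRat_tableOdds]
  split_ifs <;> simp

/-- The leading 1 of the table gives the empty query the answer 2, whose code has length 6. The
exact length is needed rather than a bound, since `h` is not known to be monotone. -/
theorem answerLength_tableOdds {T : List Bool} (hT : T.head? = some true) (n : ℕ) :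
    answerLength (fun v => encodeRat (tableOdds T v)) n = 6 := by
  refine le_antisymm (csSup_le' ?_) (le_csSup ⟨6, ?_⟩ ⟨[], by simp, ?_⟩)
  · rintro m ⟨q, _, rfl⟩
    exact length_encodeRat_tableOdds_le T q
  · rintro m ⟨q, _, rfl⟩
    exact length_encodeRat_tableOdds_le T q
  · rw [List.head?_eq_getElem?] at hT
    simp [encodeRat_tableOdds, hT]

theorem tableOdds_eq_levelOdds (T : List Bool) :
    tableOdds T = levelOdds {n | T[2 * n]? = some true} := by
  funext q
  unfold tableOdds levelOdds
  by_cases h : T[2 * q.length]? = some true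
  · rw [if_pos h, if_pos (by exact h)]
  · rw [if_neg h, if_neg (by exact h)]

theorem isResult_of_forall {δ : Str → Str} {S : Cantor}
    (h : ∀ n, δ (pre S n) = pre S (n + 1)) : IsResult δ S := by
  have key : ∀ i, δ^[i] [] = pre S i := by
    intro i
    induction i with
    | zero => rfl
    | succ i ih => rw [Function.iterate_succ_apply', ih, h]
  intro i
  rw [key, length_pre]

/-- Beyond the levels in `a`, the odds are `1`, so that a supermartingale is eventually almost
constant along `S`. -/
theorem IsSupermartingale.exists_offBranch_lt {a : Finset ℕ} {d : Str → ℝ≥0}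
    (hd : IsSupermartingale (levelOdds a) d) (S : Cantor) :
    ∃ N, (∀ i ∈ a, i < N) ∧ ∀ m, N ≤ m → (d (pre S m ++ [!S m]) : ℝ) < 1 / 2 := by
  obtain ⟨N₁, hN₁⟩ : ∃ N, ∀ i ∈ a, i < N :=
    ⟨a.sup id + 1, fun i hi => Nat.lt_succ_of_le (Finset.le_sup (f := id) hi)⟩
  have hodds : ∀ q : Str, N₁ ≤ q.length → ((levelOdds a q : ℚ) : ℝ) = 1 := fun q hq =>
    levelOdds_of_notMem fun hmem => by have := hN₁ _ hmem; omega
  have hsum : ∀ m, N₁ ≤ m → (d (pre S (m + 1)) : ℝ) + d (pre S m ++ [!S m]) ≤ d (pre S m) := by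
    intro m hm
    have h := hd (pre S m)
    rw [hodds _ (by simp; omega), hodds _ (by simp; omega), div_one, div_one] at h
    rw [pre_succ]
    cases hb : S m <;> simp only [Bool.not_false, Bool.not_true] <;> linarith
  set u : ℕ → ℝ≥0 := fun n => d (pre S (N₁ + n)) with hu
  have hanti : Antitone u := antitone_nat_of_succ_le fun n => by
    have h := hsum (N₁ + n) (by omega)
    have h2 : (0 : ℝ) ≤ d (pre S (N₁ + n) ++ [!S (N₁ + n)]) := (d _).2
    have h3 : (u (n + 1) : ℝ) ≤ u n := by
      change (d (pre S (N₁ + n + 1)) : ℝ) ≤ d (pre S (N₁ + n))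
      linarith
    exact_mod_cast h3
  -- The value at a sibling is at most the drop `u n - u (n + 1)`, which is less than 1/2 as soon as
  -- `u` is that close to its infimum.
  obtain ⟨n₀, hn₀⟩ : ∃ n₀, u n₀ < (⨅ n, u n) + 1 / 2 :=
    exists_lt_of_ciInf_lt (lt_add_of_pos_right _ (by norm_num))
  refine ⟨N₁ + n₀, fun i hi => by have := hN₁ i hi; omega, fun m hm => ?_⟩
  obtain ⟨n, rfl⟩ := Nat.exists_eq_add_of_le (show N₁ ≤ m by omega)
  have h1 := hsum (N₁ + n) (by omega)
  have h2 : (u n : ℝ) ≤ u n₀ := by exact_mod_cast hanti (show n₀ ≤ n by omega)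
  have h3 : ((⨅ n, u n : ℝ≥0) : ℝ) ≤ u (n + 1) := by
    exact_mod_cast ciInf_le (OrderBot.bddBelow _) (n + 1)
  have h4 : (u n₀ : ℝ) < ((⨅ n, u n : ℝ≥0) : ℝ) + 1 / 2 := by exact_mod_cast hn₀
  have h5 : (u n : ℝ) = d (pre S (N₁ + n)) := rfl
  have h6 : (u (n + 1) : ℝ) = d (pre S (N₁ + n + 1)) := rfl
  linarith

theorem ResourceClass.HasStrongMeasureZero.isCountable {Δ : ResourceClass} {X : Set Cantor}
    (hX : Δ.HasStrongMeasureZero X) : Δ.IsCountable X := by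
  obtain ⟨F, hF, hFX⟩ := hX
  have hF' := hF
  obtain ⟨h, hb, M, hM⟩ := hF'
  -- Table 0 is empty and has odds 1 everywhere, so its answers have length 4 only; hence the
  -- restriction to positive `r`.
  have hM' : ∀ (r : ℕ) (w : Str), ∃ p q : Str, 0 < r →
      |((binVal p : ℚ) / (binVal q : ℚ) : ℚ) - (F (tableOdds (table r)) (w ++ [false]) : ℝ)| ≤
        (2 : ℝ)⁻¹ ^ r ∧ binVal q ≠ 0 ∧
      M.OutputsWithin Δ.kind (fun v => encodeRat (tableOdds (table r) v))
        (encodeNatStr r (w ++ [false])) (pairStr p q) (h (encodeNatStr (r + 6) w).length) := by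
    intro r w
    obtain ⟨_, _, ⟨p, q, rfl, hq, rfl⟩, habs, hout⟩ := hM (tableOdds (table r)) r (w ++ [false])
    refine ⟨p, q, fun hr => ⟨habs, hq, ?_⟩⟩
    rw [answerLength_tableOdds (head?_table hr)] at hout
    -- With the index shifted by 6, the input `(r + 6, w)` has exactly the length |w0| + r + 6 at
    -- which `h` bounds the run. So neither monotonicity of `h` nor closure of the class under
    -- shifts is needed.
    rwa [length_encodeNatStr, show r + 6 + w.length + 1 = (w ++ [false]).length + r + 6 by
      simp; omega]
  choose p q hpq using hM'
  set c : ℕ → Str → Bool := fun r w => decide (binVal (p r w) < binVal (q r w)) with hc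
  refine ⟨fun k w => Frag.nextFun c (encodeNatStr k w), ⟨Frag.nextFun c, ?_, fun k w => rfl⟩,
    ?_, ?_⟩
  -- The bound consists of a quadratic term and constant multiples of `h n`, so it stays in the
  -- class.
  · refine ⟨fun n => n + (31 * (maxPushes M.tm + 8) + 300) *
      ((n + 1) ^ 2 + h n + (n + (maxPushes M.tm + 6 + 1) * h n)) + 1, ?_,
      (Frag.nextFrag M).toTM M.tm.initialState (.inr .inp) (.inr .acc)
      (Equiv.refl Bool) (Equiv.refl Bool), fun x => Frag.Does.toTM (v₁ := M.tm.initialState) ?_⟩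
    rotate_left
    · have hd := Frag.Does.nextFrag (ρ := Δ.kind) (M := M) (c := c) (x := x) (b := h x.length)
        (l := x.length + (maxPushes M.tm + 6 + 1) * h x.length) (by
          rintro r w hr rfl
          obtain ⟨-, -, hout⟩ := hpq r w hr
          refine ⟨p r w, q r w, hout, rfl, ?_⟩
          refine (hout.length_le (length_encodeRat_tableOdds_le (table r))).trans ?_
          gcongr
          simp [length_encodeNatStr]
          omega)
      have hnil : (fun _ => [] : (k : M.tm.K ⊕ Tape) → List (SumΓ M.tm.Γ Tape k)) =
          join (fun _ => []) (fun _ => []) := by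
        funext k
        cases k <;> rfl
      rw [← update_join_inr, ← update_join_inr, ← hnil] at hd
      rw [Equiv.refl_symm, Equiv.coe_refl, List.map_id, List.map_id]
      exact hd
    · refine ((Δ.isBound_id.add ((?_ : Δ.IsBound fun n => (31 * (maxPushes M.tm + 8) + 300) *
        ((n + 1) ^ 2 + h n + (n + (maxPushes M.tm + 6 + 1) * h n))))).add
        (Δ.isBound_const 1))
      refine IsBound.const_mul ((IsBound.add ?_ hb).add (Δ.isBound_id.add (hb.const_mul _))) _
      refine (((Δ.isBound_pow 2).const_mul 4).add (Δ.isBound_const 4)).mono fun j => ?_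
      nlinarith [sq_nonneg ((j : ℤ) - 1), Nat.zero_le j, sq_nonneg j]
  · intro k x
    change x <+: Frag.nextFun c (encodeNatStr k x) ∧ x ≠ Frag.nextFun c (encodeNatStr k x)
    rw [Frag.nextFun_encodeNatStr]
    split_ifs
    · exact ⟨List.prefix_append _ _, by simp⟩
    · exact ⟨List.prefix_append _ _, by simp⟩
  · intro S hS
    obtain ⟨a, h0, m₀, hm₀⟩ := hF.exists_levels hFX hS
    have hsup := hF.isSupermartingale_levelOdds (fun O hO => (hFX O hO).1) a
    obtain ⟨N₁, haN, hoff⟩ := hsup.exists_offBranch_lt S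
    -- Beyond `N` both value estimates are available. The 1 makes the table have at least two
    -- entries.
    set N := max (max N₁ m₀) 1 with hN
    -- Even entries describe `a`, which lies below `N`, and odd entries list the first `N` bits of
    -- S. The first entry is 1 because `0 ∈ a`.
    set T : List Bool := (List.range (2 * N)).map fun j =>
      if j % 2 = 0 then decide (j / 2 ∈ a) else S (j / 2) with hT
    have hTl : ∃ l, T = true :: l ∧ 0 < l.length := by
      obtain ⟨n, hn⟩ : ∃ n, 2 * N = n + 1 + 1 := ⟨2 * N - 2, by omega⟩
      rw [hT, hn, List.range_succ_eq_map]
      exact ⟨_, by simp [h0]; rfl, by simp⟩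
    obtain ⟨l, hTl, hl⟩ := hTl
    obtain ⟨r, hr, htab⟩ := exists_table l
    rw [← hTl] at htab
    have hget : ∀ j, T[j]? = if j < 2 * N then
        some (if j % 2 = 0 then decide (j / 2 ∈ a) else S (j / 2)) else none := by
      intro j
      split_ifs with h1 h2
      · simp [hT, h1, h2]
      · simp [hT, h1, h2]
      · simp [hT]; omega
    have hO : tableOdds (table r) = levelOdds a := by
      rw [tableOdds_eq_levelOdds, htab]
      congr 1
      ext n
      rw [Set.mem_setOf_eq, hget]
      constructor
      · intro h
        split_ifs at h with h1 h2
        · simpa using h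
        · omega
      · intro h
        have := haN n h
        rw [if_pos (by omega), if_pos (by omega)]
        simpa using h
    refine ⟨r + 6, isResult_of_forall fun m => ?_⟩
    change Frag.nextFun c (encodeNatStr (r + 6) (pre S m)) = _
    rw [Frag.nextFun_encodeNatStr, if_neg (by omega), Nat.add_sub_cancel, pre_succ, htab, nextBit,
      length_pre, hget]
    congr 2
    split_ifs with h1 h2
    · omega
    · simp; congr 1; omega
    · have hm : N ≤ m := by omega
      obtain ⟨happ, hq, -⟩ := hpq r (pre S m) (by omega)
      rw [hO] at happ
      have hq' : (0 : ℝ) < binVal (q r (pre S m)) := by exact_mod_cast Nat.pos_of_ne_zero hq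
      -- The table has length at least 2, hence `r ≥ 2`. An error of 1/4 keeps values of at least 4
      -- above 1 and values below 1/2 below 1.
      have hr2 : (2 : ℝ)⁻¹ ^ r ≤ 1 / 4 := by
        calc (2 : ℝ)⁻¹ ^ r ≤ (2 : ℝ)⁻¹ ^ 2 :=
              pow_le_pow_of_le_one (by norm_num) (by norm_num) (by omega)
          _ = 1 / 4 := by norm_num
      push_cast at happ
      rw [abs_le] at happ
      simp only [Option.getD_none, hc]
      cases hSm : S m
      · have h4 := hm₀ (m + 1) (by omega)
        rw [pre_succ, hSm] at h4
        rw [decide_eq_false_iff_not, not_lt]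
        have : (1 : ℝ) ≤ binVal (p r (pre S m)) / binVal (q r (pre S m)) := by linarith
        rw [le_div_iff₀ hq', one_mul] at this
        exact_mod_cast this
      · have h4 := hoff m (by omega)
        rw [hSm, Bool.not_true] at h4
        rw [decide_eq_true_iff]
        have : (binVal (p r (pre S m)) : ℝ) / binVal (q r (pre S m)) < 1 := by linarith
        rw [div_lt_one hq'] at this
        exact_mod_cast this

/-! ### Robust classes -/

namespace ResourceClass

variable {Δ : ResourceClass} {t : ℕ → ℕ}

theorem IsRobust.mul_id (hΔ : Δ.IsRobust) (h : Δ.IsBound t) : Δ.IsBound fun k => k * t k := by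
  obtain ⟨n, C, h⟩ := h
  obtain ⟨m, C', hm⟩ := hΔ n
  have h1 : Δ.IsBound fun k => C' * Δ.g m k + C' := ⟨m, C', fun _ => le_rfl⟩
  refine ((h1.const_mul C).add (Δ.isBound_id.const_mul C)).mono fun k => ?_
  calc k * t k ≤ k * (C * Δ.g n k + C) := Nat.mul_le_mul_left k (h k)
    _ = C * (k * Δ.g n k) + C * k := by ring
    _ ≤ _ := Nat.add_le_add_right (Nat.mul_le_mul_left C (hm k k (by omega))) _

theorem IsRobust.succ_pow_mul (hΔ : Δ.IsRobust) (h : Δ.IsBound t) (d : ℕ) :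
    Δ.IsBound fun k => (k + 1) ^ d * t k := by
  induction d with
  | zero => simpa using h
  | succ d ih => exact ((hΔ.mul_id ih).add ih).mono fun k => by rw [pow_succ]; nlinarith

/-- The maximum of `t` up to twice the argument. -/
def maxUpTo (t : ℕ → ℕ) (k : ℕ) : ℕ := (Finset.range (2 * k + 1)).sup t

theorem le_maxUpTo {j k : ℕ} (h : j ≤ 2 * k) : t j ≤ maxUpTo t k :=
  Finset.le_sup (f := t) (Finset.mem_range.2 (by omega))

/-- Bounds need not be monotone, so calls on inputs of various lengths are bounded by a maximum.
Robustness is uniform in `j ≤ 2 * k`, which is what a maximum needs. -/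
theorem IsRobust.maxUpTo (hΔ : Δ.IsRobust) (h : Δ.IsBound t) : Δ.IsBound (maxUpTo t) := by
  obtain ⟨n, C, h⟩ := h
  obtain ⟨m, C', hm⟩ := hΔ n
  have h1 : Δ.IsBound fun k => C' * Δ.g m k + C' := ⟨m, C', fun _ => le_rfl⟩
  refine ((h1.const_mul C).add (Δ.isBound_const (C + t 0))).mono fun k =>
    Finset.sup_le fun j hj => ?_
  have hj : j ≤ 2 * k := by have := Finset.mem_range.1 hj; omega
  -- For `k = 0` the factor `k` in the robustness condition removes all information; the constant `t
  -- 0` takes care of this case.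
  rcases Nat.eq_zero_or_pos k with rfl | hk
  · rw [show j = 0 by omega]; omega
  · have h2 := (Nat.le_mul_of_pos_left (Δ.g n j) hk).trans (hm j k hj)
    have h3 := Nat.mul_le_mul_left C h2
    have h4 := h j
    omega

end ResourceClass

/-! ### Gains -/

theorem binVal_append (l m : List Bool) : binVal (l ++ m) = binVal l + 2 ^ l.length * binVal m := by
  induction l with
  | nil => simp
  | cons x l ih => rw [List.cons_append, binVal_cons, ih, binVal_cons, List.length_cons]; ring

theorem binVal_bits (n : ℕ) : binVal n.bits = n := by
  induction n using Nat.binaryRec' with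
  | zero => simp
  | bit b n hn ih => rw [Nat.bits_append_bit n b hn, binVal_cons, ih, Nat.bit_val]

/-- The position of the first `1` in a string, starting with `1`. -/
def firstOne (l : List Bool) : ℕ := (l.takeWhile (! ·)).length + 1

/-- The position of the leading 1 determines a number up to a factor 2. -/
theorem binVal_reverse_bounds {l : List Bool} (h : true ∈ l) :
    2 ^ l.length ≤ binVal l.reverse * 2 ^ firstOne l ∧
      binVal l.reverse * 2 ^ firstOne l < 2 * 2 ^ l.length := by
  induction l with
  | nil => simp at h
  | cons x l ih =>
    have hlt := binVal_lt l.reverse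
    rw [List.length_reverse] at hlt
    rw [List.reverse_cons, binVal_append, List.length_cons, List.length_reverse, binVal_cons,
      binVal_nil]
    cases x
    · obtain ⟨h1, h2⟩ := ih (by simpa using h)
      have h3 : firstOne (false :: l) = firstOne l + 1 := by simp [firstOne]
      rw [h3, pow_succ, pow_succ]
      simp only [Bool.toNat_false]
      constructor <;> nlinarith
    · have h3 : firstOne (true :: l) = 1 := by simp [firstOne]
      rw [h3]
      simp only [Bool.toNat_true, pow_succ, pow_zero]
      constructor <;> omega

theorem binVal_reverse_eq_zero {l : List Bool} (h : true ∉ l) : binVal l.reverse = 0 := by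
  induction l with
  | nil => rfl
  | cons x l ih =>
    rw [List.mem_cons, not_or] at h
    obtain ⟨h1, h2⟩ := h
    rw [List.reverse_cons, binVal_append, ih h2]
    cases x
    · simp [binVal_cons]
    · exact absurd rfl h1

/-- The binary expansion of the difference of the numerator and the denominator, most significant
bit first. -/
def diffBits (q : ℚ) : List Bool := (subBits false q.num.natAbs.bits q.den.bits).1.reverse

/-- A power of `1 / 2` that differs from `q - 1` by a bounded factor only, or `0`. -/
def gain (q : ℚ) : ℝ≥0 := if true ∈ diffBits q then 2⁻¹ ^ firstOne (diffBits q) else 0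

/-- Write q = a / d in lowest terms. Since d ≤ a ≤ 2d, the power `2 ^ a.size` lies between d and 4d,
so replacing the denominator by it costs a factor 4; rounding a - d to its leading 1 costs a factor
2. -/
theorem gain_bounds {q : ℚ} (h1 : 1 ≤ q) (h2 : q ≤ 2) :
    (gain q : ℝ) ≤ (q : ℝ) - 1 ∧ (q : ℝ) - 1 ≤ 8 * gain q := by
  set a := q.num.natAbs with ha
  set d := q.den with hd
  have hd0 : 0 < d := q.den_pos
  have hnum : (q.num : ℤ) = (a : ℤ) := by
    rw [ha, Int.natAbs_of_nonneg (Rat.num_nonneg.2 (by linarith))]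
  have hq : q = (a : ℚ) / d := by
    conv_lhs => rw [← Rat.num_div_den q]
    rw [hnum]; simp [hd]
  have hdQ : (0 : ℚ) < d := by exact_mod_cast hd0
  have hda : d ≤ a := by
    rw [hq, le_div_iff₀ hdQ, one_mul] at h1
    exact_mod_cast h1
  have had : a ≤ 2 * d := by
    rw [hq, div_le_iff₀ hdQ] at h2
    exact_mod_cast h2
  have hspec := subBits_spec false a.bits d.bits
  have hborrow : (subBits false a.bits d.bits).2 = false := by
    rw [← Bool.not_eq_true, subBits_borrow_iff, binVal_bits, binVal_bits]; omega
  rw [hborrow, binVal_bits, binVal_bits] at hspec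
  simp only [Bool.toNat_false, mul_zero, add_zero] at hspec
  have hval : binVal (diffBits q).reverse = a - d := by
    rw [diffBits, List.reverse_reverse, ← ha, ← hd]; omega
  have hlen : (diffBits q).length = a.size := by
    rw [diffBits, List.length_reverse, length_subBits, ← ha, ← hd, Nat.size_eq_bits_len,
      Nat.size_eq_bits_len, max_eq_left (Nat.size_le_size hda)]
  have hdlt : d ≤ 2 ^ a.size := hda.trans (Nat.lt_size_self a).le
  have hale : 2 ^ a.size ≤ 4 * d := by
    have h3 : 2 ^ (a.size - 1) ≤ a := Nat.lt_size.1 (by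
      have : 0 < a.size := Nat.size_pos.2 (by omega)
      omega)
    have h4 : 2 ^ a.size = 2 * 2 ^ (a.size - 1) := by
      rw [← pow_succ']
      congr 1
      have : 0 < a.size := Nat.size_pos.2 (by omega)
      omega
    omega
  have hdR : (0 : ℝ) < d := by exact_mod_cast hd0
  have hq' : (q : ℝ) - 1 = ((a - d : ℕ) : ℝ) / d := by
    rw [Nat.cast_sub hda, sub_div, div_self hdR.ne', hq]
    push_cast
    rfl
  unfold gain
  split_ifs with hmem
  · obtain ⟨h3, h4⟩ := binVal_reverse_bounds hmem
    rw [hval, hlen] at h3 h4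
    generalize firstOne (diffBits q) = z at *
    rw [hq']
    push_cast [-Nat.cast_sub]
    have h3' : (2 : ℝ) ^ a.size ≤ ((a - d : ℕ) : ℝ) * 2 ^ z := by exact_mod_cast h3
    have h4' : ((a - d : ℕ) : ℝ) * 2 ^ z < 2 * 2 ^ a.size := by exact_mod_cast h4
    have hdlt' : (d : ℝ) ≤ 2 ^ a.size := by exact_mod_cast hdlt
    have hale' : (2 : ℝ) ^ a.size ≤ 4 * d := by exact_mod_cast hale
    rw [inv_pow]
    have hz : (0 : ℝ) < 2 ^ z := by positivity
    constructor
    · rw [le_div_iff₀ hdR, inv_mul_le_iff₀ hz]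
      linarith
    · rw [div_le_iff₀ hdR, mul_right_comm, ← div_eq_mul_inv, le_div_iff₀ hz]
      linarith
  · rw [binVal_reverse_eq_zero hmem] at hval
    rw [hq', ← hval]
    simp

/-- The capital that is accumulated along `w`. -/
def capital (O : Odds) (w : Str) : ℝ≥0 :=
  1 + ∑ i ∈ Finset.range w.length, gain (O (w.take (i + 1)))

theorem capital_append (O : Odds) (w : Str) (b : Bool) :
    capital O (w ++ [b]) = capital O w + gain (O (w ++ [b])) := by
  unfold capital
  rw [List.length_append, List.length_singleton, Finset.sum_range_succ, ← add_assoc]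
  congr 2
  · refine Finset.sum_congr rfl fun i hi => ?_
    have := Finset.mem_range.1 hi
    rw [List.take_append_of_le_length (by omega)]
  · rw [List.take_of_length_le (by simp)]

/-- The capital is at least 1, so the gain, at most O - 1, is at most (O - 1) times the capital. -/
theorem capital_append_le (O : Odds) (w : Str) (b : Bool) :
    (capital O (w ++ [b]) : ℝ) ≤ ((O (w ++ [b]) : ℚ) : ℝ) * capital O w := by
  rw [capital_append]
  have h1 := (gain_bounds (O (w ++ [b])).2.1 (O (w ++ [b])).2.2).1
  have h2 : (1 : ℝ) ≤ capital O w := by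
    have : 1 ≤ capital O w := le_self_add
    exact_mod_cast this
  have h3 := one_le_odds O (w ++ [b])
  push_cast
  nlinarith

theorem take_pre (S : Cantor) {i n : ℕ} (h : i ≤ n) : (pre S n).take i = pre S i := by
  simp [pre, ← List.map_take, List.take_range, h]

theorem capital_pre (O : Odds) (S : Cantor) (n : ℕ) :
    capital O (pre S n) = 1 + ∑ i ∈ Finset.range n, gain (O (pre S (i + 1))) := by
  unfold capital
  rw [length_pre]
  congr 1
  refine Finset.sum_congr rfl fun i hi => ?_
  rw [take_pre S (Finset.mem_range.1 hi)]

/-- Since x ≤ exp(x - 1), the product of the odds is at most exp of the sum of the excesses over 1,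
and these are at most 8 times the gains. The odds at the empty string yield no gain; they contribute
at most 1 to the exponent. -/
theorem tendsto_capital {O : Odds} (hO : Acceptable O) (S : Cantor) :
    Tendsto (fun n => (capital O (pre S n) : ℝ)) atTop atTop := by
  have hprod : ∀ n, ∏ i ∈ Finset.range (n + 1), ((O (pre S i) : ℚ) : ℝ) ≤
      Real.exp (1 + 8 * capital O (pre S n)) := by
    intro n
    calc ∏ i ∈ Finset.range (n + 1), ((O (pre S i) : ℚ) : ℝ)
        ≤ ∏ i ∈ Finset.range (n + 1), Real.exp (((O (pre S i) : ℚ) : ℝ) - 1) :=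
          Finset.prod_le_prod (fun i _ => zero_le_one.trans (one_le_odds _ _)) fun i _ => by
            have := Real.add_one_le_exp (((O (pre S i) : ℚ) : ℝ) - 1)
            linarith
      _ = Real.exp (∑ i ∈ Finset.range (n + 1), (((O (pre S i) : ℚ) : ℝ) - 1)) :=
          (Real.exp_sum _ _).symm
      _ ≤ _ := by
          refine Real.exp_le_exp.2 ?_
          rw [Finset.sum_range_succ', capital_pre]
          push_cast
          have h1 := odds_le_two O (pre S 0)
          have h2 : ∑ i ∈ Finset.range n, (((O (pre S (i + 1)) : ℚ) : ℝ) - 1) ≤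
              8 * ∑ i ∈ Finset.range n, (gain (O (pre S (i + 1))) : ℝ) := by
            rw [Finset.mul_sum]
            exact Finset.sum_le_sum fun i _ => (gain_bounds (O _).2.1 (O _).2.2).2
          linarith
  have h1 := tendsto_atTop_mono hprod ((tendsto_add_atTop_iff_nat 1).2 (hO S))
  have h2 := Real.tendsto_exp_comp_atTop.1 h1
  refine tendsto_atTop.2 fun b => ?_
  filter_upwards [tendsto_atTop.1 h2 (1 + 8 * b)] with n hn
  linarith

/-! ### The functional of a sequence of constructors -/

theorem IsConstructor.iterate_prefix {δ : Str → Str} (h : IsConstructor δ) {i j : ℕ} (hij : i ≤ j) :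
    δ^[i] [] <+: δ^[j] [] := by
  induction j, hij using Nat.le_induction with
  | base => exact List.prefix_refl _
  | succ j _ ih => rw [Function.iterate_succ_apply']; exact ih.trans (h _).1

theorem IsConstructor.length_lt {δ : Str → Str} (h : IsConstructor δ) (x : Str) :
    x.length < (δ x).length :=
  lt_of_le_of_ne (h x).1.length_le fun heq => (h x).2 ((h x).1.eq_of_length heq)

theorem IsConstructor.le_length_iterate {δ : Str → Str} (h : IsConstructor δ) (i : ℕ) :
    i ≤ (δ^[i] []).length := by
  induction i with
  | zero => exact Nat.zero_le _
  | succ i ih =>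
    rw [Function.iterate_succ_apply']
    have := h.length_lt (δ^[i] [])
    omega

/-- The string `w` is a prefix of the result of the constructor `δ`. -/
def OnBranch (δ : Str → Str) (w : Str) : Prop := ∃ i, w <+: δ^[i] []

theorem OnBranch.of_append {δ : Str → Str} {w u : Str} (h : OnBranch δ (w ++ u)) :
    OnBranch δ w := by
  obtain ⟨i, h⟩ := h
  exact ⟨i, (List.prefix_append _ _).trans h⟩

theorem OnBranch.not_both {δ : Str → Str} (hδ : IsConstructor δ) {w : Str}
    (h₀ : OnBranch δ (w ++ [false])) (h₁ : OnBranch δ (w ++ [true])) : False := by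
  obtain ⟨i, h₀⟩ := h₀
  obtain ⟨j, h₁⟩ := h₁
  have h₀ := h₀.trans (hδ.iterate_prefix (le_max_left i j))
  have h₁ := h₁.trans (hδ.iterate_prefix (le_max_right i j))
  have := (List.prefix_of_prefix_length_le h₀ h₁ (by simp)).eq_of_length (by simp)
  simp at this

theorem IsResult.onBranch {δ : Str → Str} (hδ : IsConstructor δ) {S : Cantor} (h : IsResult δ S)
    (n : ℕ) : OnBranch δ (pre S n) := by
  refine ⟨n, ?_⟩
  rw [h n, ← take_pre S (hδ.le_length_iterate n)]
  exact List.take_prefix _ _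

open Classical in
/-- The weight of the results of constructors that extend `w`. -/
def branchWeight (δ : ℕ → Str → Str) (w : Str) (k : ℕ) : ℝ≥0 :=
  if OnBranch (δ k) w then 2⁻¹ ^ k else 0

section Weight

variable {δ : ℕ → Str → Str}

theorem branchWeight_le (w : Str) (k : ℕ) : branchWeight δ w k ≤ 2⁻¹ ^ k := by
  unfold branchWeight
  split_ifs <;> simp

theorem summable_half_pow : Summable fun k : ℕ => (2⁻¹ : ℝ≥0) ^ k :=
  NNReal.summable_geometric (by rw [← NNReal.coe_lt_coe]; norm_num)

theorem summable_branchWeight (w : Str) : Summable (branchWeight δ w) :=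
  NNReal.summable_of_le (branchWeight_le w) summable_half_pow

/-- The functional that bets on all the results of the constructors. -/
def branchCapital (δ : ℕ → Str → Str) (O : Odds) (w : Str) : ℝ≥0 :=
  (∑' k, branchWeight δ w k) * capital O w

theorem branchWeight_add_le (hδ : ∀ k, IsConstructor (δ k)) (w : Str) (k : ℕ) :
    branchWeight δ (w ++ [false]) k + branchWeight δ (w ++ [true]) k ≤ branchWeight δ w k := by
  unfold branchWeight
  by_cases h₀ : OnBranch (δ k) (w ++ [false])
  · have h₁ : ¬ OnBranch (δ k) (w ++ [true]) := fun h₁ => h₀.not_both (hδ k) h₁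
    rw [if_pos h₀, if_neg h₁, if_pos h₀.of_append, add_zero]
  · by_cases h₁ : OnBranch (δ k) (w ++ [true])
    · rw [if_neg h₀, if_pos h₁, if_pos h₁.of_append, zero_add]
    · rw [if_neg h₀, if_neg h₁, add_zero]; exact zero_le'

/-- Dividing by the odds cancels the growth of the capital. What remains is the weight of the
branches through the two extensions, and no branch passes through both. -/
theorem isSupermartingale_branchCapital (hδ : ∀ k, IsConstructor (δ k)) (O : Odds) :
    IsSupermartingale O (branchCapital δ O) := by
  intro w
  have hle : ∀ b, (branchCapital δ O (w ++ [b]) : ℝ) / ((O (w ++ [b]) : ℚ) : ℝ) ≤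
      ((∑' k, branchWeight δ (w ++ [b]) k : ℝ≥0) : ℝ) * capital O w := by
    intro b
    have h1 := capital_append_le O w b
    have h2 := one_le_odds O (w ++ [b])
    rw [div_le_iff₀ (by linarith), branchCapital, NNReal.coe_mul, mul_assoc]
    exact mul_le_mul_of_nonneg_left (by rw [mul_comm]; exact h1) (NNReal.coe_nonneg _)
  have hsum : (∑' k, branchWeight δ (w ++ [false]) k) + (∑' k, branchWeight δ (w ++ [true]) k) ≤
      ∑' k, branchWeight δ w k := by
    rw [← (summable_branchWeight _).tsum_add (summable_branchWeight _)]
    exact ((summable_branchWeight _).add (summable_branchWeight _)).tsum_le_tsum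
      (branchWeight_add_le hδ w) (summable_branchWeight _)
  refine (add_le_add (hle false) (hle true)).trans ?_
  rw [← add_mul, branchCapital, NNReal.coe_mul, ← NNReal.coe_add]
  exact mul_le_mul_of_nonneg_right (by exact_mod_cast hsum) (NNReal.coe_nonneg _)

/-- Along the result of the k-th constructor the weight is always at least `2⁻¹ ^ k`, while the
capital tends to infinity. -/
theorem succeeds_branchCapital (hδ : ∀ k, IsConstructor (δ k)) {O : Odds} (hO : Acceptable O)
    {X : Set Cantor} (hX : ∀ S ∈ X, ∃ k, IsResult (δ k) S) : Succeeds (branchCapital δ O) X := by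
  intro S hS
  obtain ⟨k, hk⟩ := hX S hS
  have hle : ∀ n, 2⁻¹ ^ k * capital O (pre S (n + 1)) ≤ branchCapital δ O (pre S (n + 1)) := by
    intro n
    refine mul_le_mul_left ?_ _
    have h1 := (summable_branchWeight (δ := δ) (pre S (n + 1))).le_tsum k fun _ _ => zero_le'
    rwa [branchWeight, if_pos (hk.onBranch (hδ k) _)] at h1
  have h1 := (tendsto_add_atTop_iff_nat 1).2 (tendsto_capital hO S)
  have h2 : Tendsto (fun n => capital O (pre S (n + 1))) atTop atTop := by
    rw [← NNReal.tendsto_coe_atTop]; exact h1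
  have h3 : Tendsto (fun n => branchCapital δ O (pre S (n + 1))) atTop atTop :=
    tendsto_atTop_mono hle (h2.const_mul_atTop (by positivity))
  exact (ENNReal.tendsto_coe_nhds_top.2 h3).limsup_eq

theorem sum_branchWeight_bounds (w : Str) (J : ℕ) :
    ∑ k ∈ Finset.range J, branchWeight δ w k ≤ ∑' k, branchWeight δ w k ∧
    ∑' k, branchWeight δ w k ≤ ∑ k ∈ Finset.range J, branchWeight δ w k + 2 * 2⁻¹ ^ J := by
  refine ⟨(summable_branchWeight w).sum_le_tsum _ fun _ _ => zero_le', ?_⟩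
  have hlt : (2⁻¹ : ℝ≥0) < 1 := by rw [← NNReal.coe_lt_coe]; norm_num
  have hg : ∑' k : ℕ, (2⁻¹ : ℝ≥0) ^ k = 2 := by
    rw [NNReal.tsum_geometric hlt, ← NNReal.coe_inj, NNReal.coe_inv, NNReal.coe_sub hlt.le]
    norm_num
  have hs := NNReal.sum_add_tsum_nat_add J (summable_branchWeight (δ := δ) w)
  have htail : ∑' k, branchWeight δ w (k + J) ≤ ∑' k : ℕ, (2⁻¹ : ℝ≥0) ^ k * 2⁻¹ ^ J := by
    refine (NNReal.summable_nat_add _ (summable_branchWeight w) J).tsum_le_tsum (fun k => ?_)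
      (summable_half_pow.mul_right _)
    rw [← pow_add]
    exact branchWeight_le w _
  rw [summable_half_pow.tsum_mul_right, hg] at htail
  calc ∑' k, branchWeight δ w k = _ := hs
    _ ≤ _ := add_le_add le_rfl htail

end Weight

/-! ### Rational approximations -/

/-- Add `2 ^ j` to a binary number of length at least `j`. -/
def addAt (j : ℕ) (l : List Bool) : List Bool := l.take j ++ inc (l.drop j)

theorem binVal_addAt {j : ℕ} {l : List Bool} (h : j ≤ l.length) :
    binVal (addAt j l) = binVal l + 2 ^ j := by
  conv_rhs => rw [← List.take_append_drop j l]
  rw [addAt, binVal_append, binVal_append, binVal_inc, List.length_take, min_eq_left h]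
  ring

theorem length_le_inc (l : List Bool) : l.length ≤ (inc l).length := by
  induction l with
  | nil => simp
  | cons x l ih => cases x <;> simp [inc]; omega

theorem le_length_addAt (j : ℕ) (l : List Bool) : l.length ≤ (addAt j l).length := by
  have := length_le_inc (l.drop j)
  simp [addAt] at *
  omega

theorem length_addAt_le (j : ℕ) (l : List Bool) : (addAt j l).length ≤ l.length + 1 := by
  have := length_inc_le (l.drop j)
  simp [addAt] at *
  omega

/-- Add `2 ^ J` times the binary fraction `B` to a binary number, up to the last but one place. -/
def addBits : ℕ → List Bool → List Bool → List Bool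
  | _, [], acc => acc
  | J, x :: B, acc => addBits (J - 1) B (if x = true ∧ J ≠ 0 then addAt J acc else acc)

theorem le_length_addBits (J : ℕ) (B acc : List Bool) : acc.length ≤ (addBits J B acc).length := by
  induction B generalizing J acc with
  | nil => exact le_rfl
  | cons x B ih =>
    refine le_trans ?_ (ih _ _)
    split_ifs
    · exact le_length_addAt _ _
    · exact le_rfl

theorem length_addBits_le (J : ℕ) (B acc : List Bool) :
    (addBits J B acc).length ≤ acc.length + B.length := by
  induction B generalizing J acc with
  | nil => exact le_rfl
  | cons x B ih =>
    refine (ih _ _).trans ?_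
    rw [List.length_cons]
    split_ifs
    · have := length_addAt_le J acc; omega
    · omega

/-- Bit `i` of the fraction is added with weight `2 ^ (J - i)`, and nothing is added once this
exponent is 0. The condition `J ≤ acc.length` ensures that `addAt` acts at the intended place. -/
theorem binVal_addBits (f : ℕ → Bool) (m J k : ℕ) (acc : List Bool) (hJ : J ≤ acc.length)
    (hm : J ≤ m) : binVal (addBits J ((List.range' k m).map f) acc) =
      binVal acc + ∑ i ∈ Finset.range J, if f (k + i) then 2 ^ (J - i) else 0 := by
  induction m generalizing J k acc with
  | zero => rw [Nat.le_zero.1 hm]; simp [addBits]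
  | succ m ih =>
    rw [List.range'_succ, List.map_cons, addBits]
    rcases J with _ | J
    · rw [ih _ _ _ (by simp) (by simp)]
      simp
    · rw [Nat.add_sub_cancel, ih _ _ _ ?_ (by omega), Finset.sum_range_succ']
      · have h1 : ∀ i, k + 1 + i = k + (i + 1) := fun i => by ring
        have h2 : ∀ i, J + 1 - (i + 1) = J - i := fun i => by omega
        simp only [h1, h2, add_zero, Nat.sub_zero]
        by_cases hf : f k
        · simp only [hf, ne_eq, Nat.add_one_ne_zero, not_false_eq_true, and_self, if_true]
          rw [binVal_addAt hJ]; ring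
        · simp [hf]
      · split_ifs
        · have := le_length_addAt (J + 1) acc; omega
        · omega

open Classical in
/-- The bits that tell which of the first `m` constructors have results that extend `w`. -/
def branchBits (δ : ℕ → Str → Str) (w : Str) (m : ℕ) : List Bool :=
  (List.range' 0 m).map fun k => decide (OnBranch (δ k) w)

/-- The number of places that remain when `M` places are shifted by the gain for odds `q`. -/
def places (M : ℕ) (q : ℚ) : ℕ :=
  if true ∈ diffBits q then M - firstOne (diffBits q) else 0

theorem places_le (M : ℕ) (q : ℚ) : places M q ≤ M := by
  unfold places
  split_ifs <;> omega

section Approx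

variable {δ : ℕ → Str → Str} {w : Str}

theorem binVal_addBits_branchBits {M J : ℕ} {acc : List Bool} (hJ : J ≤ M) (hM : M ≤ acc.length) :
    (binVal (addBits J (branchBits δ w M) acc) : ℝ≥0) =
      binVal acc + 2 ^ J * ∑ k ∈ Finset.range J, branchWeight δ w k := by
  rw [branchBits, binVal_addBits _ _ _ _ _ (hJ.trans hM) hJ, Finset.mul_sum]
  push_cast
  congr 1
  refine Finset.sum_congr rfl fun k hk => ?_
  have hk := Finset.mem_range.1 hk
  rw [zero_add, branchWeight]
  by_cases h : OnBranch (δ k) w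
  · rw [if_pos (by simpa using h), if_pos h]
    obtain ⟨j, rfl⟩ := Nat.exists_eq_add_of_le hk.le
    rw [Nat.add_sub_cancel_left, pow_add, inv_pow, mul_right_comm, mul_inv_cancel₀ (by positivity),
      one_mul]
  · rw [if_neg (by simpa using h), if_neg h, mul_zero]

/-- Multiplying `2 ^ M` by a gain `2⁻¹ ^ z` leaves `M - z` places. The weights cut off after `J`
places sum to at most `2 * 2⁻¹ ^ J`, that is 2 after scaling. If `z ≥ M`, everything is cut off, and
the whole is at most 2. -/
theorem gain_mul_bounds (M : ℕ) (q : ℚ) :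
    2 ^ places M q * ∑ k ∈ Finset.range (places M q), branchWeight δ w k ≤
      2 ^ M * (gain q * ∑' k, branchWeight δ w k) ∧
    2 ^ M * (gain q * ∑' k, branchWeight δ w k) ≤
      2 ^ places M q * ∑ k ∈ Finset.range (places M q), branchWeight δ w k + 2 := by
  unfold places gain
  split_ifs with h
  · generalize firstOne (diffBits q) = z
    obtain ⟨h1, h2⟩ := sum_branchWeight_bounds (δ := δ) w (M - z)
    rcases le_total z M with hz | hz
    · obtain ⟨j, rfl⟩ := Nat.exists_eq_add_of_le hz
      rw [Nat.add_sub_cancel_left] at h1 h2 ⊢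
      have h3 : (2 : ℝ≥0) ^ (z + j) * (2⁻¹ ^ z * ∑' k, branchWeight δ w k) =
          2 ^ j * ∑' k, branchWeight δ w k := by
        rw [pow_add, ← mul_assoc, mul_right_comm (2 ^ z), inv_pow, mul_inv_cancel₀ (by positivity),
          one_mul]
      rw [h3]
      refine ⟨mul_le_mul_right h1 _, (mul_le_mul_right h2 _).trans ?_⟩
      rw [mul_add, mul_left_comm, inv_pow, mul_inv_cancel₀ (by positivity), mul_one]
    · rw [Nat.sub_eq_zero_of_le hz] at h1 h2 ⊢
      simp only [Finset.range_zero, Finset.sum_empty, mul_zero, zero_add, pow_zero, mul_one] at *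
      refine ⟨zero_le', ?_⟩
      calc (2 : ℝ≥0) ^ M * (2⁻¹ ^ z * ∑' k, branchWeight δ w k) ≤ 2 ^ z * (2⁻¹ ^ z * 2) := by
            gcongr
            norm_num
        _ = 2 := by rw [inv_pow, ← mul_assoc, mul_inv_cancel₀ (by positivity), one_mul]
  · simp

/-- The numerator of the approximation after `s` consultations of the oracle. -/
def numerator (O : Odds) (M : ℕ) (B : List Bool) (w : Str) : ℕ → List Bool
  | 0 => addBits M B (List.replicate M false)
  | s + 1 => addBits (places M (O (w.take (w.length - s)))) B (numerator O M B w s)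

theorem le_length_numerator (O : Odds) (M : ℕ) (B : List Bool) (w : Str) (s : ℕ) :
    M ≤ (numerator O M B w s).length := by
  induction s with
  | zero => exact le_trans (by simp) (le_length_addBits _ _ _)
  | succ s ih => exact ih.trans (le_length_addBits _ _ _)

theorem length_numerator_le (O : Odds) (M : ℕ) (B : List Bool) (w : Str) (s : ℕ) :
    (numerator O M B w s).length ≤ M + (s + 1) * B.length := by
  induction s with
  | zero => exact (length_addBits_le _ _ _).trans (by simp)
  | succ s ih => exact (length_addBits_le _ _ _).trans (by rw [add_one_mul (s + 1)]; omega)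

theorem binVal_replicate_false (n : ℕ) : binVal (List.replicate n false) = 0 := by
  induction n with
  | zero => rfl
  | succ n ih => rw [List.replicate_succ, binVal_cons, ih]; rfl

theorem numerator_bounds (O : Odds) (M s : ℕ) :
    (binVal (numerator O M (branchBits δ w M) w s) : ℝ≥0) ≤ 2 ^ M * ((∑' k, branchWeight δ w k) *
      (1 + ∑ i ∈ Finset.range s, gain (O (w.take (w.length - i))))) ∧
    2 ^ M * ((∑' k, branchWeight δ w k) *
      (1 + ∑ i ∈ Finset.range s, gain (O (w.take (w.length - i))))) ≤
    binVal (numerator O M (branchBits δ w M) w s) + 2 * (s + 1) := by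
  induction s with
  | zero =>
    obtain ⟨h1, h2⟩ := sum_branchWeight_bounds (δ := δ) w M
    rw [numerator, binVal_addBits_branchBits le_rfl (by simp), binVal_replicate_false]
    simp only [Finset.range_zero, Finset.sum_empty, add_zero, mul_one, Nat.cast_zero, zero_add]
    refine ⟨mul_le_mul_right h1 _, (mul_le_mul_right h2 _).trans ?_⟩
    rw [mul_add, mul_left_comm (2 ^ M), inv_pow, mul_inv_cancel₀ (by positivity), mul_one]
  | succ s ih =>
    obtain ⟨h1, h2⟩ := gain_mul_bounds (δ := δ) (w := w) M (O (w.take (w.length - s)))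
    rw [numerator, binVal_addBits_branchBits (places_le _ _) (le_length_numerator _ _ _ _ _),
      Finset.sum_range_succ, ← add_assoc, mul_add (∑' k, branchWeight δ w k), mul_add (2 ^ M),
      mul_comm _ (gain _)]
    refine ⟨add_le_add ih.1 h1, (add_le_add ih.2 h2).trans (le_of_eq ?_)⟩
    push_cast
    ring

/-- There are |w| + 1 truncated additions, each losing at most 2 units in the scale `2 ^ (r + |w| +
1)`; the precision follows from |w| + 1 ≤ 2^|w|. -/
theorem branchCapital_approx (O : Odds) (w : Str) (r : ℕ) :
    |((((binVal (numerator O (r + w.length + 1) (branchBits δ w (r + w.length + 1)) w w.length) : ℚ) /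
      2 ^ (r + w.length + 1) : ℚ)) : ℝ) - branchCapital δ O w| ≤ 2⁻¹ ^ r := by
  have hsum : branchCapital δ O w = (∑' k, branchWeight δ w k) *
      (1 + ∑ i ∈ Finset.range w.length, gain (O (w.take (w.length - i)))) := by
    rw [branchCapital, capital, ← Finset.sum_range_reflect]
    congr 2
    refine Finset.sum_congr rfl fun i hi => ?_
    have := Finset.mem_range.1 hi
    rw [show w.length - 1 - i + 1 = w.length - i by omega]
  obtain ⟨h1, h2⟩ := numerator_bounds (δ := δ) (w := w) O (r + w.length + 1) w.length
  rw [← hsum] at h1 h2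
  generalize binVal (numerator O (r + w.length + 1) (branchBits δ w (r + w.length + 1)) w w.length)
    = a at *
  generalize branchCapital δ O w = F at *
  have h1 : (a : ℝ) ≤ 2 ^ (r + w.length + 1) * F := by exact_mod_cast h1
  have h2 : (2 : ℝ) ^ (r + w.length + 1) * F ≤ a + 2 * (w.length + 1) := by exact_mod_cast h2
  have h3 : ((w.length : ℝ) + 1) ≤ 2 ^ w.length := by
    exact_mod_cast Nat.succ_le_of_lt (Nat.lt_two_pow_self (n := w.length))
  have hM : (0 : ℝ) < 2 ^ (r + w.length + 1) := by positivity
  have h4 : (2 : ℝ)⁻¹ ^ r * 2 ^ (r + w.length + 1) = 2 * 2 ^ w.length := by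
    rw [inv_pow, pow_succ, pow_add, ← mul_assoc, ← mul_assoc, inv_mul_cancel₀ (by positivity)]
    ring
  push_cast
  have h5 : ((a : ℝ) / 2 ^ (r + w.length + 1) - F) * 2 ^ (r + w.length + 1) =
      a - 2 ^ (r + w.length + 1) * F := by
    field_simp
  rw [abs_le]
  constructor
  · by_contra hc
    have := mul_lt_mul_of_pos_right (not_le.1 hc) hM
    rw [h5, neg_mul, h4] at this
    linarith
  · by_contra hc
    have := mul_lt_mul_of_pos_right (not_le.1 hc) hM
    rw [h5, h4] at this
    have : (0 : ℝ) < 2 * 2 ^ w.length := by positivity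
    linarith

end Approx

/-! ### Prefixes of the results of constructors -/

/-- Apply `δ` to the strings that are shorter than `w`. -/
def extend (δ : Str → Str) (w x : Str) : Str := if x.length < w.length then δ x else x

/-- Each application lengthens the string, so |w| rounds reach length |w|, and then a comparison
with `w` decides whether `w` lies on the branch. Stopping at that length keeps all arguments of `δ`
shorter than `w`. -/
theorem IsConstructor.exists_iterate_extend {δ : Str → Str} (hδ : IsConstructor δ) (w : Str)
    (n : ℕ) : ∃ i, (extend δ w)^[n] [] = δ^[i] [] ∧
      min n w.length ≤ ((extend δ w)^[n] []).length := by
  induction n with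
  | zero => exact ⟨0, rfl, by simp⟩
  | succ n ih =>
    obtain ⟨i, h, hlen⟩ := ih
    rw [Function.iterate_succ_apply', extend]
    split_ifs with hlt
    · refine ⟨i + 1, by rw [Function.iterate_succ_apply', h], ?_⟩
      have := hδ.length_lt ((extend δ w)^[n] [])
      omega
    · exact ⟨i, h, by omega⟩

theorem IsConstructor.prefix_iterate_extend_iff {δ : Str → Str} (hδ : IsConstructor δ) (w : Str) :
    w <+: (extend δ w)^[w.length] [] ↔ OnBranch δ w := by
  obtain ⟨i, h, hlen⟩ := hδ.exists_iterate_extend w w.length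
  rw [min_self] at hlen
  constructor
  · intro hw
    exact ⟨i, h ▸ hw⟩
  · rintro ⟨j, hj⟩
    rw [h] at hlen ⊢
    exact List.prefix_of_prefix_length_le (hj.trans (hδ.iterate_prefix (le_max_left j i)))
      (hδ.iterate_prefix (le_max_right j i)) hlen

/-! ### Copying, filling and testing for a prefix. -/

namespace Frag

section Aux

variable {K : Type} [DecidableEq K] [Fintype K] {Γ : K → Type}
  {σ : Type} {ρ : Resource} {v v' v'' : σ} {s s' s'' : ∀ k, List (Γ k)}
  {A A' A'' : Tape → List Bool} {b b' : ℕ}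

/-- Replace all symbols of stack `i` by `x` and move them to stack `j`. -/
def fill (x : Bool) (i j : Tape) : Frag (SumΓ Γ Tape) (σ × Reg) :=
  forEach i (pushBits j [x]) (pushBits j [x])

theorem Does.fill {x : Bool} {i j : Tape} (hij : i ≠ j) :
    (Frag.fill x i j).Does ρ v (join s A) v (join s (Function.update (Function.update A i [])
      j (List.replicate (A i).length x ++ A j))) (5 * (A i).length + 1) := by
  generalize hl : A i = l
  induction l generalizing A with
  | nil =>
    refine (Does.forEach_nil hl).congr ?_ (by simp)
    rw [← hl, Function.update_eq_self]
    simp [hl]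
  | cons y l ih =>
    have h := ih (A := Function.update (Function.update A i l) j (x :: A j)) (by simp [hij])
    refine (Does.forEach_cons (v' := v) (s' := s)
      (A' := Function.update (Function.update A i l) j (x :: A j)) (b := 4) hl ?_ h).congr ?_ ?_
    · have h2 := Does.pushBits (ρ := ρ) (v := v) (s := s) (A := Function.update A i l) (i := j) [x]
      rw [Function.update_of_ne hij.symm] at h2
      cases y <;> exact h2
    · rw [Function.update_comm hij, Function.update_idem, Function.update_comm hij,
        Function.update_idem, Function.update_self, List.length_cons, List.replicate_succ',
        List.append_assoc, Function.update_comm hij.symm]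
      rfl
    · rw [List.length_cons]
      omega

/-- Copy the stack `i` to the stack `j`, with the help of the stack `k`. -/
def copy (i j k : Tape) : Frag (SumΓ Γ Tape) (σ × Reg) := (move i k).seq (move₂ k i j)

theorem Does.copy {i j k : Tape} (hij : i ≠ j) (hik : i ≠ k) (hjk : j ≠ k) (hk : A k = []) :
    (Frag.copy i j k).Does ρ v (join s A) v (join s (Function.update A j (A i ++ A j)))
      (5 * ((A i).length + 2)) := by
  refine ((Does.move hik).seq (Does.move₂ hik.symm hjk.symm hij)).congr ?_ ?_
  · funext l
    by_cases h1 : l = j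
    · subst h1; simp [hk, hij, hij.symm, hik, hik.symm, hjk, hjk.symm]
    · by_cases h2 : l = i
      · subst h2; simp [hk, hij, hij.symm, hik, hik.symm, hjk, hjk.symm]
      · by_cases h3 : l = k
        · subst h3; simp [hk, hij, hij.symm, hik, hik.symm, hjk, hjk.symm]
        · simp [h1, h2, h3]
  · simp [hk]
    omega

/-- Pop a bit of `str`, and raise the flag on `flg` unless it is `x`. -/
def matchBit (x : Bool) : Frag (SumΓ Γ Tape) (σ × Reg) :=
  loop (pop (.inr .str) (fun v a => (v.1, a, none, false))
    (branch (fun v => v.2.1 == some x) (goto fun _ => none)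
      (push (.inr .flg) (fun _ => true) (goto fun _ => none))))

theorem Does.matchBit {x : Bool} : (Frag.matchBit x).Does ρ v (join s A) v
    (join s (Function.update (Function.update A .str (A .str).tail) .flg
      (if (A .str).head? = some x then A .flg else true :: A .flg))) 4 := by
  refine ((Loops.done (r' := ((A .str).head?, none, false)) ?_).does 1 ?_)
  · by_cases h : (A .str).head? = some x
    · have h2 : (Function.update (Function.update A .str (A .str).tail) .flg (A .flg)) =
          Function.update A .str (A .str).tail := by
        funext k; cases k <;> simp
      simp [h, h2]
    · have h2 : ((A .str).head? == some x) = false := by simpa using h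
      simp [h, h2]
  · simp [pushes]

/-- Push to `bts` the bit that tells whether the string on `inp` is a prefix of the one on `str`,
which is erased. -/
def testPrefix : Frag (SumΓ Γ Tape) (σ × Reg) :=
  (copy .inp .cnt .tmp).seq ((forEach .cnt (matchBit false) (matchBit true)).seq ((clear .str).seq
    ((ifEmpty .flg (pushBits .bts [true]) (pushBits .bts [false])).seq (clear .flg))))

/-- Each mismatch leaves one symbol on `flg`. Only whether there is any matters, so the content `f`
is not specified further. -/
theorem Does.forEach_matchBit (w : Str) : ∀ A : Tape → List Bool, A .cnt = w →
    ∃ f, (f = [] ↔ A .flg = [] ∧ w <+: A .str) ∧ f.length ≤ (A .flg).length + w.length ∧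
    (forEach .cnt (Frag.matchBit false) (Frag.matchBit true)).Does ρ v (join s A) v
      (join s (Function.update (Function.update (Function.update A .cnt [])
        .str ((A .str).drop w.length)) .flg f)) (5 * w.length + 1) := by
  induction w with
  | nil =>
    intro A hA
    refine ⟨A .flg, by simp, by simp, (Does.forEach_nil hA).congr ?_ (by simp)⟩
    funext k
    cases k <;> simp [hA]
  | cons x w ih =>
    intro A hA
    obtain ⟨f, h1, h2, h3⟩ := ih (Function.update (Function.update (Function.update A .cnt w) .str
      (A .str).tail) .flg (if (A .str).head? = some x then A .flg else true :: A .flg)) (by simp)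
    refine ⟨f, ?_, ?_, ?_⟩
    · rw [h1]
      rcases hs : A .str with _ | ⟨y, l⟩
      · simp
      · by_cases hxy : y = x
        · simp [hxy]
        · simp [hxy, List.cons_prefix_cons, Ne.symm hxy]
    · refine h2.trans ?_
      simp only [Function.update_self, List.length_cons]
      split_ifs
      · omega
      · simp; omega
    · have hc : ∀ x, (Frag.matchBit x : Frag (SumΓ Γ Tape) (σ × Reg)) =
          cond x (Frag.matchBit true) (Frag.matchBit false) := fun x => by cases x <;> rfl
      have h4 := Does.matchBit (ρ := ρ) (v := v) (s := s) (A := Function.update A .cnt w) (x := x)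
      rw [hc] at h4
      refine (Does.forEach_cons hA h4 (h3.congr rfl le_rfl)).congr ?_ ?_
      · funext k
        cases k <;> simp
      · rw [List.length_cons]; omega

theorem Does.testPrefix {w x : Str} {d : Bool} (hd : d = true ↔ w <+: x) (hinp : A .inp = w)
    (hstr : A .str = x) (hcnt : A .cnt = []) (htmp : A .tmp = []) (hflg : A .flg = []) :
    Frag.testPrefix.Does ρ v (join s A) v
      (join s (Function.update (Function.update A .str []) .bts (d :: A .bts)))
      (20 * (w.length + x.length + 2)) := by
  obtain ⟨f, hf, hlen, h⟩ := Does.forEach_matchBit (ρ := ρ) (v := v) (s := s) w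
    (Function.update A .cnt w) (by simp)
  simp only [ne_eq, reduceCtorEq, not_false_eq_true, Function.update_of_ne, hflg, hstr,
    true_and] at hf hlen h
  have h1 := (Does.copy (ρ := ρ) (v := v) (s := s) (A := A) (i := .inp) (j := .cnt) (k := .tmp)
    (by decide) (by decide) (by decide) htmp).congr (A'' := Function.update A .cnt w)
    (by simp [hinp, hcnt]) le_rfl
  have h2 := (h1.seq h).seq (Does.clear (i := .str))
  set A₁ := Function.update (Function.update (Function.update
    (Function.update (Function.update A .cnt w) .cnt []) .str (x.drop w.length)) .flg f)
    .str [] with hA₁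
  have h3 : (ifEmpty .flg (Frag.pushBits .bts [true]) (Frag.pushBits .bts [false])).Does ρ v
      (join s A₁) v (join s (Function.update A₁ .bts (d :: A .bts))) 5 := by
    by_cases hfe : f = []
    · refine (Does.ifEmpty_nil (by simp [hA₁, hfe]) (Does.pushBits [true])).congr ?_ (by simp)
      rw [hd.2 (hf.1 hfe)]
      simp [hA₁]
    · refine (Does.ifEmpty_cons (by simp [hA₁, hfe]) (Does.pushBits [false])).congr ?_ (by simp)
      have : d = false := by
        rw [← Bool.not_eq_true]
        exact fun h => hfe (hf.2 (hd.1 h))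
      rw [this]
      simp [hA₁]
  have h4 := (h1.seq (h.seq ((Does.clear (i := .str)).seq (h3.seq (Does.clear (i := .flg))))))
  refine h4.congr ?_ ?_
  · funext k
    cases k <;> simp [hA₁, hcnt, hflg]
  · simp [hA₁, hinp] at hlen ⊢
    omega

end Aux

end Frag

/-! ### Deciding which results of constructors extend the given string. -/

namespace Frag

section Constructors

variable {ρ : Resource} {M : StrTM} {A : Tape → List Bool}

/-- Replace the string `x` on `str` by the output of `M` on input `(k, x)`, where `uno` contains
`k` symbols `1`. -/
def callOn (M : StrTM) : Frag (SumΓ M.tm.Γ Tape) (M.tm.σ × Reg) :=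
  ((copy .uno .prc .tmp).seq ((pushBits .prc [false]).seq (move .str .prc))).seq
    ((pour M .prc).seq ((ofTM Tape M.tm).seq ((drain M .cpy).seq (move .cpy .str))))

theorem Does.callOn {k b : ℕ} {x y : Str} (huno : A .uno = List.replicate k true)
    (hstr : A .str = x) (htmp : A .tmp = []) (hprc : A .prc = []) (hcpy : A .cpy = [])
    (h : RunsWithin ρ M.tm.step (cfgSize M.tm) (M.init (encodeNatStr k x)) (M.final y) b) :
    (Frag.callOn M).Does ρ M.tm.initialState (join (fun _ => []) A) M.tm.initialState
      (join (fun _ => []) (Function.update A .str y)) (10 * (k + x.length + y.length + 4) + b) := by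
  have h1 := (Does.copy (ρ := ρ) (Γ := M.tm.Γ) (v := M.tm.initialState) (s := fun _ => [])
    (i := .uno) (j := .prc) (k := .tmp) (by decide) (by decide) (by decide) htmp).seq
    ((Does.pushBits (i := .prc) [false]).seq (Does.move (i := .str) (j := .prc) (by decide)))
  have h1 := h1.congr (A'' := Function.update (Function.update A .str []) .prc
    (encodeNatStr k x).reverse) (b' := 5 * (k + 2) + 4 + 2 * (x.length + 2)) (by
      funext l
      cases l <;> simp [huno, hstr, hprc, encodeNatStr]) (by simp [huno, hstr]; omega)
  have h2 := Does.pour (ρ := ρ) (M := M) (v := M.tm.initialState) (i := .prc)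
    (A := Function.update (Function.update A .str []) .prc (encodeNatStr k x).reverse)
  rw [Function.update_self, List.reverse_reverse, List.length_reverse, length_encodeNatStr,
    Function.update_idem] at h2
  have h3 := Does.ofTM (ι := Tape)
    (A := Function.update (Function.update A .str []) .prc []) h
  have h4 := (Does.drain (ρ := ρ) (M := M) (v := M.tm.initialState) (i := .cpy) (y := y)
    (A := Function.update (Function.update A .str []) .prc [])).seq
    (Does.move (i := .cpy) (j := .str) (by decide))
  refine (h1.seq (h2.seq (h3.seq h4))).congr ?_ ?_
  · funext l
    cases l <;> simp [hprc, hcpy]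
  · simp [hcpy]
    omega

/-- Replace the string on `str` by the output of `M` if it is shorter than the string on `inp`. -/
def extendOnce (M : StrTM) : Frag (SumΓ M.tm.Γ Tape) (M.tm.σ × Reg) :=
  ((copy .inp .cnt .tmp).seq ((copy .str .num .tmp).seq ((moveCount .num .cnt .rev).seq
    (clear .rev)))).seq (ifEmpty .cnt skip ((clear .cnt).seq (Frag.callOn M)))

/-- Lengths are compared by removing |x| symbols from a copy of `w`: something remains precisely if
`x` is shorter. -/
theorem Does.extendOnce {k b l : ℕ} {w x : Str} {δ : Str → Str}
    (huno : A .uno = List.replicate k true) (hinp : A .inp = w) (hstr : A .str = x)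
    (htmp : A .tmp = []) (hprc : A .prc = []) (hcpy : A .cpy = []) (hcnt : A .cnt = [])
    (hnum : A .num = []) (hrev : A .rev = []) (hx : x.length ≤ l)
    (h : x.length < w.length → (δ x).length ≤ l ∧
      RunsWithin ρ M.tm.step (cfgSize M.tm) (M.init (encodeNatStr k x)) (M.final (δ x)) b) :
    (Frag.extendOnce M).Does ρ M.tm.initialState (join (fun _ => []) A) M.tm.initialState
      (join (fun _ => []) (Function.update A .str (extend δ w x)))
      (30 * (k + w.length + l + 4) + b) := by
  have h1 := ((Does.copy (ρ := ρ) (Γ := M.tm.Γ) (v := M.tm.initialState) (s := fun _ => [])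
    (i := .inp) (j := .cnt) (k := .tmp) (by decide) (by decide) (by decide) htmp).seq
    ((Does.copy (i := .str) (j := .num) (k := .tmp) (by decide) (by decide) (by decide)
      (by simp [htmp])).seq ((Does.moveCount (k := .num) (i := .cnt) (j := .rev) (by decide)
      (by decide) (by decide)).seq (Does.clear (i := .rev))))).congr
    (A'' := Function.update A .cnt (w.drop x.length))
    (b' := 6 * w.length + 8 * l + 40) (by
      funext i
      cases i <;> simp [hinp, hstr, hcnt, hnum, hrev]) (by
      simp [hinp, hstr, hcnt, hnum, hrev]
      omega)
  have h2 : (ifEmpty .cnt Frag.skip ((Frag.clear .cnt).seq (Frag.callOn M)) :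
      Frag (SumΓ M.tm.Γ Tape) (M.tm.σ × Reg)).Does ρ M.tm.initialState
      (join (fun _ => []) (Function.update A .cnt (w.drop x.length))) M.tm.initialState
      (join (fun _ => []) (Function.update A .str (extend δ w x)))
      (10 * (k + w.length + 2 * l + 4) + w.length + 10 + b) := by
    unfold extend
    split_ifs with hlt
    · obtain ⟨hl, hrun⟩ := h hlt
      refine (Does.ifEmpty_cons (by simp; omega) (Does.clear.seq (Does.callOn (k := k) (x := x)
        (by simp [huno]) (by simp [hstr]) (by simp [htmp]) (by simp [hprc]) (by simp [hcpy])
        hrun))).congr ?_ ?_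
      · funext i
        cases i <;> simp [hcnt]
      · simp
        omega
    · refine (Does.ifEmpty_nil (by simp; omega) Does.skip).congr ?_ (by omega)
      funext i
      cases i <;> simp [hcnt, hstr]
      omega
  exact (h1.seq h2).mono (by omega)

/-- Push to `bts` the bit that tells whether the string `w` on `inp` is a prefix of the result of
the constructor with the number on `uno`. -/
def branchBit (M : StrTM) : Frag (SumΓ M.tm.Γ Tape) (M.tm.σ × Reg) :=
  ((copy .inp .cod .tmp).seq (forEach .cod (extendOnce M) (extendOnce M))).seq testPrefix

theorem Does.forEach_extendOnce {k b l : ℕ} {w : Str} {δ : Str → Str}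
    (h : ∀ x, x.length < w.length → (δ x).length ≤ l ∧
      RunsWithin ρ M.tm.step (cfgSize M.tm) (M.init (encodeNatStr k x)) (M.final (δ x)) b)
    (u : Str) : ∀ A : Tape → List Bool, A .cod = u → A .uno = List.replicate k true →
    A .inp = w → A .tmp = [] → A .prc = [] → A .cpy = [] → A .cnt = [] → A .num = [] →
    A .rev = [] → (A .str).length ≤ l →
    (forEach .cod (Frag.extendOnce M) (Frag.extendOnce M)).Does ρ M.tm.initialState
      (join (fun _ => []) A) M.tm.initialState (join (fun _ => [])
        (Function.update (Function.update A .cod []) .str ((extend δ w)^[u.length] (A .str))))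
      ((30 * (k + w.length + l + 4) + b + 1) * u.length + 1) := by
  induction u with
  | nil =>
    intro A hcod _ _ _ _ _ _ _ _ _
    refine (Does.forEach_nil hcod).congr ?_ (by simp)
    funext i
    cases i <;> simp [hcod]
  | cons y u ih =>
    intro A hcod huno hinp htmp hprc hcpy hcnt hnum hrev hstr
    have hlen : (extend δ w (A .str)).length ≤ l := by
      unfold extend
      split_ifs with hlt
      · exact (h _ hlt).1
      · exact hstr
    have h1 := Does.extendOnce (A := Function.update A .cod u) (k := k) (w := w) (x := A .str)
      (δ := δ) (l := l) (b := b) (by simp [huno]) (by simp [hinp]) (by simp) (by simp [htmp])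
      (by simp [hprc]) (by simp [hcpy]) (by simp [hcnt]) (by simp [hnum]) (by simp [hrev]) hstr
      (h _)
    refine (Does.forEach_cons hcod (by cases y <;> exact h1) (ih (Function.update
      (Function.update A .cod u) .str (extend δ w (A .str))) (by simp) (by simp [huno])
      (by simp [hinp]) (by simp [htmp]) (by simp [hprc]) (by simp [hcpy]) (by simp [hcnt])
      (by simp [hnum]) (by simp [hrev]) (by simpa using hlen))).congr ?_ ?_
    · funext i
      cases i <;> simp
    · rw [List.length_cons, mul_add_one]
      omega

theorem Does.branchBit {k b l : ℕ} {w : Str} {δ : Str → Str} {d : Bool} (hδ : IsConstructor δ)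
    (hd : d = true ↔ OnBranch δ w)
    (h : ∀ x, x.length < w.length → (δ x).length ≤ l ∧
      RunsWithin ρ M.tm.step (cfgSize M.tm) (M.init (encodeNatStr k x)) (M.final (δ x)) b)
    (huno : A .uno = List.replicate k true) (hinp : A .inp = w) (hstr : A .str = [])
    (htmp : A .tmp = []) (hprc : A .prc = []) (hcpy : A .cpy = []) (hcnt : A .cnt = [])
    (hnum : A .num = []) (hrev : A .rev = []) (hcod : A .cod = []) (hflg : A .flg = []) :
    (Frag.branchBit M).Does ρ M.tm.initialState (join (fun _ => []) A) M.tm.initialState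
      (join (fun _ => []) (Function.update A .bts (d :: A .bts)))
      ((30 * (k + w.length + l + 4) + b + 1) * (w.length + 1)) := by
  have h1 := (Does.copy (ρ := ρ) (Γ := M.tm.Γ) (v := M.tm.initialState) (s := fun _ => [])
    (i := .inp) (j := .cod) (k := .tmp) (by decide) (by decide) (by decide) htmp).congr
    (A'' := Function.update A .cod w) (by simp [hinp, hcod]) le_rfl
  have h2 := Does.forEach_extendOnce h w (Function.update A .cod w) (by simp) (by simp [huno])
    (by simp [hinp]) (by simp [htmp]) (by simp [hprc]) (by simp [hcpy]) (by simp [hcnt])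
    (by simp [hnum]) (by simp [hrev]) (by simp [hstr])
  have hlen : ∀ n, ((extend δ w)^[n] []).length ≤ l := by
    intro n
    induction n with
    | zero => simp
    | succ n ih =>
      rw [Function.iterate_succ_apply', extend]
      split_ifs with hlt
      · exact (h _ hlt).1
      · exact ih
  have hl := hlen w.length
  have h2 := h2.congr (A'' := Function.update A .str ((extend δ w)^[w.length] [])) (by
    funext i
    cases i <;> simp [hstr, hcod]) le_rfl
  have h3 := Does.testPrefix (ρ := ρ) (Γ := M.tm.Γ) (v := M.tm.initialState) (s := fun _ => [])
    (w := w) (A := Function.update A .str ((extend δ w)^[w.length] [])) (d := d)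
    (hd.trans (hδ.prefix_iterate_extend_iff w).symm) (by simp [hinp]) (by simp)
    (by simp [hcnt]) (by simp [htmp]) (by simp [hflg])
  refine ((h1.seq h2).seq h3).congr ?_ ?_
  · funext i
    cases i <;> simp [hstr]
  · rw [mul_add_one, hinp]
    omega

/-- Push the bits for all the constructors with numbers less than the one on `uno` to `bts`. -/
def allBits (M : StrTM) : Frag (SumΓ M.tm.Γ Tape) (M.tm.σ × Reg) :=
  forEach .uno (branchBit M) (branchBit M)

/-- The unary counter on `uno`, after the pop, is at the same time the number of the constructor to
be tested. The numbers come in decreasing order, so that pushing puts bit 0 on top. -/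
theorem Does.allBits {b l : ℕ} {w : Str} {δ : ℕ → Str → Str} (hδ : ∀ k, IsConstructor (δ k))
    (m : ℕ) : ∀ A : Tape → List Bool, (∀ k < m, ∀ x, x.length < w.length → (δ k x).length ≤ l ∧
      RunsWithin ρ M.tm.step (cfgSize M.tm) (M.init (encodeNatStr k x)) (M.final (δ k x)) b) →
    A .uno = List.replicate m true → A .inp = w → A .str = [] → A .tmp = [] → A .prc = [] →
    A .cpy = [] → A .cnt = [] → A .num = [] → A .rev = [] → A .cod = [] → A .flg = [] →
    (Frag.allBits M).Does ρ M.tm.initialState (join (fun _ => []) A) M.tm.initialState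
      (join (fun _ => []) (Function.update (Function.update A .uno [])
        .bts (branchBits δ w m ++ A .bts)))
      (((30 * (m + w.length + l + 4) + b + 1) * (w.length + 1) + 1) * m + 1) := by
  induction m with
  | zero =>
    intro A _ huno _ _ _ _ _ _ _ _ _ _
    refine (Does.forEach_nil huno).congr ?_ (by simp)
    funext i
    cases i <;> simp [huno, branchBits]
  | succ m ih =>
    intro A h huno hinp hstr htmp hprc hcpy hcnt hnum hrev hcod hflg
    classical
    have h1 := Does.branchBit (A := Function.update A .uno (List.replicate m true)) (k := m)
      (d := decide (OnBranch (δ m) w)) (hδ m) decide_eq_true_iff (h m (by omega)) (by simp)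
      (by simp [hinp]) (by simp [hstr]) (by simp [htmp]) (by simp [hprc]) (by simp [hcpy])
      (by simp [hcnt]) (by simp [hnum]) (by simp [hrev]) (by simp [hcod]) (by simp [hflg])
    refine (Does.forEach_cons (x := true) (l := List.replicate m true) (by rw [huno]; rfl) h1
      (ih _ (fun k hk => h k (by omega)) (by simp) (by simp [hinp]) (by simp [hstr])
      (by simp [htmp]) (by simp [hprc]) (by simp [hcpy]) (by simp [hcnt]) (by simp [hnum])
      (by simp [hrev]) (by simp [hcod]) (by simp [hflg]))).congr ?_ ?_
    · funext i
      cases i <;> simp [branchBits, List.range'_concat]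
    · have h2 : (30 * (m + w.length + l + 4) + b + 1) * (w.length + 1) ≤
        (30 * (m + 1 + w.length + l + 4) + b + 1) * (w.length + 1) := by gcongr; omega
      have h3 : ((30 * (m + w.length + l + 4) + b + 1) * (w.length + 1) + 1) * m ≤
        ((30 * (m + 1 + w.length + l + 4) + b + 1) * (w.length + 1) + 1) * m := by gcongr
      rw [mul_add_one ((30 * (m + 1 + w.length + l + 4) + b + 1) * (w.length + 1) + 1)]
      omega

end Constructors

end Frag

/-! ### Shifted addition of binary fractions, and the rounds between consultations. -/

namespace Frag

section Addition

variable {K : Type} [DecidableEq K] [Fintype K] {Γ : K → Type}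
  {σ : Type} {ρ : Resource} {v v' v'' : σ} {s s' s'' : ∀ k, List (Γ k)}
  {A A' A'' : Tape → List Bool} {b b' : ℕ}

/-- Add a power of two, given by the length of the string on `cnt`, to the number on `acc`. -/
def addPower : Frag (SumΓ Γ Tape) (σ × Reg) :=
  ifEmpty .cnt skip ((copy .cnt .num .tmp).seq ((moveCount .num .acc .rev).seq (incr .acc .rev)))

theorem Does.addPower (htmp : A .tmp = []) (hnum : A .num = []) (hrev : A .rev = []) :
    Frag.addPower.Does ρ v (join s A) v (join s (Function.update A .acc
      (if (A .cnt).length ≠ 0 then addAt (A .cnt).length (A .acc) else A .acc)))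
      (7 * (A .cnt).length + 4 * (A .acc).length + 40) := by
  by_cases h : A .cnt = []
  · refine (Does.ifEmpty_nil h Does.skip).congr ?_ (by omega)
    simp [h]
  · refine (Does.ifEmpty_cons h ((Does.copy (by decide) (by decide) (by decide) htmp).seq
      ((Does.moveCount (by decide) (by decide) (by decide)).seq
      (Does.incr (by decide))))).congr ?_ ?_
    · have h2 : (A .cnt).length ≠ 0 := by simpa using h
      rw [if_pos h2]
      funext i
      cases i <;> simp [hnum, hrev, addAt]
    · simp [hnum, hrev]
      omega

/-- Add the multiple of the binary fraction on `bts` by the power of two that is given by the length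
of the string on `cnt` to the number on `acc`. -/
def addFraction : Frag (SumΓ Γ Tape) (σ × Reg) :=
  (forEach .bts ((pushBits .cpy [false]).seq (dropTop .cnt 1))
    ((pushBits .cpy [true]).seq (addPower.seq (dropTop .cnt 1)))).seq
  ((move .cpy .bts).seq (clear .cnt))

/-- The stack `cnt` holds the current exponent in unary and loses one symbol per bit. `Q` bounds the
length of the number throughout, as each bit lengthens it by at most 1. -/
theorem Does.forEach_addPower (B : List Bool) (Q : ℕ) : ∀ A : Tape → List Bool, A .bts = B →
    A .tmp = [] → A .num = [] → A .rev = [] → (A .cnt).length ≤ Q →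
    (A .acc).length + B.length ≤ Q →
    (forEach .bts ((Frag.pushBits .cpy [false]).seq (Frag.dropTop .cnt 1))
      ((Frag.pushBits .cpy [true]).seq (Frag.addPower.seq (Frag.dropTop .cnt 1)))).Does ρ v
      (join s A) v (join s (Function.update (Function.update (Function.update (Function.update A
        .bts []) .cpy (B.reverse ++ A .cpy)) .cnt ((A .cnt).drop B.length)) .acc
        (addBits (A .cnt).length B (A .acc))))
      ((11 * Q + 50) * B.length + 1) := by
  induction B with
  | nil =>
    intro A hbts _ _ _ _ _
    refine (Does.forEach_nil hbts).congr ?_ (by simp)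
    funext i
    cases i <;> simp [hbts, addBits]
  | cons x B ih =>
    intro A hbts htmp hnum hrev hcnt hacc
    rw [List.length_cons] at hacc
    have h1 : (cond x ((Frag.pushBits .cpy [true]).seq (Frag.addPower.seq (Frag.dropTop .cnt 1)))
        ((Frag.pushBits .cpy [false]).seq (Frag.dropTop .cnt 1)) :
        Frag (SumΓ Γ Tape) (σ × Reg)).Does ρ v (join s (Function.update A .bts B)) v
        (join s (Function.update (Function.update (Function.update (Function.update A .bts B) .cpy
          (x :: A .cpy)) .cnt ((A .cnt).drop 1)) .acc
          (if x = true ∧ (A .cnt).length ≠ 0 then addAt (A .cnt).length (A .acc) else A .acc)))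
        (11 * Q + 48) := by
      cases x
      · refine ((Does.pushBits [false]).seq Does.dropTop).congr ?_ (by simp)
        funext i
        cases i <;> simp
      · refine ((Does.pushBits [true]).seq ((Does.addPower (by simp [htmp]) (by simp [hnum])
          (by simp [hrev])).seq Does.dropTop)).congr ?_ (by simp; omega)
        funext i
        cases i <;> simp
    have hlen : (if x = true ∧ (A .cnt).length ≠ 0 then addAt (A .cnt).length (A .acc)
        else A .acc).length ≤ (A .acc).length + 1 := by
      split_ifs
      · exact length_addAt_le _ _
      · omega
    refine (Does.forEach_cons hbts h1 (ih _ (by simp) (by simp [htmp]) (by simp [hnum])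
      (by simp [hrev]) (by simp; omega) (by
        rw [Function.update_self]
        omega))).congr ?_ ?_
    · funext i
      cases i <;> simp [addBits, Nat.add_comm]
    · rw [List.length_cons, mul_add_one]
      omega

theorem Does.addFraction {Q : ℕ} (htmp : A .tmp = []) (hnum : A .num = []) (hrev : A .rev = [])
    (hcpy : A .cpy = []) (hcnt : (A .cnt).length ≤ Q)
    (hacc : (A .acc).length + (A .bts).length ≤ Q) :
    Frag.addFraction.Does ρ v (join s A) v (join s (Function.update (Function.update A .cnt [])
      .acc (addBits (A .cnt).length (A .bts) (A .acc)))) ((11 * Q + 53) * ((A .bts).length + 1)) := by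
  refine ((Does.forEach_addPower (A .bts) Q A rfl htmp hnum hrev hcnt hacc).seq
    ((Does.move (by decide)).seq Does.clear)).congr ?_ ?_
  · funext i
    cases i <;> simp [hcpy]
  · simp [hcpy]
    have : (11 * Q + 53) * ((A .bts).length + 1) =
      (11 * Q + 50) * (A .bts).length + 3 * (A .bts).length + 11 * Q + 53 := by ring
    omega

/-- Remove symbols from `rev` up to the first `1`, and as many from `cnt`. Raise the flag on `flg` if
there is a `1`. -/
def skipZeros : Frag (SumΓ Γ Tape) (σ × Reg) :=
  loop (pop (.inr .rev) (fun v a => (v.1, a, none, false))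
    (branch (fun v => v.2.1.isSome)
      (pop (.inr .cnt) (fun v _ => v)
        (branch (fun v => v.2.1.getD false) (push (.inr .flg) (fun _ => true) (goto fun _ => none))
          (goto fun _ => some true)))
      (goto fun _ => none)))

/-- Removing symbols from the unary exponent up to the first 1 performs the division by `2 ^
firstOne`. The remaining digits `l` are irrelevant and are cleared afterwards. -/
theorem Does.skipZeros (hflg : A .flg = []) : ∃ l, l.length ≤ (A .rev).length ∧
    Frag.skipZeros.Does ρ v (join s A) v
      (join s (Function.update (Function.update (Function.update A .rev l) .cnt
        ((A .cnt).drop (if true ∈ A .rev then firstOne (A .rev) else (A .rev).length))) .flg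
        (if true ∈ A .rev then [true] else []))) (2 * ((A .rev).length + 2)) := by
  suffices ∀ l, ∀ (A : Tape → List Bool) r, A .flg = [] → A .rev = l → ∃ l' r' t, l'.length ≤ l.length ∧
      t ≤ l.length + 1 ∧
      Loops (pop (.inr .rev) (fun v a => (v.1, a, none, false))
        (branch (fun v => v.2.1.isSome)
          (pop (.inr .cnt) (fun v _ => v)
            (branch (fun v => v.2.1.getD false)
              (push (.inr .flg) (fun _ => true) (goto fun _ => none))
              (goto fun _ => some true)))
          (goto fun _ => none))) v r (join s A) v r'
      (join s (Function.update (Function.update (Function.update A .rev l') .cnt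
        ((A .cnt).drop (if true ∈ l then firstOne l else l.length))) .flg
        (if true ∈ l then [true] else []))) t by
    obtain ⟨l', r', t, hl, ht, h⟩ := this (A .rev) A (none, none, false) hflg rfl
    exact ⟨l', hl, (h.does (ρ := ρ) 1 (by simp [pushes])).mono (by omega)⟩
  intro l
  induction l with
  | nil =>
    intro A r hflg hrev
    refine ⟨[], (none, none, false), 1, by simp, by simp, .done ?_⟩
    have : Function.update (Function.update (Function.update A .rev []) .cnt (A .cnt)) .flg [] =
        Function.update A .rev [] := by
      funext i
      cases i <;> simp [hflg]
    simp [hrev, this]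
  | cons x l ih =>
    intro A r hflg hrev
    cases x
    · obtain ⟨l', r', t, hl, ht, h⟩ := ih (Function.update (Function.update A .rev l) .cnt
        (A .cnt).tail) (some false, none, false) (by simp [hflg]) (by simp)
      refine ⟨l', r', t + 1, by simp; omega, by simp; omega, .more (v' := v)
        (r' := (some false, none, false)) (S' := join s (Function.update (Function.update A .rev l)
          .cnt (A .cnt).tail)) (by simp [hrev]) (h.congr_stacks ?_ rfl)⟩
      have hf : firstOne (false :: l) = firstOne l + 1 := by simp [firstOne]
      funext i
      cases i <;> simp [hf]
      split_ifs <;> simp [Nat.add_comm]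
    · refine ⟨l, (some true, none, false), 1, by simp, by simp, .done ?_⟩
      have hf : firstOne (true :: l) = 1 := by simp [firstOne]
      simp [hrev, hf, hflg]

end Addition

section Rounds

variable {K : Type} [DecidableEq K] [Fintype K] {Γ : K → Type}
  {σ : Type} {ρ : Resource} {v v' v'' : σ} {s s' s'' : ∀ k, List (Γ k)}
  {A A' A'' : Tape → List Bool} {b b' : ℕ}

/-- Contents of the stacks between the consultations of the oracle. -/
def roundStk (idx bts acc str qry cod : List Bool) : Tape → List Bool
  | .idx => idx
  | .bts => bts
  | .acc => acc
  | .str => str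
  | .qry => qry
  | .cod => cod
  | _ => []

/-- Prepare the next query. -/
def prepare : Frag (SumΓ Γ Tape) (σ × Reg) :=
  (move₂ .str .qry .tmp).seq ((move .tmp .str).seq (dropTop .str 1))

theorem drop_reverse_take (w : Str) {j : ℕ} (hj : j ≤ w.length) :
    ((w.take j).reverse).drop 1 = (w.take (j - 1)).reverse := by
  rw [List.drop_one, List.tail_reverse, List.dropLast_eq_take, List.take_take, List.length_take]
  congr 2
  omega

theorem Does.prepare {w : Str} {j : ℕ} {idx bts acc : List Bool} (hj : j ≤ w.length) :
    Frag.prepare.Does ρ v (join s (roundStk idx bts acc (w.take j).reverse [] [])) v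
      (join s (roundStk idx bts acc (w.take (j - 1)).reverse (w.take j) []))
      (5 * (w.length + 3)) := by
  refine ((Does.move₂ (by decide) (by decide) (by decide)).seq ((Does.move (by decide)).seq
    Does.dropTop)).congr ?_ ?_
  · funext i
    have := drop_reverse_take w hj
    cases i <;> simp_all [roundStk]
  · simp [roundStk]
    omega

/-- Read the answer of the oracle, and update the number on `acc`. -/
def absorb : Frag (SumΓ Γ Tape) (σ × Reg) :=
  (unpair.seq (subtract.seq (copy .idx .cnt .tmp))).seq (skipZeros.seq
    ((ifEmpty .flg (clear .cnt) skip).seq ((clear .flg).seq ((clear .rev).seq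
      (addFraction.seq prepare)))))

theorem Does.absorb {w : Str} {j Q : ℕ} {idx bts acc : List Bool} {q : ℚ} (hq : 1 ≤ q)
    (hj : j ≤ w.length) (hw : w.length ≤ Q) (hidx : idx.length ≤ Q)
    (hacc : acc.length + bts.length ≤ Q) (hcod : (encodeRat q).length ≤ Q) :
    Frag.absorb.Does ρ v (join s (roundStk idx bts acc (w.take j).reverse [] (encodeRat q))) v
      (join s (roundStk idx bts (addBits (places idx.length q) bts acc) (w.take (j - 1)).reverse
        (w.take j) [])) (100 * (Q + 1) * (bts.length + 1)) := by
  -- As `q ≥ 1`, the subtraction leaves no borrow on `flg`, which is then free for the flag of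
  -- `skipZeros`.
  have hlt : ¬ binVal q.num.natAbs.bits < binVal q.den.bits := by
    rw [binVal_bits, binVal_bits, not_lt]
    have h1 : (q.den : ℤ) ≤ q.num := by
      have := Rat.num_div_den q
      have hd : (0 : ℚ) < q.den := by exact_mod_cast q.den_pos
      rw [← this, le_div_iff₀ hd, one_mul] at hq
      exact_mod_cast hq
    omega
  have hlen : (encodeRat q).length = 2 * q.num.natAbs.bits.length + q.den.bits.length + 1 := by
    simp [encodeRat, pairStr]; omega
  have hdiff : (diffBits q).length ≤ Q := by
    rw [diffBits, List.length_reverse, length_subBits]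
    omega
  have h1 := ((Does.unpair (ρ := ρ) (v := v) (s := s) (A := roundStk idx bts acc
    (w.take j).reverse [] (encodeRat q)) (x := q.num.natAbs.bits) (y := q.den.bits) rfl rfl rfl).seq
    ((Does.subtract (by simp [roundStk]) (by simp [roundStk])).seq
    (Does.copy (i := .idx) (j := .cnt) (k := .tmp) (by decide) (by decide) (by decide)
      (by simp [roundStk])))).congr (A'' := Function.update (Function.update
      (roundStk idx bts acc (w.take j).reverse [] []) .rev (diffBits q)) .cnt idx)
      (b' := 20 * (Q + 4)) (by
        funext i
        cases i <;> simp [roundStk, hlt, diffBits]) (by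
        simp [roundStk]
        omega)
  obtain ⟨l, hl, h2⟩ := Does.skipZeros (ρ := ρ) (v := v) (s := s) (A := Function.update
    (Function.update (roundStk idx bts acc (w.take j).reverse [] []) .rev (diffBits q)) .cnt idx)
    (by simp [roundStk])
  simp only [ne_eq, reduceCtorEq, not_false_eq_true, Function.update_of_ne, Function.update_self]
    at hl h2
  -- If the difference has no digit 1, the gain is 0, and emptying `cnt` makes the following
  -- addition void. In either case only the length of `cnt` matters.
  obtain ⟨c, hc, h3⟩ : ∃ c : List Bool, c.length = places idx.length q ∧
      (ifEmpty .flg (Frag.clear .cnt) Frag.skip : Frag (SumΓ Γ Tape) (σ × Reg)).Does ρ v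
        (join s (Function.update (Function.update (Function.update (Function.update (Function.update
          (roundStk idx bts acc (w.take j).reverse [] []) .rev (diffBits q)) .cnt idx) .rev l) .cnt
          (idx.drop (if true ∈ diffBits q then firstOne (diffBits q) else (diffBits q).length))) .flg
          (if true ∈ diffBits q then [true] else []))) v
        (join s (Function.update (Function.update (Function.update
          (roundStk idx bts acc (w.take j).reverse [] []) .rev l) .cnt c) .flg
          (if true ∈ diffBits q then [true] else []))) (Q + 3) := by
    by_cases hm : true ∈ diffBits q
    · refine ⟨idx.drop (firstOne (diffBits q)), by simp [places, hm],
        (Does.ifEmpty_cons (by simp [hm]) Does.skip).congr ?_ (by omega)⟩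
      funext i
      cases i <;> simp [hm]
    · refine ⟨[], by simp [places, hm], (Does.ifEmpty_nil (by simp [hm]) Does.clear).congr ?_ ?_⟩
      · funext i
        cases i <;> simp [hm]
      · simp [hm]
        omega
  have h4 := (Does.clear (ρ := ρ) (v := v) (s := s) (i := .flg) (A := Function.update
    (Function.update (Function.update (roundStk idx bts acc (w.take j).reverse [] []) .rev l) .cnt c)
    .flg (if true ∈ diffBits q then [true] else []))).congr (A'' := Function.update
    (Function.update (roundStk idx bts acc (w.take j).reverse [] []) .rev l) .cnt c) (b' := 3) (by
      funext i
      cases i <;> simp [roundStk]) (by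
      simp
      split_ifs <;> simp)
  have h5 := (Does.clear (ρ := ρ) (v := v) (s := s) (i := .rev) (A := Function.update
    (Function.update (roundStk idx bts acc (w.take j).reverse [] []) .rev l) .cnt c)).congr
    (A'' := Function.update (roundStk idx bts acc (w.take j).reverse [] []) .cnt c)
    (b' := Q + 2) (by
      funext i
      cases i <;> simp [roundStk]) (by
      simp
      omega)
  have h6 := (Does.addFraction (ρ := ρ) (v := v) (s := s) (Q := Q) (A := Function.update
    (roundStk idx bts acc (w.take j).reverse [] []) .cnt c) (by simp [roundStk])
    (by simp [roundStk]) (by simp [roundStk]) (by simp [roundStk]) (by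
      rw [Function.update_self, hc]
      exact (places_le _ _).trans hidx) (by simpa [roundStk] using hacc)).congr
    (A'' := roundStk idx bts (addBits (places idx.length q) bts acc) (w.take j).reverse [] [])
    (b' := (11 * Q + 53) * (bts.length + 1)) (by
      funext i
      cases i <;> simp [roundStk, hc]) (by simp [roundStk])
  refine (h1.seq (h2.seq (h3.seq (h4.seq (h5.seq (h6.seq (Does.prepare hj))))))).mono ?_
  have h7 : 100 * (Q + 1) * (bts.length + 1) = (11 * Q + 53) * (bts.length + 1) +
    (89 * Q + 47) * (bts.length + 1) := by ring
  have h8 : (89 * Q + 47) * 1 ≤ (89 * Q + 47) * (bts.length + 1) := by gcongr; omega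
  omega

/-- Write the pair of the number on `acc` and the power of two with as many zeros as there are
symbols on `idx` to `cpy`. -/
def finish : Frag (SumΓ Γ Tape) (σ × Reg) :=
  (clear .bts).seq ((pushBits .cpy [true]).seq ((fill false .idx .cpy).seq ((move .acc .tmp).seq
    ((move₂ .tmp .cpy .num).seq ((pushBits .cpy [false]).seq (fill true .num .cpy))))))

theorem Does.finish {idx bts acc : List Bool} :
    Frag.finish.Does ρ v (join s (roundStk idx bts acc [] [] [])) v (join s (Function.update
      (fun _ => []) .cpy (pairStr acc (List.replicate idx.length false ++ [true]))))
      (10 * (idx.length + bts.length + acc.length + 3)) := by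
  refine (Does.clear.seq ((Does.pushBits [true]).seq ((Does.fill (by decide)).seq
    ((Does.move (by decide)).seq ((Does.move₂ (by decide) (by decide) (by decide)).seq
    ((Does.pushBits [false]).seq (Does.fill (by decide)))))))).congr ?_ ?_
  · funext i
    cases i <;> simp [roundStk, pairStr]
  · simp [roundStk]
    omega

end Rounds

end Frag

/-! ### Oracle machines from fragments -/

section Driver

variable {K : Type} [DecidableEq K] [Fintype K] {Γ : K → Type} {σ : Type} [Fintype σ]

/-- Labels of the oracle machine `driver`. -/
abbrev DriverLabel (P₁ P₂ P₃ : Frag (SumΓ Γ Tape) (σ × Reg)) : Type :=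
  (P₁.L ⊕ P₂.L) ⊕ (P₃.L ⊕ Option Bool)

/-- The program of the oracle machine `driver`. -/
def driverCode (v₀ : σ) (P₁ P₂ P₃ : Frag (SumΓ Γ Tape) (σ × Reg)) :
    DriverLabel P₁ P₂ P₃ → Stmt (SumΓ Γ Tape) (DriverLabel P₁ P₂ P₃) (σ × Reg)
  | .inl (.inl l) => mapLabel (fun o => o.elim (.inr (.inr (some false)))
      fun l => .inl (.inl l)) (P₁.code l)
  | .inl (.inr l) => mapLabel (fun o => o.elim (.inr (.inr (some false)))
      fun l => .inl (.inr l)) (P₂.code l)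
  | .inr (.inl l) => mapLabel (fun o => o.elim (.inr (.inr none))
      fun l => .inr (.inl l)) (P₃.code l)
  | .inr (.inr none) => load (fun _ => (v₀, none, none, false)) halt
  | .inr (.inr (some false)) => peek (.inr .qry) (fun v a => (v.1, a, none, false))
      (goto fun v => cond v.2.1.isSome (.inr (.inr (some true))) (.inr (.inl P₃.entry)))
  | .inr (.inr (some true)) => halt

/-- The oracle machine that executes `P₁`, then consults the oracle and executes `P₂` as long as
there is a query on the stack `qry`, and then executes `P₃`. -/
def driver (v₀ : σ) (P₁ P₂ P₃ : Frag (SumΓ Γ Tape) (σ × Reg)) : OracleTM where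
  tm :=
    { K := K ⊕ Tape
      k₀ := .inr .inp
      k₁ := .inr .cpy
      Γ := SumΓ Γ Tape
      Λ := DriverLabel P₁ P₂ P₃
      main := .inl (.inl P₁.entry)
      σ := σ × Reg
      initialState := (v₀, none, none, false)
      Γk₀Fin := inferInstanceAs (Fintype Bool)
      m := driverCode v₀ P₁ P₂ P₃ }
  inputAlphabet := Equiv.refl Bool
  outputAlphabet := Equiv.refl Bool
  queryStack := .inr .qry
  answerStack := .inr .cod
  queryAlphabet := Equiv.refl Bool
  answerAlphabet := Equiv.refl Bool
  ask := .inr (.inr (some true))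
  resume := .inl (.inr P₂.entry)

/-- The step function of `driver`. -/
def driverStep (v₀ : σ) (P₁ P₂ P₃ : Frag (SumΓ Γ Tape) (σ × Reg)) (O : Str → Str) :
    Cfg (SumΓ Γ Tape) (DriverLabel P₁ P₂ P₃) (σ × Reg) →
      Option (Cfg (SumΓ Γ Tape) (DriverLabel P₁ P₂ P₃) (σ × Reg)) :=
  (driver v₀ P₁ P₂ P₃).step O

variable {ρ : Resource} {v₀ : σ} {P₁ P₂ P₃ : Frag (SumΓ Γ Tape) (σ × Reg)} {O : Str → Str}
  {R : ℕ → Tape → List Bool} {b₁ b₂ b₃ ℓ : ℕ}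

/-- Only the label `ask` is intercepted by the oracle step; the `halt` that the program has there is
never executed. -/
theorem driverStep_of_ne {l : DriverLabel P₁ P₂ P₃} (hl : l ≠ .inr (.inr (some true)))
    (v : σ × Reg) (S : ∀ k, List (SumΓ Γ Tape k)) :
    driverStep v₀ P₁ P₂ P₃ O ⟨some l, v, S⟩ = some (stepAux (driverCode v₀ P₁ P₂ P₃ l) v S) :=
  if_neg fun h => hl (Option.some.inj h)

theorem driverStep_ask (v : σ × Reg) (A : Tape → List Bool) :
    driverStep v₀ P₁ P₂ P₃ O ⟨some (.inr (.inr (some true))), v, join (fun _ => []) A⟩ =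
      some ⟨some (.inl (.inr P₂.entry)), v, join (fun _ => [])
        (Function.update (Function.update A .qry []) .cod (O (A .qry)))⟩ := by
  refine (if_pos rfl).trans ?_
  rw [← update_join_inr, ← update_join_inr]
  have h : Function.update (Function.update (join (fun k => ([] : List (Γ k))) A) (.inr .qry) [])
      (.inr .cod) (((O ((A .qry).map id)).map id)) = Function.update (Function.update
      (join (fun k => ([] : List (Γ k))) A) (.inr .qry) []) (.inr .cod) (O (A .qry)) := by
    rw [List.map_id, List.map_id]
  exact congrArg (fun S => some (⟨some (.inl (.inr P₂.entry)), v, S⟩ :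
    Cfg (SumΓ Γ Tape) (DriverLabel P₁ P₂ P₃) (σ × Reg))) h

/-- `R i` is the content of the stacks when `i` rounds remain. An empty query ends the loop; this is
possible because the odds at the empty string are never needed. -/
theorem driver_rounds (n : ℕ) (hq : ∀ i < n, R (i + 1) .qry ≠ []) (h0 : R 0 .qry = [])
    (h2 : ∀ i < n, P₂.Does ρ v₀ (join (fun _ => []) (Function.update (Function.update (R (i + 1))
      .qry []) .cod (O (R (i + 1) .qry)))) v₀ (join (fun _ => []) (R i)) b₂)
    (hO : ∀ i < n, (O (R (i + 1) .qry)).length ≤ ℓ) (r : Reg) :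
    ∃ r' t, (ρ = .time → t ≤ n * (b₂ + ℓ + 2) + 1) ∧
      Path (driverStep v₀ P₁ P₂ P₃ O) (fun c => ρ = .space →
        stkSize c.stk ≤ stkSize (join (fun k => ([] : List (Γ k))) (R n)) +
          (n * (b₂ + ℓ + 2) + 1))
        ⟨some (.inr (.inr (some false))), (v₀, r), join (fun _ => []) (R n)⟩
        ⟨some (.inr (.inl P₃.entry)), (v₀, r'), join (fun _ => []) (R 0)⟩ t := by
  induction n generalizing r with
  | zero =>
    refine ⟨(none, none, false), 1, fun _ => by omega, .cons (fun _ => Nat.le_add_right _ _) ?_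
      (.refl fun _ => Nat.le_add_right _ _)⟩
    rw [driverStep_of_ne (by simp)]
    simp [driverCode, h0]
  | succ n ih =>
    obtain ⟨x, l, hx⟩ := List.exists_cons_of_ne_nil (hq n (by omega))
    obtain ⟨r₂, t₂, ht₂, hr₂⟩ := h2 n (by omega) (some x, none, false)
    obtain ⟨r', t, ht, hp⟩ := ih (fun i hi => hq i (by omega)) (fun i hi => h2 i (by omega))
      (fun i hi => hO i (by omega)) r₂
    have hsize : stkSize (join (fun k => ([] : List (Γ k))) (Function.update (Function.update
        (R (n + 1)) .qry []) .cod (O (R (n + 1) .qry)))) ≤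
        stkSize (join (fun k => ([] : List (Γ k))) (R (n + 1))) + ℓ := by
      have h3 := stkSize_update (join (fun k => ([] : List (Γ k))) (R (n + 1))) (.inr .qry) []
      have h4 := stkSize_update (join (fun k => ([] : List (Γ k))) (Function.update (R (n + 1))
        .qry [])) (.inr .cod) (O (R (n + 1) .qry))
      rw [update_join_inr] at h3 h4
      have h5 := hO n (by omega)
      simp only [List.length_nil] at h3
      omega
    have hmid := hr₂.ok_right
    have hpath := Frag.Runs.path (Λ := DriverLabel P₁ P₂ P₃)
      (step := driverStep v₀ P₁ P₂ P₃ O)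
      (e := fun l => .inl (.inr l)) (x := .inr (.inr (some false)))
      (fun l v S => (driverStep_of_ne (by simp) v S).trans
        (congrArg some (stepAux_mapLabel _ _ v S))) hr₂
    refine ⟨r', 1 + (1 + (t₂ + t)), fun hρ => ?_, ?_⟩
    · have := ht hρ
      have := ht₂ hρ
      rw [add_one_mul]
      omega
    have hN : (n + 1) * (b₂ + ℓ + 2) = n * (b₂ + ℓ + 2) + b₂ + ℓ + 2 := by ring
    rw [add_comm 1 (1 + (t₂ + t)), add_comm 1 (t₂ + t), hN]
    refine .cons (c₁ := ⟨some (.inr (.inr (some true))), (v₀, some x, none, false),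
      join (fun _ => []) (R (n + 1))⟩) (fun _ => Nat.le_add_right _ _) ?_
      (.cons (fun _ => Nat.le_add_right _ _) (driverStep_ask _ _) (Path.trans
        (hpath.mono fun c hc hρ => (hc hρ).trans (by omega))
        (hp.mono fun c hc hρ => (hc hρ).trans ?_)))
    · rw [driverStep_of_ne (by simp)]
      simp [driverCode, hx]
    · have := hmid hρ
      omega

theorem driver_outputsWithin {x y : Str} {n : ℕ}
    (h1 : P₁.Does ρ v₀ (join (fun _ => []) (Function.update (fun _ => []) .inp x)) v₀
      (join (fun _ => []) (R n)) b₁)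
    (hq : ∀ i < n, R (i + 1) .qry ≠ []) (h0 : R 0 .qry = [])
    (h2 : ∀ i < n, P₂.Does ρ v₀ (join (fun _ => []) (Function.update (Function.update (R (i + 1))
      .qry []) .cod (O (R (i + 1) .qry)))) v₀ (join (fun _ => []) (R i)) b₂)
    (hO : ∀ i < n, (O (R (i + 1) .qry)).length ≤ ℓ)
    (h3 : P₃.Does ρ v₀ (join (fun _ => []) (R 0)) v₀
      (join (fun _ => []) (Function.update (fun _ => []) .cpy y)) b₃) :
    (driver v₀ P₁ P₂ P₃).OutputsWithin ρ O x y (x.length + b₁ + n * (b₂ + ℓ + 2) + b₃ + 2) := by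
  obtain ⟨r₁, t₁, ht₁, h1⟩ := h1 (none, none, false)
  obtain ⟨r₂, t₂, ht₂, h2⟩ := driver_rounds (P₁ := P₁) (P₃ := P₃) n hq h0 h2 hO r₁
  obtain ⟨r₃, t₃, ht₃, h3⟩ := h3 r₂
  have hm1 := h1.ok_right
  have hm2 := h2.ok_right
  have hx : stkSize (join (fun k => ([] : List (Γ k)))
      (Function.update (fun _ => ([] : List Bool)) Tape.inp x)) =
      x.length := by
    rw [stkSize_join, stkSize_nil, zero_add]
    exact stkSize_update_nil (Γ := fun _ : Tape => Bool) Tape.inp x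
  rw [hx] at hm1
  have hp1 := Frag.Runs.path (Λ := DriverLabel P₁ P₂ P₃)
    (step := driverStep v₀ P₁ P₂ P₃ O)
    (e := fun l => .inl (.inl l)) (x := .inr (.inr (some false)))
    (fun l v S => (driverStep_of_ne (by simp) v S).trans
      (congrArg some (stepAux_mapLabel _ _ v S))) h1
  have hp3 := Frag.Runs.path (Λ := DriverLabel P₁ P₂ P₃)
    (step := driverStep v₀ P₁ P₂ P₃ O)
    (e := fun l => .inr (.inl l)) (x := .inr (.inr none))
    (fun l v S => (driverStep_of_ne (by simp) v S).trans
      (congrArg some (stepAux_mapLabel _ _ v S))) h3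
  rw [hx] at hp1
  set b := x.length + b₁ + n * (b₂ + ℓ + 2) + b₃ + 2 with hb
  have hp3 := hp3.mono (ok' := fun c => ρ = .space → stkSize c.stk ≤ b)
    fun c hc hρ => (hc hρ).trans (by have := hm1 hρ; have := hm2 hρ; simp only at this; omega)
  have hp2 := h2.mono (ok' := fun c => ρ = .space → stkSize c.stk ≤ b)
    fun c hc hρ => (hc hρ).trans (by have := hm1 hρ; omega)
  have hp1 := hp1.mono (ok' := fun c => ρ = .space → stkSize c.stk ≤ b)
    fun c hc hρ => (hc hρ).trans (by omega)
  have hp := hp1.trans (hp2.trans (hp3.trans (.cons (c' := ⟨none, (v₀, none, none, false),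
    join (fun _ => []) (Function.update (fun _ => []) .cpy y)⟩) hp3.ok_right
    (driverStep_of_ne (by simp) _ _) (.refl hp3.ok_right))))
  have hjoin : ∀ (i : Tape) (l : List Bool), join (fun k => ([] : List (Γ k)))
      (Function.update (fun _ => []) i l) =
        (Function.update (fun _ => []) (Sum.inr i) l : ∀ k, List (SumΓ Γ Tape k)) := by
    intro i l
    rw [← update_join_inr]
    congr 1
    funext k
    cases k <;> rfl
  have e1 : StrTM.init (driver v₀ P₁ P₂ P₃).toTM2ComputableAux x =
      ⟨some (.inl (.inl P₁.entry)), (v₀, none, none, false),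
        join (fun _ => []) (Function.update (fun _ => []) .inp x)⟩ := by
    rw [StrTM.init, initList_eq, hjoin]
    exact congrArg (fun l : List Bool => (⟨some (.inl (.inl P₁.entry)), (v₀, none, none, false),
      Function.update (fun _ => []) (Sum.inr Tape.inp) l⟩ :
        Cfg (SumΓ Γ Tape) (DriverLabel P₁ P₂ P₃) (σ × Reg))) (List.map_id x)
  have e2 : StrTM.final (driver v₀ P₁ P₂ P₃).toTM2ComputableAux y =
      ⟨none, (v₀, none, none, false),
        join (fun _ => []) (Function.update (fun _ => []) .cpy y)⟩ := by
    rw [StrTM.final, haltList_eq, hjoin]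
    exact congrArg (fun l : List Bool => (⟨none, (v₀, none, none, false),
      Function.update (fun _ => []) (Sum.inr Tape.cpy) l⟩ :
        Cfg (SumΓ Γ Tape) (DriverLabel P₁ P₂ P₃) (σ × Reg))) (List.map_id y)
  unfold OracleTM.OutputsWithin
  rw [e1, e2]
  have hrun := hp.runsWithin (ρ := ρ) (size := fun c => stkSize c.stk) (b := b) rfl (fun hρ => by
    have := ht₁ hρ
    have := ht₂ hρ
    have := ht₃ hρ
    omega) fun hρ d hd => hd hρ
  exact hrun

end Driver

/-! ### Countability implies strong measure zero -/

theorem RunsWithin.mono {ρ : Resource} {C : Type} {step : C → Option C} {size : C → ℕ} {c₀ c₁ : C}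
    {b b' : ℕ} (h : RunsWithin ρ step size c₀ c₁ b) (hb : b ≤ b') :
    RunsWithin ρ step size c₀ c₁ b' := by
  cases ρ with
  | time => exact h.map fun e => ⟨e.1, e.2.trans hb⟩
  | space => exact ⟨h.1, fun c hc => (h.2 c hc).trans hb⟩

/-- There are finitely many queries of bounded length, so the supremum is not a junk value. -/
theorem length_le_answerLength (A : Str → Str) {n : ℕ} {q : Str} (hq : q.length ≤ n) :
    (A q).length ≤ answerLength A n := by
  refine le_csSup (Set.Finite.bddAbove ?_) ⟨q, hq, rfl⟩
  refine ((List.finite_length_le Bool n).image fun q => (A q).length).subset ?_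
  rintro m ⟨q, hq, rfl⟩
  exact ⟨q, hq, rfl⟩

/-! ### Assembly of the oracle machine for the functional. -/

namespace Frag

variable {ρ : Resource} {M : StrTM}

/-- Determine which results of constructors extend the string on `inp`, set up the number on
`acc`, and prepare the first query. -/
def initial (M : StrTM) : Frag (SumΓ M.tm.Γ Tape) (M.tm.σ × Reg) :=
  ((copy .inp .cod .tmp).seq ((fill true .cod .uno).seq ((copy .inp .idx .tmp).seq
    ((splitOnes .inp .num).seq ((clear .num).seq (dropTop .inp 1)))))).seq ((allBits M).seq
  (((copy .idx .num .tmp).seq ((fill false .num .acc).seq (copy .idx .cnt .tmp))).seq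
    ((addFraction.seq (move .inp .str)).seq prepare)))

/-- The input itself is kept on `idx` as a unary number: its length r + |w| + 1 is both the number
of binary places and the number of constructors taken into account. -/
theorem Does.initial {b l r : ℕ} {w : Str} {δ : ℕ → Str → Str} (hδ : ∀ k, IsConstructor (δ k))
    (h : ∀ k < (encodeNatStr r w).length, ∀ x, x.length < w.length → (δ k x).length ≤ l ∧
      RunsWithin ρ M.tm.step (cfgSize M.tm) (M.init (encodeNatStr k x)) (M.final (δ k x)) b) :
    (Frag.initial M).Does ρ M.tm.initialState
      (join (fun _ => []) (Function.update (fun _ => []) .inp (encodeNatStr r w)))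
      M.tm.initialState (join (fun _ => []) (roundStk (encodeNatStr r w)
        (branchBits δ w (encodeNatStr r w).length)
        (addBits (encodeNatStr r w).length (branchBits δ w (encodeNatStr r w).length)
          (List.replicate (encodeNatStr r w).length false))
        (w.take (w.length - 1)).reverse w []))
      (((30 * ((encodeNatStr r w).length + w.length + l + 4) + b + 1) * (w.length + 1) + 1) *
        (encodeNatStr r w).length +
        (22 * (encodeNatStr r w).length + 200) * ((encodeNatStr r w).length + 1)) := by
  set x := encodeNatStr r w with hx
  have hlen : x.length = r + w.length + 1 := length_encodeNatStr r w
  have hB : (branchBits δ w x.length).length = x.length := by simp [branchBits]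
  have h1 := ((Does.copy (ρ := ρ) (Γ := M.tm.Γ) (v := M.tm.initialState) (s := fun _ => [])
    (A := Function.update (fun _ => []) .inp x) (i := .inp) (j := .cod) (k := .tmp) (by decide)
    (by decide) (by decide) (by simp)).seq ((Does.fill (x := true) (i := .cod) (j := .uno)
    (by decide)).seq ((Does.copy (i := .inp) (j := .idx) (k := .tmp) (by decide) (by decide)
    (by decide) (by simp)).seq ((Does.splitOnes (i := .inp) (j := .num) (n := r) (l := false :: w)
    (by decide) (by simp [hx, encodeNatStr]) (by simp)).seq ((Does.clear (i := .num)).seq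
    (Does.dropTop (i := .inp) (n := 1))))))).congr (A'' := Function.update (Function.update
      (Function.update (fun _ => []) .inp w) .uno (List.replicate x.length true)) .idx x)
      (b' := 20 * (x.length + 3)) (by
        funext i
        cases i <;> simp) (by
        simp
        omega)
  have h2 := Does.allBits (ρ := ρ) (M := M) (w := w) (b := b) (l := l) hδ x.length
    (Function.update (Function.update (Function.update (fun _ => []) .inp w) .uno
      (List.replicate x.length true)) .idx x) h (by simp) (by simp) (by simp) (by simp) (by simp)
    (by simp) (by simp) (by simp) (by simp) (by simp) (by simp)
  have h2 := h2.congr (A'' := Function.update (roundStk x (branchBits δ w x.length) [] [] [] [])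
    .inp w) (by
      funext i
      cases i <;> simp [roundStk]) le_rfl
  have h3 := ((Does.copy (ρ := ρ) (Γ := M.tm.Γ) (v := M.tm.initialState) (s := fun _ => [])
    (A := Function.update (roundStk x (branchBits δ w x.length) [] [] [] []) .inp w) (i := .idx)
    (j := .num) (k := .tmp) (by decide) (by decide) (by decide) (by simp [roundStk])).seq
    ((Does.fill (x := false) (i := .num) (j := .acc) (by decide)).seq (Does.copy (i := .idx)
    (j := .cnt) (k := .tmp) (by decide) (by decide) (by decide) (by simp [roundStk])))).congr
    (A'' := Function.update (Function.update (roundStk x (branchBits δ w x.length)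
      (List.replicate x.length false) [] [] []) .inp w) .cnt x) (b' := 20 * (x.length + 3)) (by
        funext i
        cases i <;> simp [roundStk]) (by
        simp [roundStk]
        omega)
  have h4 := ((Does.addFraction (ρ := ρ) (Γ := M.tm.Γ) (v := M.tm.initialState)
    (s := fun _ => []) (Q := 2 * x.length) (A := Function.update (Function.update (roundStk x
      (branchBits δ w x.length) (List.replicate x.length false) [] [] []) .inp w) .cnt x)
    (by simp [roundStk]) (by simp [roundStk]) (by simp [roundStk]) (by simp [roundStk])
    (by simp; omega) (by simp [roundStk, hB]; omega)).seq
    (Does.move (i := .inp) (j := .str) (by decide))).congr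
    (A'' := roundStk x (branchBits δ w x.length) (addBits x.length (branchBits δ w x.length)
      (List.replicate x.length false)) (w.take w.length).reverse [] [])
    (b' := (22 * x.length + 53) * (x.length + 1) + 2 * (w.length + 2)) (by
      funext i
      cases i <;> simp [roundStk]) (by
      simp [roundStk, hB]
      rw [show 11 * (2 * x.length) = 22 * x.length by ring])
  have h5 := Does.prepare (ρ := ρ) (Γ := M.tm.Γ) (v := M.tm.initialState) (s := fun _ => [])
    (w := w) (idx := x) (bts := branchBits δ w x.length) (acc := addBits x.length
      (branchBits δ w x.length) (List.replicate x.length false)) le_rfl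
  refine (h1.seq (h2.seq (h3.seq (h4.seq h5)))).congr ?_ ?_
  · rw [List.take_length]
  · have h6 : (22 * x.length + 200) * (x.length + 1) = (22 * x.length + 53) * (x.length + 1) +
      147 * (x.length + 1) := by ring
    omega

end Frag

/-- Here `N` stands for |w| + r + ℓ, `T` for the cost of one call of a constructor, `m` for the
length of the input, `r` for that of an answer and `q` for that of the numerator. The total is
polynomial in `N` and only linear in `T`. -/
theorem cost_bound {m n N l T a r q : ℕ} (hm : m ≤ N + 1) (hn : n ≤ N) (hl : l ≤ 2 * N + a * T)
    (ha : 1 ≤ a) (hr : r ≤ N) (hq : q ≤ (N + 1) * (N + 2)) :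
    m + (((30 * (m + n + l + 4) + T + 1) * (n + 1) + 1) * m + (22 * m + 200) * (m + 1)) +
      n * (100 * (4 * (N + 1) ^ 2 + 1) * (m + 1) + r + 2) + 10 * (m + m + q + 3) + 2 ≤
      4000 * a * ((N + 1) ^ 4 * (T + 1)) := by
  obtain ⟨P, hP⟩ : ∃ P, P = N + 1 := ⟨_, rfl⟩
  obtain ⟨Z, hZ⟩ : ∃ Z, Z = a * (P ^ 4 * (T + 1)) := ⟨_, rfl⟩
  have hP1 : 1 ≤ P := by omega
  have hpow : ∀ i ≤ 4, P ^ i ≤ P ^ 4 := fun i hi => Nat.pow_le_pow_right hP1 hi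
  have hZ4 : P ^ 4 ≤ Z := by
    rw [hZ]
    exact (Nat.le_mul_of_pos_right _ (Nat.succ_pos T)).trans (Nat.le_mul_of_pos_left _ ha)
  have hZi : ∀ i ≤ 4, P ^ i ≤ Z := fun i hi => (hpow i hi).trans hZ4
  have h1 : 30 * (m + n + l + 4) + T + 1 ≤ 300 * (a * P * (T + 1)) := by
    have e1 : P ≤ a * P * (T + 1) :=
      (Nat.le_mul_of_pos_left _ ha).trans (Nat.le_mul_of_pos_right _ (Nat.succ_pos T))
    have e2 : a * T ≤ a * P * (T + 1) := by
      calc a * T ≤ (a * P) * T := Nat.mul_le_mul_right _ (Nat.le_mul_of_pos_right _ hP1)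
        _ ≤ _ := Nat.mul_le_mul_left _ (Nat.le_succ T)
    have e3 : T ≤ a * T := Nat.le_mul_of_pos_left _ ha
    omega
  have h2 : ((30 * (m + n + l + 4) + T + 1) * (n + 1) + 1) * m ≤ 301 * Z := by
    calc ((30 * (m + n + l + 4) + T + 1) * (n + 1) + 1) * m
        ≤ (300 * (a * P * (T + 1)) * P + 1) * P :=
          Nat.mul_le_mul (Nat.add_le_add_right (Nat.mul_le_mul h1 (by omega)) 1) (by omega)
      _ = 300 * (a * (P ^ 3 * (T + 1))) + P ^ 1 := by ring
      _ ≤ 300 * Z + Z := by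
          refine add_le_add (Nat.mul_le_mul_left _ ?_) (hZi 1 (by omega))
          rw [hZ]
          exact Nat.mul_le_mul_left _ (Nat.mul_le_mul_right _ (hpow 3 (by omega)))
      _ = _ := by ring
  have h3 : (22 * m + 200) * (m + 1) ≤ 444 * Z := by
    calc (22 * m + 200) * (m + 1) ≤ (222 * P) * (2 * P) := Nat.mul_le_mul (by omega) (by omega)
      _ = 444 * P ^ 2 := by ring
      _ ≤ _ := Nat.mul_le_mul_left _ (hZi 2 (by omega))
  have h4 : n * (100 * (4 * P ^ 2 + 1) * (m + 1) + r + 2) ≤ 1003 * Z := by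
    have e1 : 1 ≤ P ^ 2 := Nat.one_le_pow _ _ hP1
    calc n * (100 * (4 * P ^ 2 + 1) * (m + 1) + r + 2)
        ≤ P * (100 * (5 * P ^ 2) * (2 * P) + 3 * P) := by
          refine Nat.mul_le_mul (by omega) ?_
          have : 100 * (4 * P ^ 2 + 1) * (m + 1) ≤ 100 * (5 * P ^ 2) * (2 * P) :=
            Nat.mul_le_mul (by omega) (by omega)
          omega
      _ = 1000 * P ^ 4 + 3 * P ^ 2 := by ring
      _ ≤ 1000 * Z + 3 * Z := add_le_add (Nat.mul_le_mul_left _ (hZi 4 le_rfl))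
          (Nat.mul_le_mul_left _ (hZi 2 (by omega)))
      _ = _ := by ring
  have h5 : q ≤ 2 * Z := by
    calc q ≤ P * (P + 1) := by rw [hP]; exact hq
      _ ≤ P * (2 * P) := Nat.mul_le_mul_left _ (by omega)
      _ = 2 * P ^ 2 := by ring
      _ ≤ _ := Nat.mul_le_mul_left _ (hZi 2 (by omega))
  have h6 := hZi 1 (by omega)
  rw [pow_one] at h6
  rw [mul_assoc 4000 a, ← hP, ← hZ]
  rw [← hP] at hm
  omega

namespace ResourceClass

variable {Δ : ResourceClass}

/-- Polynomially many constructor calls are made, on inputs of length at most `2 * N`. Robustness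
absorbs both the maximum of `t` up to `2 * N` and the factor `(N + 1) ^ 4`. -/
theorem hasFunctional_branchCapital (hΔ : Δ.IsRobust) {δ : ℕ → Str → Str} {f : Str → Str}
    (hf : f ∈ Δ.functions) (hfδ : ∀ k w, f (encodeNatStr k w) = δ k w)
    (hδ : ∀ k, IsConstructor (δ k)) : Δ.HasFunctional (branchCapital δ) := by
  obtain ⟨t, ht, M, hM⟩ := hf
  refine ⟨fun N => 4000 * (maxPushes M.tm + 1) * ((N + 1) ^ 4 * (maxUpTo t N + 1)), ?_,
    driver M.tm.initialState (Frag.initial M) Frag.absorb Frag.finish, fun O r w => ?_⟩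
  · exact (hΔ.succ_pow_mul ((hΔ.maxUpTo ht).add (Δ.isBound_const 1)) 4).const_mul _
  set h : ℕ → ℕ := fun N => 4000 * (maxPushes M.tm + 1) * ((N + 1) ^ 4 * (maxUpTo t N + 1)) with hh
  -- The queries are prefixes of `w`; this makes them short enough for their answers to be counted
  -- in `ℓ`.
  have hle : ∀ n, n ≤ h n := by
    intro n
    have h1 : n + 1 ≤ (n + 1) ^ 4 := Nat.le_self_pow (by omega) _
    have h2 : (n + 1) ^ 4 ≤ (n + 1) ^ 4 * (maxUpTo t n + 1) :=
      Nat.le_mul_of_pos_right _ (Nat.succ_pos _)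
    have h3 := Nat.le_mul_of_pos_left ((n + 1) ^ 4 * (maxUpTo t n + 1))
      (show 0 < 4000 * (maxPushes M.tm + 1) by omega)
    rw [hh]
    simp only
    omega
  set A : Str → Str := fun v => encodeRat (O v) with hA
  set ℓ := answerLength A (h (w.length + r)) with hℓ
  set N := w.length + r + ℓ with hN
  set x := encodeNatStr r w with hx
  have hlen : x.length = r + w.length + 1 := length_encodeNatStr r w
  set B := branchBits δ w x.length with hB
  have hBlen : B.length = x.length := by simp [hB, branchBits]
  set num := numerator O x.length B w with hnum
  refine ⟨pairStr (num w.length) (List.replicate x.length false ++ [true]),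
    binVal (num w.length) / 2 ^ x.length, ⟨_, _, rfl, ?_, ?_⟩, ?_, ?_⟩
  · rw [binVal_append]; simp [binVal_cons]
  · rw [binVal_append, binVal_replicate_false]; simp [binVal_cons]
  · rw [hnum, hB, hlen]
    exact branchCapital_approx O w r
  -- With `i` rounds left, the |w| - i longest prefixes have been dealt with, and the prefix of
  -- length `i` is the next query.
  set R : ℕ → Tape → List Bool := fun i => Frag.roundStk x B (num (w.length - i))
    (w.take (i - 1)).reverse (w.take i) [] with hR
  have hnumlen : ∀ i, (num (w.length - i)).length + B.length ≤ 4 * (N + 1) ^ 2 := by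
    intro i
    have h1 := length_numerator_le O x.length B w (w.length - i)
    rw [hBlen] at h1 ⊢
    have h2 : x.length + (w.length - i + 1) * x.length + x.length ≤
        (N + 1) + (N + 1) * (N + 1) + (N + 1) :=
      add_le_add (add_le_add (by omega) (Nat.mul_le_mul (by omega) (by omega))) (by omega)
    nlinarith
  have hans : ∀ q : Str, q.length ≤ w.length → (A q).length ≤ ℓ := fun q hq =>
    length_le_answerLength A (hq.trans ((Nat.le_add_right _ r).trans (hle _)))
  have hout := driver_outputsWithin (ρ := Δ.kind) (v₀ := M.tm.initialState)
    (P₁ := Frag.initial M) (P₂ := Frag.absorb) (P₃ := Frag.finish) (O := A) (R := R) (x := x)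
    (y := pairStr (num w.length) (List.replicate x.length false ++ [true])) (n := w.length)
    (ℓ := ℓ) (b₂ := 100 * (4 * (N + 1) ^ 2 + 1) * (x.length + 1))
    (b₁ := ((30 * (x.length + w.length + (2 * N + (maxPushes M.tm + 1) * maxUpTo t N) + 4) +
      maxUpTo t N + 1) * (w.length + 1) + 1) * x.length + (22 * x.length + 200) * (x.length + 1))
    (b₃ := 10 * (x.length + x.length + (num w.length).length + 3)) ?_ ?_ ?_ ?_ ?_ ?_
  · change RunsWithin _ _ _ _ _ _ at hout ⊢
    refine hout.mono ?_
    have hc := cost_bound (m := x.length) (n := w.length) (N := N)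
      (l := 2 * N + (maxPushes M.tm + 1) * maxUpTo t N) (T := maxUpTo t N)
      (a := maxPushes M.tm + 1) (r := ℓ) (q := (num w.length).length) (by omega) (by omega)
      le_rfl (by omega) (by omega) (by
        refine (length_numerator_le O x.length B w w.length).trans ?_
        rw [hBlen]
        calc x.length + (w.length + 1) * x.length ≤ (N + 1) + (N + 1) * (N + 1) :=
              add_le_add (by omega) (Nat.mul_le_mul (by omega) (by omega))
          _ = _ := by ring)
    exact hc
  · have hR0 : R w.length = Frag.roundStk x B (addBits x.length B (List.replicate x.length false))
        (w.take (w.length - 1)).reverse w [] := by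
      rw [hR]
      simp only [Nat.sub_self, List.take_length]
      rfl
    rw [hR0]
    refine Frag.Does.initial hδ fun k hk u hu => ?_
    have hk : k < x.length := hk
    have hrun := hM (encodeNatStr k u)
    rw [hfδ] at hrun
    -- Here k ≤ r + |w| and |u| < |w|, so the code has length at most r + 2|w|; this accounts for
    -- the factor 2 in the definition of robustness.
    have hj : (encodeNatStr k u).length ≤ 2 * N := by rw [length_encodeNatStr]; omega
    have hrun := hrun.mono (le_maxUpTo hj)
    exact ⟨hrun.length_le.trans (Nat.add_le_add_right hj _), hrun⟩
  · intro i hi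
    simp only [hR, Frag.roundStk]
    intro h0
    have := congrArg List.length h0
    rw [List.length_take, List.length_nil] at this
    omega
  · simp [hR, Frag.roundStk]
  · intro i hi
    have hO := (O (w.take (i + 1))).2.1
    have h1 := Frag.Does.absorb (ρ := Δ.kind) (Γ := M.tm.Γ) (v := M.tm.initialState)
      (s := fun _ => []) (w := w) (j := i) (Q := 4 * (N + 1) ^ 2) (idx := x) (bts := B)
      (acc := num (w.length - (i + 1))) hO (by omega) (by nlinarith) (by nlinarith)
      (hnumlen _) ((hans _ (by simp)).trans (by nlinarith))
    have h2 : num (w.length - i) = addBits (places x.length (O (w.take (i + 1)))) B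
        (num (w.length - (i + 1))) := by
      rw [show w.length - i = w.length - (i + 1) + 1 by omega, hnum, numerator,
        show w.length - (w.length - (i + 1)) = i + 1 by omega]
    rw [← h2, hBlen] at h1
    have h3 : Function.update (Function.update (R (i + 1)) .qry []) .cod (A (R (i + 1) .qry)) =
        Frag.roundStk x B (num (w.length - (i + 1))) (w.take i).reverse []
          (encodeRat (O (w.take (i + 1)))) := by
      funext k
      cases k <;> simp [hR, Frag.roundStk, hA]
    rw [h3]
    exact h1
  · intro i hi
    exact hans _ (by simp [hR, Frag.roundStk])
  · have h1 := Frag.Does.finish (ρ := Δ.kind) (Γ := M.tm.Γ) (v := M.tm.initialState)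
      (s := fun _ => []) (idx := x) (bts := B) (acc := num w.length)
    rw [hBlen] at h1
    have h2 : R 0 = Frag.roundStk x B (num w.length) [] [] [] := by simp [hR]
    rw [h2]
    exact h1

theorem IsCountable.hasStrongMeasureZero (hΔ : Δ.IsRobust) {X : Set Cantor}
    (hX : Δ.IsCountable X) : Δ.HasStrongMeasureZero X := by
  obtain ⟨δ, ⟨f, hf, hfδ⟩, hδ, hX⟩ := hX
  exact ⟨branchCapital δ, hasFunctional_branchCapital hΔ hf hfδ hδ, fun O hO =>
    ⟨isSupermartingale_branchCapital hδ O, succeeds_branchCapital hδ hO hX⟩⟩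

end ResourceClass

end StrongMeasureZero

end

/-- The effective Borel conjecture for time or space bounded resource classes. -/
theorem mainTheorem2 (Δ : StrongMeasureZero.ResourceClass)
    (X : Set StrongMeasureZero.Cantor) :
    (Δ.HasStrongMeasureZero X → Δ.IsCountable X) ∧
      (Δ.IsRobust → (Δ.HasStrongMeasureZero X ↔ Δ.IsCountable X)) := by
  exact ⟨fun h => h.isCountable, fun hΔ => ⟨fun h => h.isCountable,
    fun h => h.hasStrongMeasureZero hΔ⟩⟩
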